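/- Let $G$ be a real semisimple Lie group with Lie algebra $\mathfrak g$ and Cartan decomposition $\mathfrak g=\mathfrak k\oplus\mathfrak p$ (presented as a covering group of a closed, transpose-stable subgroup of $GL(N,\mathbb R)$, with Cartan involution $X\mapsto -X^{T}$; the adjoint representation always provides such a presentation), and let $K$ be the subgroup of elements whose matrix is orthogonal. Let $\mathfrak a\subset\mathfrak p$ be maximal abelian, $\ell=\dim\mathfrak a$, $\Sigma$ the restricted roots with root spaces $\mathfrak g_\alpha$, $\Sigma^+$ the positive roots for a lexicographic order, and $2\rho=\sum_{\alpha\in\Sigma^+}(\dim\mathfrak g_\alpha)\,\alpha$. Let $A,N,V$ be the analytic subgroups of $\mathfrak a$, $\mathfrak n=\bigoplus_{\alpha\in\Sigma^+}\mathfrak g_\alpha$, $\mathfrak v=\bigoplus_{\alpha\in\Sigma^+}\mathfrak g_{-\alpha}$, let $M=Z_K(\mathfrak a)$, and for $g\in VMAN$ write $g=v(g)m(g)a(g)n(g)$. For $\mu\in\mathfrak a_{\mathbb C}^*$ put $\chi_\mu(a)=e^{\mu(\log a)}$ and $\xi_{-\rho}(g)=\chi_{-\rho}(a(g))$. Let $w$,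 in the identity component of $G$, normalize $\mathfrak a$ and represent the Weyl group element that maps $\Sigma^+$ to $-\Sigma^+$. Let $\mathfrak v'$ be the set of $X\in\mathfrak v$ which for no simple root $\alpha$ lie in the sum of the $\mathfrak g_{-\beta}$, $\beta\in\Sigma^+$, $\beta\notin\mathbb R\alpha$; put $V'=\exp\mathfrak v'$, on which $A$ acts by conjugation, and give $V'$ the $A$-invariant measure $d\mu(x)=\xi_{-\rho}(w^{-1}x)\,dx$, where $dx$ is a Haar measure of $V$. Let $\sigma$ be a finite-dimensional unitary representation of $M$ on $W$ and let $\chi_\lambda$ be a unitary character of $A$; let $\chi_{\lambda'}$ be the contragredient character, $\chi_\lambda\overline{\chi_{\lambda'}}=1$. The principal series acts on $W$-valued functions on $V$ by $$U(\sigma,\lambda)(g)f(x)=\sigma(m(g^{-1}x))^{-1}\chi_{\lambda+\rho}(a(g^{-1}x))^{-1}f(v(g^{-1}x)).$$ Its $A$-adapted realization is $\widetilde U=T\circ U\circ T^{-1}$, $Tf(x)=\xi_{-\rho}(w^{-1}x)^{-1/2}f(x)$, on $\widetilde{\mathcal H}=L^2(V',W;\mu)$, with matrix coefficients $c_{f,g}(y)=\int_{V'}\langle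 \widetilde U(y)f(x),g(x)\rangle_\sigma\,d\mu(x)$. Identify $\mathfrak a$ with $\mathbb R^\ell$ by a linear isomorphism, give $A=\exp\mathfrak a$ the Haar measure $da$ that corresponds to Lebesgue measure, and let $d\upsilon$ be $(2\pi)^{-\ell}$ times Lebesgue measure on $\mathbb R^\ell$. Then there is exactly one measure $d\omega$ on $A\backslash V'$ such that $\int_{V'}\varphi\,d\mu=\int_{A\backslash V'}\int_A\varphi(a\cdot\omega)\,da\,d\omega$ for all measurable $\varphi\ge 0$, and $V'\to A\backslash V'$ has a continuous section. Fix any continuous section $s$ and put $f(t,\omega)=f(t\cdot s(\omega))$ for $t\in A$. **Theorem 4.1.** Let $f\in\widetilde{\mathcal H}(\sigma,\lambda)$ and $g\in\widetilde{\mathcal H}(\sigma,\lambda')$ (not necessarily $K$-finite). For almost every $\omega$ the functions $t\mapsto\chi_\lambda(t)^{-1}f(t,\omega)$ and $t\mapsto\chi_{\lambda'}(t)^{-1}g(t,\omega)$ are in $L^2(A)$, and their $L^2$ Fourier transforms $\widetilde f(\cdot,\omega)$, $\widetilde g(\cdot,\omega)$, for example $$\widetilde f(\upsilon,\omega)=\int_A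 e^{-i\upsilon\cdot\log t}\,\chi_\lambda(t)^{-1}f(t,\omega)\,dt \quad\text{(in the } L^2 \text{ sense)},$$ have versions that are jointly measurable in $(\upsilon,\omega)$. For all such versions, and for almost every $\upsilon\in\mathbb R^\ell$, the integral $$m(\lambda,\upsilon)=\int_{A\backslash V'}\langle\widetilde f(\upsilon,\omega),\widetilde g(\upsilon,\omega)\rangle_\sigma\,d\omega$$ converges absolutely. The function $m(\lambda,\cdot)$ is integrable on $\mathbb R^\ell$, and for every $a\in A$ the integral defining $c_{f,g}(a)$ converges absolutely and $$c_{f,g}(a)=\int_{\mathbb R^\ell}e^{-i\upsilon\cdot\log a}\,m(\lambda,\upsilon)\,d\upsilon .$$ -/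

import Mathlib

open MeasureTheory
open scoped Matrix ENNReal

noncomputable section

attribute [local instance 100] LieRing.ofAssociativeRing

/-- A real semisimple Lie group `G` together with a Cartan involution, presented as a covering
group of a closed linear group which is stable under transposition.

`toGL` is a covering homomorphism of `G` onto a closed subgroup of `GL (N, ℝ)` that is stable under
`g ↦ gᵀ`, and `lie` is the Lie algebra of that subgroup, i.e. the set of matrices `X` all of whose
exponentials `exp (t X)` lie in it.  The differential of `toGL` identifies `lie` with the Lie
algebra of `G`; the Cartan involution is `X ↦ -Xᵀ`.

Linear groups are the case where `toGL` is injective.  There is no loss of generality for other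
groups: if `G` is a Lie group with semisimple Lie algebra `𝔤` and Cartan involution `θ`, one can
take for `toGL` the adjoint representation, written in a basis of `𝔤` which is orthonormal for
`-B (X, θ Y)`, where `B` is the Killing form.  `G` is not assumed to be connected or to have
finite center. -/
structure SemisimpleLieGroup (G : Type*) [Group G] [TopologicalSpace G] (N : ℕ) where
  toGL : G →* GL (Fin N) ℝ
  isCoveringMap : IsCoveringMap toGL.rangeRestrict
  isClosed_range : IsClosed (toGL.range : Set (GL (Fin N) ℝ))
  exists_transpose : ∀ g : G, ∃ g' : G,
    (toGL g' : Matrix (Fin N) (Fin N) ℝ) = (toGL g : Matrix (Fin N) (Fin N) ℝ)ᵀ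
  lie : LieSubalgebra ℝ (Matrix (Fin N) (Fin N) ℝ)
  mem_lie_iff : ∀ X : Matrix (Fin N) (Fin N) ℝ, X ∈ lie ↔
    ∀ t : ℝ, ∃ g : G, (toGL g : Matrix (Fin N) (Fin N) ℝ) = NormedSpace.exp (t • X)
  isSemisimple : LieAlgebra.IsSemisimple ℝ lie

namespace SemisimpleLieGroup

variable {G : Type*} [Group G] [TopologicalSpace G] {N : ℕ} (S : SemisimpleLieGroup G N)

/-- The matrix of an element of `G`. -/
def mat (g : G) : Matrix (Fin N) (Fin N) ℝ := (S.toGL g : Matrix (Fin N) (Fin N) ℝ)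

/-- The adjoint action of `G` on matrices (in particular on the Lie algebra). -/
def Ad (g : G) (X : Matrix (Fin N) (Fin N) ℝ) : Matrix (Fin N) (Fin N) ℝ :=
  S.mat g * X * S.mat g⁻¹

/-- `g = exp X` in `G`: there is a continuous one-parameter subgroup `γ` of `G` with
infinitesimal generator `X` and `γ 1 = g`. -/
def IsExp (X : Matrix (Fin N) (Fin N) ℝ) (g : G) : Prop :=
  ∃ γ : ℝ → G, Continuous γ ∧ (∀ s t, γ (s + t) = γ s * γ t) ∧
    (∀ t, S.mat (γ t) = NormedSpace.exp (t • X)) ∧ γ 1 = g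

open Classical in
/-- The exponential map of `G` (with value `1` off the Lie algebra). -/
def exp (X : Matrix (Fin N) (Fin N) ℝ) : G :=
  if h : ∃ g, S.IsExp X g then h.choose else 1

/-- The analytic subgroup corresponding to a subspace (in practice, a subalgebra) `h`: the
subgroup generated by the `exp X`, `X ∈ h`. -/
def analyticSubgroup (h : Submodule ℝ (Matrix (Fin N) (Fin N) ℝ)) : Subgroup G :=
  Subgroup.closure {g | ∃ X ∈ h, S.IsExp X g}

lemma mat_one : S.mat 1 = 1 := by simp [mat]

lemma mat_mul (g h : G) : S.mat (g * h) = S.mat g * S.mat h := by simp [mat]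

lemma mat_mul_inv (g : G) : S.mat g * S.mat g⁻¹ = 1 := by
  rw [← mat_mul, mul_inv_cancel, mat_one]

lemma mat_inv_mul (g : G) : S.mat g⁻¹ * S.mat g = 1 := by
  rw [← mat_mul, inv_mul_cancel, mat_one]

lemma Ad_mul (g h : G) (X : Matrix (Fin N) (Fin N) ℝ) : S.Ad (g * h) X = S.Ad g (S.Ad h X) := by
  simp only [Ad, mat_mul, mul_inv_rev, Matrix.mul_assoc]

lemma Ad_one (X : Matrix (Fin N) (Fin N) ℝ) : S.Ad 1 X = X := by
  simp [Ad, mat_one]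

lemma exp_Ad (g : G) (X : Matrix (Fin N) (Fin N) ℝ) :
    NormedSpace.exp (S.Ad g X) = S.Ad g (NormedSpace.exp X) := by
  have h := Matrix.exp_units_conj (S.toGL g) X
  simpa [Ad, mat] using h

lemma Ad_smul (g : G) (t : ℝ) (X : Matrix (Fin N) (Fin N) ℝ) :
    S.Ad g (t • X) = t • S.Ad g X := by
  simp [Ad]

/-- `Ad g` as a linear map. -/
def AdLin (g : G) : Matrix (Fin N) (Fin N) ℝ →ₗ[ℝ] Matrix (Fin N) (Fin N) ℝ where
  toFun := S.Ad g
  map_add' X Y := by simp [Ad, Matrix.mul_add, Matrix.add_mul]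
  map_smul' t X := S.Ad_smul g t X

lemma Ad_mem_lie (g : G) {X : Matrix (Fin N) (Fin N) ℝ} (hX : X ∈ S.lie) : S.Ad g X ∈ S.lie := by
  rw [S.mem_lie_iff] at hX ⊢
  intro t
  obtain ⟨h, hh⟩ := hX t
  refine ⟨g * h * g⁻¹, ?_⟩
  rw [← Ad_smul, exp_Ad, ← hh]
  simp [Ad, mat]

lemma IsExp.conj [IsTopologicalGroup G] {X : Matrix (Fin N) (Fin N) ℝ} {x : G}
    (h : S.IsExp X x) (g : G) : S.IsExp (S.Ad g X) (g * x * g⁻¹) := by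
  obtain ⟨γ, hc, hm, he, h1⟩ := h
  refine ⟨fun t => g * γ t * g⁻¹, by fun_prop, fun s t => ?_, fun t => ?_, by simp [h1]⟩
  · simp only [hm]; group
  · rw [← Ad_smul, exp_Ad, ← he, Ad, mat_mul, mat_mul]

lemma conj_mem_analyticSubgroup [IsTopologicalGroup G]
    {h : Submodule ℝ (Matrix (Fin N) (Fin N) ℝ)} {g : G} (hg : ∀ X ∈ h, S.Ad g X ∈ h) {x : G}
    (hx : x ∈ S.analyticSubgroup h) : g * x * g⁻¹ ∈ S.analyticSubgroup h := by
  induction hx using Subgroup.closure_induction with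
  | mem x hx =>
    obtain ⟨X, hX, hXx⟩ := hx
    exact Subgroup.subset_closure ⟨_, hg X hX, IsExp.conj S hXx g⟩
  | one => simp
  | mul x y _ _ hx hy =>
    have : g * (x * y) * g⁻¹ = (g * x * g⁻¹) * (g * y * g⁻¹) := by group
    rw [this]; exact Subgroup.mul_mem _ hx hy
  | inv x _ hx =>
    have : g * x⁻¹ * g⁻¹ = (g * x * g⁻¹)⁻¹ := by group
    rw [this]; exact Subgroup.inv_mem _ hx

/-- The subgroup `K` fixed by the Cartan involution: elements whose matrix is orthogonal. -/
def K : Subgroup G where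
  carrier := {g | S.mat g * (S.mat g)ᵀ = 1}
  one_mem' := by simp [mat_one]
  mul_mem' {g h} hg hh := by
    simp only [Set.mem_ofPred_eq] at hg hh ⊢
    calc S.mat (g * h) * (S.mat (g * h))ᵀ
        = S.mat g * (S.mat h * (S.mat h)ᵀ) * (S.mat g)ᵀ := by
          rw [mat_mul, Matrix.transpose_mul]; simp only [Matrix.mul_assoc]
      _ = 1 := by rw [hh, Matrix.mul_one, hg]
  inv_mem' {g} hg := by
    simp only [Set.mem_ofPred_eq] at hg ⊢
    have h1 : S.mat g⁻¹ = (S.mat g)ᵀ := by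
      calc S.mat g⁻¹ = S.mat g⁻¹ * (S.mat g * (S.mat g)ᵀ) := by rw [hg, Matrix.mul_one]
        _ = (S.mat g)ᵀ := by rw [← Matrix.mul_assoc, mat_inv_mul, Matrix.one_mul]
    rw [h1, Matrix.transpose_transpose, ← h1, mat_inv_mul]

end SemisimpleLieGroup

/-- A maximal abelian subspace `𝔞` of `𝔭 = {X ∈ 𝔤 | Xᵀ = X}`, and an ordered basis of `𝔞`, which
gives the lexicographic order on the dual of `𝔞`.  These data determine the minimal parabolic
subgroup `MAN`. -/
structure MinimalParabolic {G : Type*} [Group G] [TopologicalSpace G] {N : ℕ}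
    (S : SemisimpleLieGroup G N) where
  𝔞 : Submodule ℝ (Matrix (Fin N) (Fin N) ℝ)
  mem_lie : ∀ H ∈ 𝔞, H ∈ S.lie
  symmetric : ∀ H ∈ 𝔞, Hᵀ = H
  commute : ∀ H ∈ 𝔞, ∀ H' ∈ 𝔞, H * H' = H' * H
  maximal : ∀ X ∈ S.lie, Xᵀ = X → (∀ H ∈ 𝔞, X * H = H * X) → X ∈ 𝔞
  order : Module.Basis (Fin (Module.finrank ℝ 𝔞)) ℝ 𝔞

namespace MinimalParabolic

variable {G : Type*} [Group G] [TopologicalSpace G] {N : ℕ}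
  {S : SemisimpleLieGroup G N} (P : MinimalParabolic S)

/-! ### Restricted roots and the subalgebras they define -/

/-- The common eigenspace `𝔤_α` of `ad 𝔞` on the Lie algebra. -/
def rootSpace (α : Module.Dual ℝ P.𝔞) : Submodule ℝ (Matrix (Fin N) (Fin N) ℝ) where
  carrier := {X | X ∈ S.lie ∧ ∀ H : P.𝔞, (H : Matrix (Fin N) (Fin N) ℝ) * X - X * H = α H • X}
  add_mem' {X Y} hX hY := ⟨add_mem hX.1 hY.1, fun H => by
    rw [smul_add, ← hX.2 H, ← hY.2 H, Matrix.mul_add, Matrix.add_mul]; abel⟩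
  zero_mem' := ⟨zero_mem _, fun H => by simp⟩
  smul_mem' c X hX := ⟨S.lie.smul_mem c hX.1, fun H => by
    rw [smul_comm, ← hX.2 H, Matrix.mul_smul, Matrix.smul_mul, smul_sub]⟩

/-- The set `Σ` of restricted roots. -/
def roots : Set (Module.Dual ℝ P.𝔞) := {α | α ≠ 0 ∧ P.rootSpace α ≠ ⊥}

/-- Positivity in the lexicographic order: the first nonzero coordinate is positive. -/
def IsPos (α : Module.Dual ℝ P.𝔞) : Prop :=
  ∃ i, 0 < α (P.order i) ∧ ∀ j < i, α (P.order j) = 0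

/-- The set `Σ⁺` of positive restricted roots. -/
def posRoots : Set (Module.Dual ℝ P.𝔞) := {α | α ∈ P.roots ∧ P.IsPos α}

/-- The simple roots: the positive roots which are not a sum of two positive roots. -/
def simpleRoots : Set (Module.Dual ℝ P.𝔞) :=
  {α | α ∈ P.posRoots ∧ ∀ β ∈ P.posRoots, ∀ γ ∈ P.posRoots, α ≠ β + γ}

/-- Half the sum of the positive roots, counted with multiplicity. -/
def rho : Module.Dual ℝ P.𝔞 :=
  (1 / 2 : ℝ) • ∑ᶠ α ∈ P.posRoots, (Module.finrank ℝ (P.rootSpace α) : ℝ) • α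

/-- `𝔫`, the sum of the positive root spaces. -/
def 𝔫 : Submodule ℝ (Matrix (Fin N) (Fin N) ℝ) := ⨆ α ∈ P.posRoots, P.rootSpace α

/-- `𝔳`, the sum of the negative root spaces. -/
def 𝔳 : Submodule ℝ (Matrix (Fin N) (Fin N) ℝ) := ⨆ α ∈ P.posRoots, P.rootSpace (-α)

/-- For a simple root `α`, the sum of the eigenspaces of `𝔳` whose root is not a multiple of `α`
(the complement `Wᶜ` of the sum `W` of the eigenspaces in `𝔳` for multiples of `α`). -/
def complementOf (α : Module.Dual ℝ P.𝔞) : Submodule ℝ (Matrix (Fin N) (Fin N) ℝ) :=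
  ⨆ β ∈ {β | β ∈ P.posRoots ∧ ∀ t : ℝ, β ≠ t • α}, P.rootSpace (-β)

/-- `𝔳'`: the complement in `𝔳` of the subspaces `Wᶜ` attached to the simple roots. -/
def 𝔳' : Set (Matrix (Fin N) (Fin N) ℝ) :=
  {X | X ∈ P.𝔳 ∧ ∀ α ∈ P.simpleRoots, X ∉ P.complementOf α}

/-! ### The subgroups -/

/-- `A`, the analytic subgroup of `𝔞`. -/
def A : Subgroup G := S.analyticSubgroup P.𝔞

/-- `N`, the analytic subgroup of `𝔫`. -/
def Nplus : Subgroup G := S.analyticSubgroup P.𝔫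

/-- `V`, the analytic subgroup of `𝔳`. -/
def V : Subgroup G := S.analyticSubgroup P.𝔳

/-- The centralizer of `𝔞` in `G`. -/
def centralizer : Subgroup G where
  carrier := {g | ∀ H ∈ P.𝔞, S.mat g * H = H * S.mat g}
  one_mem' := by simp [SemisimpleLieGroup.mat_one]
  mul_mem' {g h} hg hh H hH := by
    rw [S.mat_mul, Matrix.mul_assoc, hh H hH, ← Matrix.mul_assoc, hg H hH, Matrix.mul_assoc]
  inv_mem' {g} hg H hH := by
    calc S.mat g⁻¹ * H = S.mat g⁻¹ * (H * S.mat g) * S.mat g⁻¹ := by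
          rw [Matrix.mul_assoc, Matrix.mul_assoc, S.mat_mul_inv, Matrix.mul_one]
      _ = H * S.mat g⁻¹ := by
          rw [← hg H hH, ← Matrix.mul_assoc, S.mat_inv_mul, Matrix.one_mul]

/-- `M`, the centralizer of `𝔞` in `K`. -/
def M : Subgroup G := P.centralizer ⊓ S.K

lemma A_le_centralizer : P.A ≤ P.centralizer := by
  refine (Subgroup.closure_le _).2 ?_
  rintro g ⟨X, hX, γ, -, -, he, rfl⟩ H hH
  rw [he 1, one_smul]
  have hc : Commute X H := P.commute X hX H hH
  exact hc.exp_left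

lemma Ad_mem_rootSpace {g : G} (hg : g ∈ P.centralizer) {α : Module.Dual ℝ P.𝔞}
    {X : Matrix (Fin N) (Fin N) ℝ} (hX : X ∈ P.rootSpace α) : S.Ad g X ∈ P.rootSpace α := by
  refine ⟨S.Ad_mem_lie g hX.1, fun H => ?_⟩
  have h1 : S.mat g * (H : Matrix (Fin N) (Fin N) ℝ) = H * S.mat g := hg H H.2
  have h2 : S.mat g⁻¹ * (H : Matrix (Fin N) (Fin N) ℝ) = H * S.mat g⁻¹ :=
    (P.centralizer.inv_mem hg) H H.2
  rw [← S.Ad_smul, ← hX.2 H, SemisimpleLieGroup.Ad, SemisimpleLieGroup.Ad, Matrix.mul_sub,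
    Matrix.sub_mul, ← Matrix.mul_assoc, ← Matrix.mul_assoc, ← h1]
  simp only [Matrix.mul_assoc, h2]

lemma Ad_mem_iSup {g : G} (hg : g ∈ P.centralizer) (s : Set (Module.Dual ℝ P.𝔞))
    {X : Matrix (Fin N) (Fin N) ℝ} (hX : X ∈ ⨆ β ∈ s, P.rootSpace (-β)) :
    S.Ad g X ∈ ⨆ β ∈ s, P.rootSpace (-β) := by
  have h : (⨆ β ∈ s, P.rootSpace (-β)) ≤ (⨆ β ∈ s, P.rootSpace (-β)).comap (S.AdLin g) :=
    iSup₂_le fun β hβ Y hY =>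
      Submodule.mem_comap.2 (le_iSup₂ (f := fun β (_ : β ∈ s) => P.rootSpace (-β)) β hβ
        (P.Ad_mem_rootSpace hg hY))
  exact h hX

lemma Ad_mem_𝔳' {g : G} (hg : g ∈ P.centralizer) {X : Matrix (Fin N) (Fin N) ℝ}
    (hX : X ∈ P.𝔳') : S.Ad g X ∈ P.𝔳' := by
  refine ⟨P.Ad_mem_iSup hg _ hX.1, fun α hα h => hX.2 α hα ?_⟩
  have := P.Ad_mem_iSup (P.centralizer.inv_mem hg) _ h
  rwa [← S.Ad_mul, inv_mul_cancel, S.Ad_one] at this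

/-- `V' = exp 𝔳'`, as a subset of `V`. -/
def V' : Set P.V := {v | ∃ X ∈ P.𝔳', S.IsExp X (v : G)}

/-- `A` acts on `V` by conjugation. -/
instance actionV [IsTopologicalGroup G] : MulAction P.A P.V where
  smul a v := ⟨a * v * (a : G)⁻¹, S.conj_mem_analyticSubgroup
    (fun _ hX => P.Ad_mem_iSup (P.A_le_centralizer a.2) _ hX) v.2⟩
  one_smul v := Subtype.ext (by change ((1 : P.A) : G) * v * ((1 : P.A) : G)⁻¹ = v; simp)
  mul_smul a b v := Subtype.ext (by
    change ((a * b : P.A) : G) * v * ((a * b : P.A) : G)⁻¹ = a * (b * v * (b : G)⁻¹) * (a : G)⁻¹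
    simp [mul_assoc])

lemma smul_mem_V' [IsTopologicalGroup G] (a : P.A) {v : P.V} (hv : v ∈ P.V') : a • v ∈ P.V' := by
  obtain ⟨X, hX, hXv⟩ := hv
  exact ⟨_, P.Ad_mem_𝔳' (P.A_le_centralizer a.2) hX, SemisimpleLieGroup.IsExp.conj S hXv a⟩

/-- `A` acts on `V'` by conjugation. -/
instance actionV' [IsTopologicalGroup G] : MulAction P.A P.V' where
  smul a v := ⟨a • (v : P.V), P.smul_mem_V' a v.2⟩
  one_smul v := Subtype.ext (one_smul P.A (v : P.V))
  mul_smul a b v := Subtype.ext (mul_smul a b (v : P.V))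

/-- The orbit space `A \ V'`, with the quotient topology and the quotient `σ`-algebra. -/
abbrev OrbitSpace [IsTopologicalGroup G] : Type _ :=
  Quotient (MulAction.orbitRel P.A P.V')

/-! ### Logarithm and characters of `A` -/

open Classical in
/-- The logarithm `A → 𝔞`, inverse to the exponential map. -/
def log (a : P.A) : P.𝔞 :=
  if h : ∃ H : P.𝔞, S.IsExp (H : Matrix (Fin N) (Fin N) ℝ) (a : G) then h.choose else 0

/-- The exponential map `𝔞 → A`. -/
def expA (H : P.𝔞) : P.A :=
  ⟨S.exp (H : Matrix (Fin N) (Fin N) ℝ), by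
    unfold SemisimpleLieGroup.exp
    split_ifs with h
    · exact Subgroup.subset_closure ⟨H, H.2, h.choose_spec⟩
    · exact Subgroup.one_mem _⟩

/-- The character `χ_μ (a) = exp (μ (log a))` of `A`, for `μ` a complex-valued linear form. -/
def chi (μ : P.𝔞 →ₗ[ℝ] ℂ) (a : P.A) : ℂ := Complex.exp (μ (P.log a))

/-- The parameter of the contragredient character, `χ_μ * conj χ_μ' = 1`. -/
def contragredient (μ : P.𝔞 →ₗ[ℝ] ℂ) : P.𝔞 →ₗ[ℝ] ℂ :=
  -(Complex.conjAe.toLinearMap ∘ₗ μ)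

/-- `ρ` as a complex-valued linear form. -/
def rhoC : P.𝔞 →ₗ[ℝ] ℂ := Complex.ofRealLI.toLinearMap ∘ₗ P.rho

/-! ### The big cell `VMAN` -/

/-- Membership in `VMAN`. -/
def InCell (x : G) : Prop :=
  ∃ (v : P.V) (m : P.M) (a : P.A) (n : P.Nplus), x = v * m * a * n

open Classical in
/-- The `V`-component of an element of `VMAN`. -/
def vPart (x : G) : P.V := if h : P.InCell x then h.choose else 1

open Classical in
/-- The `M`-component of an element of `VMAN`. -/
def mPart (x : G) : P.M := if h : P.InCell x then h.choose_spec.choose else 1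

open Classical in
/-- The `A`-component of an element of `VMAN`. -/
def aPart (x : G) : P.A := if h : P.InCell x then h.choose_spec.choose_spec.choose else 1

open Classical in
/-- `ξ_{-ρ} (x) = χ_{-ρ} (a (x))` on `VMAN` (and `0` elsewhere). -/
def xi (x : G) : ℝ := if P.InCell x then Real.exp (-P.rho (P.log (P.aPart x))) else 0

/-- `w` normalizes `𝔞`, lies in the identity component, and the Weyl group element that it
represents sends `Σ⁺` to `-Σ⁺`. -/
structure RepresentsLongElement (w : G) : Prop where
  mem_component : w ∈ connectedComponent (1 : G)
  normalizes : ∀ H : P.𝔞, S.Ad w H ∈ P.𝔞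
  neg : ∀ α ∈ P.posRoots, ∃ β ∈ P.posRoots, ∀ H : P.𝔞, β ⟨S.Ad w H, normalizes H⟩ = -α H

/-! ### The principal series in the noncompact picture and in the `A`-adapted picture -/

section Representation

variable {W : Type*} [NormedAddCommGroup W] [InnerProductSpace ℂ W]

open Classical in
/-- The noncompact picture of the principal series: `g ∈ G` acts on functions on `V` by
`U g f x = σ (m (g⁻¹ x))⁻¹ χ_{lam + ρ} (a (g⁻¹ x))⁻¹ f (v (g⁻¹ x))`. -/
def U (σ : P.M →* (W ≃ₗᵢ[ℂ] W)) (lam : P.𝔞 →ₗ[ℝ] ℂ) (g : G) (f : P.V → W) (x : P.V) : W :=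
  if P.InCell (g⁻¹ * x) then
    (P.chi (lam + P.rhoC) (P.aPart (g⁻¹ * x)))⁻¹ •
      (σ (P.mPart (g⁻¹ * x)))⁻¹ (f (P.vPart (g⁻¹ * x)))
  else 0

/-- `T f x = ξ_{-ρ} (w⁻¹ x)^{-1/2} f x`. -/
def T (w : G) (f : P.V → W) (x : P.V) : W := ((P.xi (w⁻¹ * x) ^ (-(1 / 2) : ℝ) : ℝ) : ℂ) • f x

/-- `T⁻¹ f x = ξ_{-ρ} (w⁻¹ x)^{1/2} f x`. -/
def Tinv (w : G) (f : P.V → W) (x : P.V) : W := ((P.xi (w⁻¹ * x) ^ (1 / 2 : ℝ) : ℝ) : ℂ) • f x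

/-- The `A`-adapted realization `T ∘ U ∘ T⁻¹` of the principal series. -/
def Uadapted (w : G) (σ : P.M →* (W ≃ₗᵢ[ℂ] W)) (lam : P.𝔞 →ₗ[ℝ] ℂ) (g : G) (f : P.V → W) :
    P.V → W :=
  P.T w (P.U σ lam g (P.Tinv w f))

variable [MeasurableSpace G]

/-- The `A`-invariant measure `ξ_{-ρ} (w⁻¹ x) dx` on `V'`, as a measure on `V` carried by `V'`;
`dx` is a Haar measure of `V`. -/
def invMeasure (w : G) (dx : Measure P.V) : Measure P.V :=
  (dx.restrict P.V').withDensity fun x => ENNReal.ofReal (P.xi (w⁻¹ * x))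

/-- The Hilbert space of the `A`-adapted realization for a unitary character of `A`:
square integrable `W`-valued functions for the `A`-invariant measure. -/
abbrev AdaptedSpace (W : Type*) [NormedAddCommGroup W] (w : G) (dx : Measure P.V) : Type _ :=
  Lp W 2 (P.invMeasure w dx)

/-- The integrand of the matrix coefficient, `⟨U g f x, h x⟩`, linear in `f`. -/
def coeffIntegrand (w : G) (σ : P.M →* (W ≃ₗᵢ[ℂ] W)) (lam : P.𝔞 →ₗ[ℝ] ℂ)
    (f h : P.V → W) (g : G) (x : P.V) : ℂ :=
  inner ℂ (h x) (P.Uadapted w σ lam g f x)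

/-- The matrix coefficient `c_{f,h} (g) = (U g f, h)` in the `A`-adapted realization. -/
def coeff (w : G) (dx : Measure P.V) (σ : P.M →* (W ≃ₗᵢ[ℂ] W)) (lam : P.𝔞 →ₗ[ℝ] ℂ)
    (f h : P.V → W) (g : G) : ℂ :=
  ∫ x, P.coeffIntegrand w σ lam f h g x ∂(P.invMeasure w dx)

/-! ### Fourier analysis along the `A`-orbits

A linear isomorphism `e : ℝ^ℓ ≃ 𝔞` gives `A` the Haar measure `da`, the image of Lebesgue measure
`dt` under `t ↦ exp (e t)`, and the unitary characters `a ↦ exp (i υ · e⁻¹ (log a))`, `υ ∈ ℝ^ℓ`. -/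

variable {l : ℕ} (e : EuclideanSpace ℝ (Fin l) ≃ₗ[ℝ] P.𝔞) [IsTopologicalGroup G]

/-- `dω` is the quotient measure on `A \ V'`: the double integration formula
`∫_{V'} φ dx = ∫_{A\V'} ∫_A φ (a • ω) da dω` holds, `dx` being the `A`-invariant measure.  (The inner
integral does not depend on the representative of the orbit `ω`.) -/
def IsQuotientMeasure (w : G) (dx : Measure P.V) (dω : Measure P.OrbitSpace) : Prop :=
  ∀ φ : P.V → ℝ≥0∞, Measurable φ →
    ∫⁻ x, φ x ∂(P.invMeasure w dx) =
      ∫⁻ ω, (∫⁻ t : EuclideanSpace ℝ (Fin l), φ (P.expA (e t) • (ω.out : P.V))) ∂dω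

/-- A continuous cross-section of `V' → A \ V'`, which identifies `V'` with `A × A \ V'` through
`(a, ω) ↦ a • s ω`. -/
structure IsSection (s : P.OrbitSpace → P.V') : Prop where
  continuous : Continuous s
  rightInverse : ∀ ω, (Quotient.mk _ (s ω) : P.OrbitSpace) = ω

/-- `f_lam (t, ω) = χ_lam (t)⁻¹ f (t, ω)`, with `f (t, ω) = f (a • s ω)` for `a = exp (e t)`. -/
def twist (s : P.OrbitSpace → P.V') (lam : P.𝔞 →ₗ[ℝ] ℂ) (f : P.V → W)
    (ω : P.OrbitSpace) (t : EuclideanSpace ℝ (Fin l)) : W :=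
  (P.chi lam (P.expA (e t)))⁻¹ • f (P.expA (e t) • (s ω : P.V))

/-- The measure on `ℝ^ℓ` dual to Lebesgue measure for the pairing `exp (i υ · t)`. -/
def dualMeasure (l : ℕ) : Measure (EuclideanSpace ℝ (Fin l)) :=
  ENNReal.ofReal (((2 * Real.pi) ^ l)⁻¹) • volume

/-- `F` is (a jointly measurable version of) the modified Fourier transform of `f`: for almost
every orbit `ω`, the function `f_lam (·, ω)` is square integrable on `A`, and `F (·, ω)` is its `L²`
Fourier transform `υ ↦ ∫ exp (-i υ · t) f_lam (t, ω) dt`.  The Fourier transform of Mathlib has the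
kernel `exp (-2 π i υ · t)`, whence the dilation by `(2 π)⁻¹`. -/
def IsModifiedFourierTransform [FiniteDimensional ℂ W] (dω : Measure P.OrbitSpace)
    (s : P.OrbitSpace → P.V') (lam : P.𝔞 →ₗ[ℝ] ℂ) (f : P.V → W)
    (F : EuclideanSpace ℝ (Fin l) → P.OrbitSpace → W) : Prop :=
  haveI : CompleteSpace W := FiniteDimensional.complete ℂ W
  AEStronglyMeasurable (Function.uncurry F) ((dualMeasure l).prod dω) ∧
    ∀ᵐ ω ∂dω, ∃ hf : MemLp (P.twist e s lam f ω) 2 volume,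
      ∀ᵐ υ : EuclideanSpace ℝ (Fin l), F υ ω =
        (Lp.fourierTransformₗᵢ (EuclideanSpace ℝ (Fin l)) W (hf.toLp _))
          ((2 * Real.pi)⁻¹ • υ)

end Representation

end MinimalParabolic

end

noncomputable section

attribute [local instance 100] LieRing.ofAssociativeRing

set_option linter.unusedSectionVars false

/-! On `A` the adapted realization is translation along orbits, up to a character. For `a` in `A`
and `x` in `V` the equation `a⁻¹ x = (a⁻¹ x a) · a⁻¹` already is the `VMAN` decomposition, and
conjugation by `T` absorbs the `ρ`-shift, so the operator is `f ↦ χ_λ(a) f(a⁻¹ • x)`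
(`RepresentsLongElement.Uadapted_apply`). Once a section identifies `V'` with `A × A \ V'` as
measure spaces (`RepresentsLongElement.measurePreserving`), division by `χ_λ` leaves a pure
translation in the `A`-variable (`inner_translate`). Plancherel on each orbit turns the translation
into the factor `e^{-iυ·log a}`, and Fubini moves the integral over `υ` outside
(`IsSliceFourier.integral_eq`). All integrability comes from pairing two `L²` functions on `ℝ^ℓ × A
\ V'`; joint measurability of the orbitwise transforms is `exists_measurable_fourier`.

The splitting of `V'` rests on two facts. The measure `ξ_{-ρ}(w⁻¹x) dx` is `A`-invariant, because
conjugation by `a` changes the density and the Haar integral by the same factor `e^{2ρ(log a)}`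
(`RepresentsLongElement.xi_smul`, `ChainData.lintegral_smul`). And `V'` has a continuous
`A`-equivariant map to `𝔞` (`exists_equivariant`), assembled from positive functions that are
homogeneous with simple roots as weights. The section, the quotient measure and its uniqueness
follow from this map by averaging.

The Lie theory below these facts uses ordered lists of root vectors ("unipotent chains"): the group
of a chain is a product of one-parameter groups, which yields explicit Haar measure, σ-compactness
and injectivity of the covering on `V` and `N`. Uniqueness in `VMAN` compares degrees under `ad H`
for `H` in the open positive chamber. -/

lemma Matrix.continuous_exp (N : ℕ) :
    Continuous (NormedSpace.exp : Matrix (Fin N) (Fin N) ℝ → Matrix (Fin N) (Fin N) ℝ) := by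
  let _ : NormedRing (Matrix (Fin N) (Fin N) ℝ) := Matrix.linftyOpNormedRing
  let _ : NormedAlgebra ℝ (Matrix (Fin N) (Fin N) ℝ) := Matrix.linftyOpNormedAlgebra
  let _ : NormedAlgebra ℚ (Matrix (Fin N) (Fin N) ℝ) := NormedAlgebra.restrictScalars ℚ ℝ _
  exact NormedSpace.exp_continuous

lemma Matrix.exp_mul_exp_neg {N : ℕ} (X : Matrix (Fin N) (Fin N) ℝ) :
    NormedSpace.exp X * NormedSpace.exp (-X) = 1 := by
  rw [← Matrix.exp_add_of_commute X (-X) (Commute.refl X).neg_right, add_neg_cancel,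
    NormedSpace.exp_zero]

/-- The exponential of a matrix as an element of the general linear group. -/
def Matrix.expGL {N : ℕ} (X : Matrix (Fin N) (Fin N) ℝ) : GL (Fin N) ℝ where
  val := NormedSpace.exp X
  inv := NormedSpace.exp (-X)
  val_inv := Matrix.exp_mul_exp_neg X
  inv_val := by simpa using Matrix.exp_mul_exp_neg (-X)

lemma Matrix.continuous_expGL (N : ℕ) :
    Continuous (Matrix.expGL : Matrix (Fin N) (Fin N) ℝ → GL (Fin N) ℝ) :=
  Units.continuous_iff.2 ⟨Matrix.continuous_exp N, (Matrix.continuous_exp N).comp continuous_neg⟩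

/-! ### The exponential map of `G`, lifted through the covering. -/

namespace SemisimpleLieGroup

variable {G : Type*} [Group G] [TopologicalSpace G] {N : ℕ} (S : SemisimpleLieGroup G N)

lemma continuous_toGL : Continuous S.toGL :=
  continuous_subtype_val.comp S.isCoveringMap.continuous

lemma continuous_mat : Continuous S.mat :=
  Units.continuous_val.comp S.continuous_toGL

/-- Points over the same matrix are separated because a covering map is a separated map; points over
different matrices are separated in the linear group. -/
lemma t2Space (S : SemisimpleLieGroup G N) : T2Space G := by
  refine ⟨fun x y hxy => ?_⟩
  by_cases h : MonoidHom.rangeRestrict S.toGL x = MonoidHom.rangeRestrict S.toGL y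
  · obtain ⟨u, v, hu, hv, hxu, hyv, huv⟩ := S.isCoveringMap.isSeparatedMap x y h hxy
    exact ⟨u, v, hu, hv, hxu, hyv, huv⟩
  · obtain ⟨u, v, hu, hv, hxu, hyv, huv⟩ := t2_separation h
    exact ⟨_, _, hu.preimage S.isCoveringMap.continuous, hv.preimage S.isCoveringMap.continuous,
      hxu, hyv, huv.preimage _⟩

lemma toGL_eq_of_mat_eq {g h : G} (H : S.mat g = S.mat h) : S.toGL g = S.toGL h := Units.ext H

/-- Continuous maps into `G` with the same matrices that agree at a point are equal. -/
lemma eq_of_mat_eq {A : Type*} [TopologicalSpace A] [PreconnectedSpace A] {u v : A → G}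
    (hu : Continuous u) (hv : Continuous v) (h : ∀ a, S.mat (u a) = S.mat (v a)) (a : A)
    (ha : u a = v a) : u = v :=
  S.isCoveringMap.eq_of_comp_eq hu hv
    (funext fun x => Subtype.ext (S.toGL_eq_of_mat_eq (h x))) a ha

lemma expGL_mem_range {X : Matrix (Fin N) (Fin N) ℝ} (hX : X ∈ S.lie) :
    Matrix.expGL X ∈ S.toGL.range := by
  obtain ⟨g, hg⟩ := (S.mem_lie_iff X).1 hX 1
  exact ⟨g, Units.ext (by rw [hg, one_smul]; rfl)⟩

/-- The Lie algebra is a vector space, hence simply connected and locally path connected, so the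
matrix exponential lifts through the covering. Lifting it all at once gives continuity in `X`, which
separate one-parameter subgroups do not provide. -/
lemma exists_continuous_lift_exp :
    ∃ F : C(S.lie.toSubmodule, G), F 0 = 1 ∧ ∀ X, S.mat (F X) = NormedSpace.exp (X : Matrix (Fin N) (Fin N) ℝ) := by
  let f : C(S.lie.toSubmodule, S.toGL.range) :=
    ⟨fun X => ⟨Matrix.expGL X.1, S.expGL_mem_range X.2⟩,
      ((Matrix.continuous_expGL N).comp continuous_subtype_val).subtype_mk _⟩
  have : LocallyConvexSpace ℝ (Matrix (Fin N) (Fin N) ℝ) :=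
    inferInstanceAs (LocallyConvexSpace ℝ (Fin N → Fin N → ℝ))
  have : LocallyConvexSpace ℝ S.lie.toSubmodule :=
    LocallyConvexSpace.induced S.lie.toSubmodule.subtype
  have : LocallyPathConnectedSpace S.lie.toSubmodule :=
    LocallyConvexSpace.toLocallyPathConnectedSpace (E := S.lie.toSubmodule)
  obtain ⟨F, ⟨h0, hF⟩, -⟩ := S.isCoveringMap.existsUnique_continuousMap_lifts f 0 1
    (Subtype.ext (Units.ext (by simp [f, Matrix.expGL])))
  refine ⟨F, h0, fun X => ?_⟩
  have := congrArg (fun y : S.toGL.range => ((y : GL (Fin N) ℝ) : Matrix (Fin N) (Fin N) ℝ))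
    (congrFun hF X)
  exact this

/-- The exponential map of `G` on its Lie algebra (with value `1` elsewhere), as a continuous
lift of the matrix exponential. -/
def E (X : Matrix (Fin N) (Fin N) ℝ) : G :=
  open Classical in if h : X ∈ S.lie then S.exists_continuous_lift_exp.choose ⟨X, h⟩ else 1

lemma mat_E {X : Matrix (Fin N) (Fin N) ℝ} (hX : X ∈ S.lie) :
    S.mat (S.E X) = NormedSpace.exp X := by
  rw [E, dif_pos hX, S.exists_continuous_lift_exp.choose_spec.2]

lemma E_zero : S.E 0 = 1 := by
  rw [E, dif_pos (zero_mem _)]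
  exact S.exists_continuous_lift_exp.choose_spec.1

lemma continuous_E {A : Type*} [TopologicalSpace A] {u : A → Matrix (Fin N) (Fin N) ℝ}
    (hu : Continuous u) (hmem : ∀ a, u a ∈ S.lie) : Continuous fun a => S.E (u a) := by
  have : (fun a => S.E (u a)) = fun a => S.exists_continuous_lift_exp.choose ⟨u a, hmem a⟩ := by
    funext a
    rw [E, dif_pos (hmem a)]
  rw [this]
  exact (map_continuous _).comp (hu.subtype_mk _)

lemma smul_mem_lie (t : ℝ) {X : Matrix (Fin N) (Fin N) ℝ} (hX : X ∈ S.lie) : t • X ∈ S.lie :=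
  S.lie.smul_mem t hX

variable [IsTopologicalGroup G]

/-- Along a ray both sides are continuous lifts of one path of matrices and agree at `t = 0`, so
uniqueness of lifts applies. `conj_E` and `isExp_iff` use the same device. -/
lemma E_add {X Y : Matrix (Fin N) (Fin N) ℝ} (hX : X ∈ S.lie) (hY : Y ∈ S.lie)
    (h : Commute X Y) : S.E (X + Y) = S.E X * S.E Y := by
  have hmem (t : ℝ) : t • (X + Y) ∈ S.lie := S.smul_mem_lie t (add_mem hX hY)
  have key : (fun t : ℝ => S.E (t • (X + Y))) = fun t : ℝ => S.E (t • X) * S.E (t • Y) := by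
    refine S.eq_of_mat_eq (S.continuous_E (by fun_prop) hmem)
      ((S.continuous_E (by fun_prop) fun t => S.smul_mem_lie t hX).mul
        (S.continuous_E (by fun_prop) fun t => S.smul_mem_lie t hY)) (fun t => ?_) 0
      (by simp [E_zero])
    rw [mat_mul, S.mat_E (hmem t), S.mat_E (S.smul_mem_lie t hX), S.mat_E (S.smul_mem_lie t hY),
      smul_add, Matrix.exp_add_of_commute _ _ ((h.smul_left t).smul_right t)]
  simpa using congrFun key 1

lemma E_neg {X : Matrix (Fin N) (Fin N) ℝ} (hX : X ∈ S.lie) : S.E (-X) = (S.E X)⁻¹ := by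
  refine eq_inv_of_mul_eq_one_left ?_
  rw [← S.E_add (neg_mem hX) hX (Commute.refl X).neg_left, neg_add_cancel, E_zero]

lemma conj_E (g : G) {X : Matrix (Fin N) (Fin N) ℝ} (hX : X ∈ S.lie) :
    g * S.E X * g⁻¹ = S.E (S.Ad g X) := by
  have hmem (t : ℝ) : t • S.Ad g X ∈ S.lie := S.smul_mem_lie t (S.Ad_mem_lie g hX)
  have key : (fun t : ℝ => g * S.E (t • X) * g⁻¹) = fun t : ℝ => S.E (t • S.Ad g X) := by
    refine S.eq_of_mat_eq ((continuous_const.mul (S.continuous_E (by fun_prop)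
      fun t => S.smul_mem_lie t hX)).mul continuous_const)
      (S.continuous_E (by fun_prop) hmem) (fun t => ?_) 0 (by simp [E_zero])
    rw [mat_mul, mat_mul, S.mat_E (S.smul_mem_lie t hX), S.mat_E (hmem t), ← Ad_smul, exp_Ad]
    rfl
  simpa using congrFun key 1

lemma isExp_E {X : Matrix (Fin N) (Fin N) ℝ} (hX : X ∈ S.lie) : S.IsExp X (S.E X) := by
  refine ⟨fun t => S.E (t • X), S.continuous_E (by fun_prop) fun t => S.smul_mem_lie t hX,
    fun s t => ?_, fun t => S.mat_E (S.smul_mem_lie t hX), by simp⟩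
  simp only [add_smul]
  rw [S.E_add (S.smul_mem_lie s hX) (S.smul_mem_lie t hX)
    (((Commute.refl X).smul_left s).smul_right t)]

/-- A one-parameter subgroup is determined by its generator, so the choices made in the definitions
of `exp` and `log` are harmless. -/
lemma isExp_iff {X : Matrix (Fin N) (Fin N) ℝ} (hX : X ∈ S.lie) {g : G} :
    S.IsExp X g ↔ g = S.E X := by
  refine ⟨?_, fun h => h ▸ S.isExp_E hX⟩
  rintro ⟨γ, hc, hm, he, rfl⟩
  have h0 : γ 0 = 1 := by simpa using hm 0 0
  have key : γ = fun t : ℝ => S.E (t • X) := by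
    refine S.eq_of_mat_eq hc (S.continuous_E (by fun_prop) fun t => S.smul_mem_lie t hX)
      (fun t => ?_) 0 (by simp [E_zero, h0])
    rw [he, S.mat_E (S.smul_mem_lie t hX)]
  simpa using congrFun key 1

lemma exp_eq_E {X : Matrix (Fin N) (Fin N) ℝ} (hX : X ∈ S.lie) : S.exp X = S.E X := by
  have h : ∃ g, S.IsExp X g := ⟨_, S.isExp_E hX⟩
  rw [exp, dif_pos h]
  exact (S.isExp_iff hX).1 h.choose_spec

lemma E_mem_analyticSubgroup {h : Submodule ℝ (Matrix (Fin N) (Fin N) ℝ)}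
    {X : Matrix (Fin N) (Fin N) ℝ} (hX : X ∈ S.lie) (hXh : X ∈ h) :
    S.E X ∈ S.analyticSubgroup h :=
  Subgroup.subset_closure ⟨X, hXh, S.isExp_E hX⟩

/-- The analytic subgroup of a subspace of the Lie algebra is generated by exponentials. -/
lemma analyticSubgroup_le {h : Submodule ℝ (Matrix (Fin N) (Fin N) ℝ)} (hh : ∀ X ∈ h, X ∈ S.lie)
    {H : Subgroup G} (hH : ∀ X ∈ h, S.E X ∈ H) : S.analyticSubgroup h ≤ H := by
  refine (Subgroup.closure_le _).2 ?_
  rintro g ⟨X, hX, hg⟩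
  rw [(S.isExp_iff (hh X hX)).1 hg]
  exact hH X hX

end SemisimpleLieGroup

/-! ### Filtration of matrices by `ad H`-degree, and the logarithm of unipotent matrices. -/

namespace Matrix

variable {N : ℕ}

/-- A symmetric real matrix becomes diagonal after an inner automorphism. -/
lemma exists_algEquiv_eq_diagonal {H : Matrix (Fin N) (Fin N) ℝ} (hH : Hᵀ = H) :
    ∃ (φ : Matrix (Fin N) (Fin N) ℝ ≃ₐ[ℝ] Matrix (Fin N) (Fin N) ℝ) (d : Fin N → ℝ),
      φ H = diagonal d := by
  have hH' : H.IsHermitian := by rw [IsHermitian, conjTranspose_eq_transpose_of_trivial, hH]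
  refine ⟨(Unitary.conjStarAlgAut ℝ _ (star hH'.eigenvectorUnitary)).toAlgEquiv,
    hH'.eigenvalues, ?_⟩
  have := hH'.conjStarAlgAut_star_eigenvectorUnitary
  simpa using this

/-- The matrices whose components of `ad H`-degree less than `c` vanish, where `φ H = diagonal d`. -/
def filtration (φ : Matrix (Fin N) (Fin N) ℝ ≃ₐ[ℝ] Matrix (Fin N) (Fin N) ℝ) (d : Fin N → ℝ)
    (c : ℝ) : Submodule ℝ (Matrix (Fin N) (Fin N) ℝ) where
  carrier := {Y | ∀ i j, d i - d j < c → φ Y i j = 0}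
  add_mem' {X Y} hX hY i j h := by simp [hX i j h, hY i j h]
  zero_mem' i j _ := by simp
  smul_mem' t X hX i j h := by simp [hX i j h]

variable {φ : Matrix (Fin N) (Fin N) ℝ ≃ₐ[ℝ] Matrix (Fin N) (Fin N) ℝ} {d : Fin N → ℝ}
  {H : Matrix (Fin N) (Fin N) ℝ}

/-- Degrees add along `i, k, j`: `dᵢ - dⱼ = (dᵢ - dₖ) + (dₖ - dⱼ)`. If the total is below `a + b`,
one of the two factors is below its own threshold. -/
lemma filtration_mul_mem {a b : ℝ} {X Y : Matrix (Fin N) (Fin N) ℝ}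
    (hX : X ∈ filtration φ d a) (hY : Y ∈ filtration φ d b) : X * Y ∈ filtration φ d (a + b) := by
  intro i j h
  rw [map_mul, mul_apply]
  refine Finset.sum_eq_zero fun k _ => ?_
  rcases lt_or_ge (d i - d k) a with h1 | h1
  · rw [hX i k h1, zero_mul]
  · rw [hY k j (by linarith), mul_zero]

lemma filtration_anti {a b : ℝ} (h : a ≤ b) : filtration φ d b ≤ filtration φ d a :=
  fun _ hX i j hij => hX i j (hij.trans_le h)

lemma one_mem_filtration : 1 ∈ filtration φ d 0 := by
  intro i j h
  rw [map_one, one_apply_ne]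
  rintro rfl
  simp at h

lemma filtration_pow_mem {a : ℝ} {X : Matrix (Fin N) (Fin N) ℝ}
    (hX : X ∈ filtration φ d a) (n : ℕ) : X ^ n ∈ filtration φ d (n * a) := by
  induction n with
  | zero => simpa using one_mem_filtration
  | succ n ih =>
    rw [pow_succ]
    convert filtration_mul_mem ih hX using 2
    push_cast; ring

lemma apply_eq_zero_of_ad_eq (hφ : φ H = diagonal d) {c : ℝ} {X : Matrix (Fin N) (Fin N) ℝ}
    (hX : H * X - X * H = c • X) {i j : Fin N} (h : d i - d j ≠ c) : φ X i j = 0 := by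
  have h1 := congrArg (fun Y => φ Y i j) hX
  simp only [map_sub, map_mul, hφ, map_smul, sub_apply, diagonal_mul, mul_diagonal, smul_apply,
    smul_eq_mul] at h1
  have h2 : (d i - d j - c) * φ X i j = 0 := by linear_combination h1
  exact (mul_eq_zero.1 h2).resolve_left (sub_ne_zero.2 h)

lemma mem_filtration_of_ad_eq (hφ : φ H = diagonal d) {c : ℝ} {X : Matrix (Fin N) (Fin N) ℝ}
    (hX : H * X - X * H = c • X) : X ∈ filtration φ d c :=
  fun _ _ h => apply_eq_zero_of_ad_eq hφ hX h.ne

lemma exists_filtration_eq_zero (d : Fin N → ℝ) :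
    ∃ C : ℝ, ∀ X ∈ filtration φ d C, X = 0 := by
  obtain ⟨C, hC⟩ := (Set.finite_range fun p : Fin N × Fin N => d p.1 - d p.2).bddAbove
  refine ⟨C + 1, fun X hX => ?_⟩
  apply φ.injective
  rw [map_zero]
  ext i j
  exact hX i j ((hC ⟨(i, j), rfl⟩).trans_lt (lt_add_one C))

/-- Powers climb by `c` in degree while degrees are bounded. The exponent is uniform in `X`, so a
single truncated logarithm serves the whole group. -/
lemma exists_pow_eq_zero (d : Fin N → ℝ) {c : ℝ} (hc : 0 < c) :
    ∃ m : ℕ, ∀ X ∈ filtration φ d c, X ^ m = 0 := by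
  obtain ⟨C, hC⟩ := exists_filtration_eq_zero (φ := φ) d
  obtain ⟨m, hm⟩ := exists_nat_ge (C / c)
  refine ⟨m, fun X hX => hC _ (filtration_anti ?_ (filtration_pow_mem hX m))⟩
  rwa [div_le_iff₀ hc] at hm

/-- A matrix with components only in positive degrees and only in nonpositive degrees is zero. -/
lemma eq_zero_of_mem_filtration_neg {c : ℝ} (hc : 0 < c) {X : Matrix (Fin N) (Fin N) ℝ}
    (h1 : X ∈ filtration φ d c) (h2 : X ∈ filtration φ (-d) 0) : X = 0 := by
  apply φ.injective
  rw [map_zero]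
  ext i j
  rcases lt_or_ge (d i - d j) c with h | h
  · exact h1 i j h
  · exact h2 i j (by simp only [Pi.neg_apply]; linarith)

/-- From the quadratic term on, every term of the series has degree at least `2c`, and a
finite-dimensional subspace is closed. -/
lemma exp_sub_one_sub_mem_filtration {c : ℝ} (hc : 0 < c) {X : Matrix (Fin N) (Fin N) ℝ}
    (hX : X ∈ filtration φ d c) : NormedSpace.exp X - 1 - X ∈ filtration φ d (2 * c) := by
  open scoped Matrix.Norms.Operator in
  have hs := NormedSpace.exp_series_hasSum_exp' (𝕂 := ℝ) X
  have hs2 := (hasSum_nat_add_iff' 2).2 hs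
  simp only [Finset.sum_range_succ, Finset.sum_range_zero, Nat.factorial, pow_zero, pow_one,
    Nat.cast_one, inv_one, one_smul, zero_add, mul_one, ← sub_sub] at hs2
  have hcl : IsClosed (filtration φ d (2 * c) : Set (Matrix (Fin N) (Fin N) ℝ)) :=
    (filtration φ d (2 * c)).closed_of_finiteDimensional
  refine hcl.mem_of_tendsto hs2 (Filter.Eventually.of_forall fun s => sum_mem fun n _ => ?_)
  refine Submodule.smul_mem _ _ (filtration_anti ?_ (filtration_pow_mem hX _))
  push_cast
  nlinarith [Nat.cast_nonneg (α := ℝ) n]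

lemma exp_sub_one_mem_filtration {c : ℝ} (hc : 0 < c) {X : Matrix (Fin N) (Fin N) ℝ}
    (hX : X ∈ filtration φ d c) : NormedSpace.exp X - 1 ∈ filtration φ d c := by
  have := add_mem (filtration_anti (by linarith) (exp_sub_one_sub_mem_filtration hc hX)) hX
  simpa using this

section Log

/-- The truncated series of the logarithm, which inverts the exponential on nilpotent matrices. -/
def nilLog (m : ℕ) (u : Matrix (Fin N) (Fin N) ℝ) : Matrix (Fin N) (Fin N) ℝ :=
  ∑ k ∈ Finset.range m, ((-1) ^ k * (k + 1 : ℝ)⁻¹) • (u - 1) ^ (k + 1)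

lemma continuous_nilLog (m : ℕ) :
    Continuous (nilLog m : Matrix (Fin N) (Fin N) ℝ → Matrix (Fin N) (Fin N) ℝ) := by
  unfold nilLog
  fun_prop

open scoped Matrix.Norms.Operator

lemma hasDerivAt_pow_of_commute {v : ℝ → Matrix (Fin N) (Fin N) ℝ}
    {v' : Matrix (Fin N) (Fin N) ℝ} {t : ℝ} (hv : HasDerivAt v v' t) (h : Commute (v t) v')
    (n : ℕ) : HasDerivAt (fun s => v s ^ (n + 1)) ((n + 1 : ℝ) • (v t ^ n * v')) t := by
  induction n with
  | zero => simpa using hv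
  | succ n ih =>
    have h1 := ih.mul hv
    have h2 : (fun s => v s ^ (n + 1 + 1)) = (fun s => v s ^ (n + 1)) * v := by
      funext s; simp [pow_succ]
    rw [h2]
    convert! h1 using 1
    rw [smul_mul_assoc, mul_assoc, ← h.eq, ← mul_assoc, ← pow_succ]
    push_cast
    module

/-- With `u = exp (tX)`, the derivative of `nilLog m u` is `∑_{k<m} (1-u)^k u X`. The geometric sum
telescopes to `(1 - (1-u)^m) X = X`, so `nilLog m (exp (tX)) - tX` is constant, and it vanishes at
`t = 0`. -/
lemma nilLog_exp {m : ℕ} {X : Matrix (Fin N) (Fin N) ℝ}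
    (h : ∀ t : ℝ, (NormedSpace.exp (t • X) - 1) ^ m = 0) : nilLog m (NormedSpace.exp X) = X := by
  have hd (t : ℝ) : HasDerivAt (fun s : ℝ => nilLog m (NormedSpace.exp (s • X)) - s • X) 0 t := by
    have h1 : HasDerivAt (fun s : ℝ => NormedSpace.exp (s • X) - 1)
        (NormedSpace.exp (t • X) * X) t :=
      (hasDerivAt_exp_smul_const (𝕂 := ℝ) X t).sub_const 1
    have hcomm : Commute (NormedSpace.exp (t • X)) X :=
      ((Commute.refl X).smul_left t).exp_left
    have h2 : Commute (NormedSpace.exp (t • X) - 1) (NormedSpace.exp (t • X) * X) :=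
      Commute.sub_left ((Commute.refl _).mul_right hcomm) (Commute.one_left _)
    have h3 : HasDerivAt (fun s : ℝ => nilLog m (NormedSpace.exp (s • X)))
        (∑ k ∈ Finset.range m, ((-1) ^ k * (k + 1 : ℝ)⁻¹) •
          ((k + 1 : ℝ) • ((NormedSpace.exp (t • X) - 1) ^ k * (NormedSpace.exp (t • X) * X)))) t := by
      unfold nilLog
      exact HasDerivAt.fun_sum fun k _ => (hasDerivAt_pow_of_commute h1 h2 k).fun_const_smul _
    have h4 := h3.sub ((hasDerivAt_id t).smul_const X)
    convert! h4 using 1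
    rw [eq_comm, sub_eq_zero]
    set u := NormedSpace.exp (t • X)
    have h5 (k : ℕ) : ((-1) ^ k * (k + 1 : ℝ)⁻¹) • ((k + 1 : ℝ) • ((u - 1) ^ k * (u * X))) =
        (1 - u) ^ k * (u * X) := by
      have : (k + 1 : ℝ) ≠ 0 := by positivity
      rw [smul_smul, mul_assoc, inv_mul_cancel₀ this, mul_one, ← neg_sub u 1,
        ← neg_one_smul ℝ (u - 1), smul_pow, smul_mul_assoc]
    simp_rw [h5]
    rw [← Finset.sum_mul, ← mul_assoc]
    have h6 := geom_sum_mul_neg (1 - u) m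
    rw [sub_sub_cancel, ← neg_sub u 1, neg_pow, h t, mul_zero, sub_zero] at h6
    rw [← neg_sub u 1, h6, one_mul, one_smul]
  have hc := is_const_of_deriv_eq_zero (fun t => (hd t).differentiableAt)
    (fun t => (hd t).deriv) 1 0
  simp only [one_smul, zero_smul, NormedSpace.exp_zero, sub_zero] at hc
  rw [sub_eq_iff_eq_add] at hc
  rw [hc]
  simp [nilLog]

end Log

end Matrix

section

variable {𝔸 : Type*} [NormedRing 𝔸] [NormedAlgebra ℝ 𝔸] [FiniteDimensional ℝ 𝔸]

/-- A subspace stable under `ad X` is stable under `Ad (exp X)`. -/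
lemma NormedSpace.exp_conj_mem {X : 𝔸} {U : Submodule ℝ 𝔸}
    (h : ∀ Y ∈ U, X * Y - Y * X ∈ U) {Y : 𝔸} (hY : Y ∈ U) :
    NormedSpace.exp X * Y * NormedSpace.exp (-X) ∈ U := by
  have : CompleteSpace 𝔸 := FiniteDimensional.complete ℝ 𝔸
  let _ : NormedAlgebra ℚ 𝔸 := NormedAlgebra.restrictScalars ℚ ℝ _
  have hXX : NormedSpace.exp X * NormedSpace.exp (-X) = 1 := by
    rw [← NormedSpace.exp_add_of_commute (Commute.refl X).neg_right, add_neg_cancel,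
      NormedSpace.exp_zero]
  let A : 𝔸 →L[ℝ] 𝔸 :=
    LinearMap.toContinuousLinearMap (LinearMap.mulLeft ℝ X - LinearMap.mulRight ℝ X)
  have hA (Z : 𝔸) : A Z = X * Z - Z * X := rfl
  -- Constancy of this function is the identity `Ad (exp X) = exp (ad X)`. The series for `exp (ad
  -- X) Y` then stays in the closed subspace `U` term by term.
  have hd (t : ℝ) : HasDerivAt (fun s : ℝ => NormedSpace.exp (s • -X) *
      (NormedSpace.exp (s • A) Y) * NormedSpace.exp (s • X)) 0 t := by
    have h1 := hasDerivAt_exp_smul_const (𝕂 := ℝ) (-X) t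
    have h2 := hasDerivAt_exp_smul_const' (𝕂 := ℝ) X t
    have h3 := (hasDerivAt_exp_smul_const' (𝕂 := ℝ) A t).clm_apply (hasDerivAt_const t Y)
    have h4 := (h1.mul h3).mul h2
    convert! h4 using 1
    simp only [map_zero, add_zero, mul_apply_eq_comp, hA, Pi.mul_apply]
    noncomm_ring
  have hc := is_const_of_deriv_eq_zero (fun t => (hd t).differentiableAt)
    (fun t => (hd t).deriv) 1 0
  have h0 : (0 : ℝ) • A = 0 := zero_smul ℝ A
  simp only [one_smul, h0, zero_smul, NormedSpace.exp_zero, one_apply_eq_self, one_mul,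
    mul_one] at hc
  have h5 : NormedSpace.exp A Y = NormedSpace.exp X * Y * NormedSpace.exp (-X) := by
    have h6 := congrArg (fun Z => NormedSpace.exp X * Z * NormedSpace.exp (-X)) hc
    simp only [← mul_assoc, hXX, one_mul] at h6
    rwa [mul_assoc, hXX, mul_one] at h6
  rw [← h5]
  have hs := (NormedSpace.exp_series_hasSum_exp' (𝕂 := ℝ) A).mapL
    (ContinuousLinearMap.apply ℝ _ Y)
  refine U.closed_of_finiteDimensional.mem_of_tendsto hs
    (Filter.Eventually.of_forall fun s => sum_mem fun n _ => ?_)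
  have hn (n : ℕ) : (A ^ n) Y ∈ U := by
    induction n with
    | zero => simpa using hY
    | succ n ih =>
      rw [pow_succ', mul_apply_eq_comp, hA]
      exact h _ ih
  simpa using U.smul_mem _ (hn n)

end

lemma IsSigmaCompact.prod {A B : Type*} [TopologicalSpace A] [TopologicalSpace B] {s : Set A}
    {t : Set B} (hs : IsSigmaCompact s) (ht : IsSigmaCompact t) : IsSigmaCompact (s ×ˢ t) := by
  obtain ⟨K, hK, rfl⟩ := hs
  obtain ⟨L, hL, rfl⟩ := ht
  have : (⋃ n, K n) ×ˢ (⋃ n, L n) = ⋃ p : ℕ × ℕ, K p.1 ×ˢ L p.2 := by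
    rw [Set.prod_iUnion]
    ext x
    simp only [Set.mem_iUnion, Set.mem_prod, Prod.exists]
    constructor
    · rintro ⟨j, ⟨i, hi⟩, hj⟩; exact ⟨i, j, hi, hj⟩
    · rintro ⟨i, j, hi, hj⟩; exact ⟨j, ⟨i, hi⟩, hj⟩
  rw [this]
  exact isSigmaCompact_iUnion_of_isCompact _ fun p => (hK p.1).prod (hL p.2)

lemma IsSigmaCompact.inter_isClosed {A : Type*} [TopologicalSpace A] {s t : Set A}
    (hs : IsSigmaCompact s) (ht : IsClosed t) : IsSigmaCompact (s ∩ t) := by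
  obtain ⟨K, hK, rfl⟩ := hs
  rw [Set.iUnion_inter]
  exact isSigmaCompact_iUnion_of_isCompact _ fun n => (hK n).inter_right ht

lemma IsSigmaCompact.measurableSet {A : Type*} [TopologicalSpace A] [T2Space A]
    [MeasurableSpace A] [OpensMeasurableSpace A] {s : Set A} (hs : IsSigmaCompact s) :
    MeasurableSet s := by
  obtain ⟨K, hK, rfl⟩ := hs
  exact MeasurableSet.iUnion fun n => (hK n).measurableSet

/-- A vector outside a subspace is detected by a linear form vanishing on the subspace. -/
lemma Submodule.exists_dual_eq_one {V : Type*} [AddCommGroup V] [Module ℝ V] {p : Submodule ℝ V}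
    {x : V} (hx : x ∉ p) : ∃ f : V →ₗ[ℝ] ℝ, f x = 1 ∧ ∀ y ∈ p, f y = 0 := by
  obtain ⟨f, hfx, hf⟩ := p.exists_dual_map_eq_bot_of_notMem hx inferInstance
  refine ⟨(f x)⁻¹ • f, by simp [hfx], fun y hy => ?_⟩
  have : f y ∈ p.map f := Submodule.mem_map_of_mem hy
  rw [hf, Submodule.mem_bot] at this
  simp [this]

namespace Matrix

variable {N : ℕ}

section
open scoped Matrix.Norms.Operator

lemma exp_conj_mem {X : Matrix (Fin N) (Fin N) ℝ} {U : Submodule ℝ (Matrix (Fin N) (Fin N) ℝ)}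
    (h : ∀ Y ∈ U, X * Y - Y * X ∈ U) {Y : Matrix (Fin N) (Fin N) ℝ} (hY : Y ∈ U) :
    NormedSpace.exp X * Y * NormedSpace.exp (-X) ∈ U :=
  NormedSpace.exp_conj_mem h hY

/-- Solutions of the linear equation `u' = Y u` with `u 0 = 1` are exponentials. -/
lemma eq_exp_of_hasDerivAt {Y : Matrix (Fin N) (Fin N) ℝ} {u : ℝ → Matrix (Fin N) (Fin N) ℝ}
    (h0 : u 0 = 1) (h : ∀ t, HasDerivAt u (Y * u t) t) (t : ℝ) :
    u t = NormedSpace.exp (t • Y) := by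
  have hd (t : ℝ) : HasDerivAt (fun s : ℝ => NormedSpace.exp (s • -Y) * u s) 0 t := by
    convert! (hasDerivAt_exp_smul_const (𝕂 := ℝ) (-Y) t).mul (h t) using 1
    noncomm_ring
  have hc := is_const_of_deriv_eq_zero (fun t => (hd t).differentiableAt)
    (fun t => (hd t).deriv) t 0
  simp only [zero_smul, NormedSpace.exp_zero, h0, one_mul] at hc
  have h1 := congrArg (fun Z => NormedSpace.exp (t • Y) * Z) hc
  simp only [← mul_assoc, smul_neg, exp_mul_exp_neg, one_mul, mul_one] at h1
  exact h1

end

end Matrix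

/-! ### Unipotent chains and the groups they generate. -/

namespace SemisimpleLieGroup

variable {G : Type*} [Group G] [TopologicalSpace G] {N : ℕ} (S : SemisimpleLieGroup G N)

/-- A list of elements of the Lie algebra of positive degrees for the filtration, each of which
normalizes the span of the following ones and is independent of it in lowest degree. -/
def IsUnipotentChain (φ : Matrix (Fin N) (Fin N) ℝ ≃ₐ[ℝ] Matrix (Fin N) (Fin N) ℝ)
    (d : Fin N → ℝ) : List (Matrix (Fin N) (Fin N) ℝ) → Prop
  | [] => True
  | X :: L => (X ∈ S.lie ∧ (∃ h > 0, X ∈ Matrix.filtration φ d h ∧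
      Submodule.span ℝ {Y | Y ∈ L} ≤ Matrix.filtration φ d h ∧
      X ∉ Submodule.span ℝ {Y | Y ∈ L} ⊔ Matrix.filtration φ d (2 * h)) ∧
      ∀ Y ∈ Submodule.span ℝ {Y | Y ∈ L}, X * Y - Y * X ∈ Submodule.span ℝ {Y | Y ∈ L}) ∧
      IsUnipotentChain φ d L

/-- The analytic subgroup of the span of a list. -/
def chainGroup (L : List (Matrix (Fin N) (Fin N) ℝ)) : Subgroup G :=
  S.analyticSubgroup (Submodule.span ℝ {Y | Y ∈ L})

variable {S} {φ : Matrix (Fin N) (Fin N) ℝ ≃ₐ[ℝ] Matrix (Fin N) (Fin N) ℝ} {d : Fin N → ℝ}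
  {X : Matrix (Fin N) (Fin N) ℝ} {L : List (Matrix (Fin N) (Fin N) ℝ)}

lemma span_cons_eq : Submodule.span ℝ {Y | Y ∈ X :: L} =
    Submodule.span ℝ {X} ⊔ Submodule.span ℝ {Y | Y ∈ L} := by
  rw [← Submodule.span_union]
  congr 1
  ext Y
  simp

lemma mem_span_cons {Y : Matrix (Fin N) (Fin N) ℝ} (hY : Y ∈ Submodule.span ℝ {Y | Y ∈ X :: L}) :
    ∃ t : ℝ, ∃ Z ∈ Submodule.span ℝ {Y | Y ∈ L}, Y = t • X + Z := by
  rw [span_cons_eq, Submodule.mem_sup] at hY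
  obtain ⟨_, hy, Z, hZ, rfl⟩ := hY
  obtain ⟨t, rfl⟩ := Submodule.mem_span_singleton.1 hy
  exact ⟨t, Z, hZ, rfl⟩

lemma chainGroup_nil [IsTopologicalGroup G] : S.chainGroup [] = ⊥ := by
  have h0 (Y : Matrix (Fin N) (Fin N) ℝ)
      (hY : Y ∈ Submodule.span ℝ {Y | Y ∈ ([] : List (Matrix (Fin N) (Fin N) ℝ))}) : Y = 0 := by
    simpa using hY
  refine eq_bot_iff.2 (S.analyticSubgroup_le (fun Y h => ?_) fun Y hY => ?_)
  · rw [h0 Y h]; exact zero_mem _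
  · rw [h0 Y hY, E_zero]; exact one_mem _

namespace IsUnipotentChain

lemma mem_lie (hL : S.IsUnipotentChain φ d L) {Y : Matrix (Fin N) (Fin N) ℝ}
    (hY : Y ∈ Submodule.span ℝ {Y | Y ∈ L}) : Y ∈ S.lie := by
  have : Submodule.span ℝ {Y | Y ∈ L} ≤ S.lie.toSubmodule := by
    clear hY
    refine Submodule.span_le.2 ?_
    induction L with
    | nil => simp
    | cons X L ih =>
      intro Y hY
      rcases List.mem_cons.1 hY with rfl | h
      · exact hL.1.1
      · exact ih hL.2 h
  exact this hY

variable [IsTopologicalGroup G]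

lemma Ad_E_mem (hL : S.IsUnipotentChain φ d (X :: L)) (t : ℝ)
    {Y : Matrix (Fin N) (Fin N) ℝ} (hY : Y ∈ Submodule.span ℝ {Y | Y ∈ L}) :
    S.Ad (S.E (t • X)) Y ∈ Submodule.span ℝ {Y | Y ∈ L} := by
  have hX := S.smul_mem_lie t hL.1.1
  rw [Ad, ← S.E_neg hX, S.mat_E hX, S.mat_E (neg_mem hX)]
  refine Matrix.exp_conj_mem (fun Z hZ => ?_) hY
  have := Submodule.smul_mem _ t (hL.1.2.2 Z hZ)
  simpa [smul_sub] using this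

lemma E_mem (hL : S.IsUnipotentChain φ d (X :: L)) (t : ℝ) : S.E (t • X) ∈ S.chainGroup (X :: L) :=
  have h : t • X ∈ Submodule.span ℝ {Y | Y ∈ X :: L} :=
    Submodule.smul_mem _ t (Submodule.subset_span (by simp))
  S.E_mem_analyticSubgroup (hL.mem_lie h) h

lemma chainGroup_le (hL : S.IsUnipotentChain φ d (X :: L)) :
    S.chainGroup L ≤ S.chainGroup (X :: L) :=
  S.analyticSubgroup_le (fun _ h => hL.2.mem_lie h) fun Y hY =>
    S.E_mem_analyticSubgroup (hL.2.mem_lie hY) (by rw [span_cons_eq]; exact Submodule.mem_sup_right hY)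

open scoped Matrix.Norms.Operator in
-- This takes the place of the Baker–Campbell–Hausdorff formula. Seek the solution of `U' = B U` as
-- `exp (b X) u`: `b'` must be the `X`-coordinate of `B`, and then `u' = Ad (exp (-b X)) (B - b' X)
-- u`, whose coefficient lies in the span of `L` since `X` normalizes that span. Even for constant
-- `B` the new coefficient depends on time, so the induction needs the time-dependent statement.
lemma exists_solution_cons (hL : S.IsUnipotentChain φ d (X :: L))
    (ih : ∀ B : ℝ → Matrix (Fin N) (Fin N) ℝ, Continuous B →
      (∀ t, B t ∈ Submodule.span ℝ {Y | Y ∈ L}) → ∃ u : ℝ → G, Continuous u ∧ u 0 = 1 ∧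
      (∀ t, u t ∈ S.chainGroup L) ∧ ∀ t, HasDerivAt (fun s => S.mat (u s)) (B t * S.mat (u t)) t)
    {B : ℝ → Matrix (Fin N) (Fin N) ℝ} (hB : Continuous B)
    (hBL : ∀ t, B t ∈ Submodule.span ℝ {Y | Y ∈ X :: L}) :
    ∃ (b : ℝ → ℝ) (u : ℝ → G), Continuous (fun t => S.E (b t • X) * u t) ∧
      S.E (b 0 • X) * u 0 = 1 ∧ (∀ t, u t ∈ S.chainGroup L) ∧
      ∀ t, HasDerivAt (fun s => S.mat (S.E (b s • X) * u s))
        (B t * S.mat (S.E (b t • X) * u t)) t := by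
  obtain ⟨⟨hX, ⟨h, -, -, -, hXL⟩, had⟩, hL'⟩ := id hL
  have hXL' : X ∉ Submodule.span ℝ {Y | Y ∈ L} := fun h => hXL (Submodule.mem_sup_left h)
  obtain ⟨f, hfX, hfL⟩ := Submodule.exists_dual_eq_one hXL'
  have hf : Continuous f := f.continuous_of_finiteDimensional
  have hbc : Continuous fun t => f (B t) := hf.comp hB
  let b : ℝ → ℝ := fun t => ∫ s in (0 : ℝ)..t, f (B s)
  have hb (t : ℝ) : HasDerivAt b (f (B t)) t :=
    intervalIntegral.integral_hasDerivAt_right (hbc.intervalIntegrable _ _)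
      hbc.stronglyMeasurable.stronglyMeasurableAtFilter hbc.continuousAt
  have hbcont : Continuous b := continuous_iff_continuousAt.2 fun t => (hb t).continuousAt
  have hR (t : ℝ) : B t - f (B t) • X ∈ Submodule.span ℝ {Y | Y ∈ L} := by
    obtain ⟨r, Z, hZ, hBZ⟩ := mem_span_cons (hBL t)
    rw [hBZ, map_add, map_smul, hfX, hfL Z hZ]
    simpa using hZ
  have hE (r : ℝ) : S.mat (S.E (r • X)) = NormedSpace.exp (r • X) :=
    S.mat_E (S.smul_mem_lie r hX)
  have hEi (r : ℝ) : S.mat (S.E (r • X))⁻¹ = NormedSpace.exp (-(r • X)) := by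
    rw [← S.E_neg (S.smul_mem_lie r hX), S.mat_E (neg_mem (S.smul_mem_lie r hX))]
  have hexp := Matrix.continuous_exp N
  obtain ⟨u, huc, hu0, huL, hu⟩ := ih
    (fun t => S.Ad (S.E (-b t • X)) (B t - f (B t) • X))
    (by simp only [Ad, hE, hEi]; fun_prop) (fun t => hL.Ad_E_mem _ (hR t))
  refine ⟨b, u, (S.continuous_E (by fun_prop) fun t => S.smul_mem_lie _ hX).mul huc, ?_, huL,
    fun t => ?_⟩
  · simp [b, hu0, E_zero]
  · simp only [mat_mul, hE]
    have h1 : HasDerivAt (fun s => NormedSpace.exp (b s • X))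
        (f (B t) • (NormedSpace.exp (b t • X) * X)) t :=
      (hasDerivAt_exp_smul_const (𝕂 := ℝ) X (b t)).scomp t (hb t)
    convert! h1.mul (hu t) using 1
    rw [Ad, hE, hEi]
    simp only [neg_smul, neg_neg]
    have h2 : NormedSpace.exp (b t • X) * X = X * NormedSpace.exp (b t • X) :=
      (((Commute.refl X).smul_left (b t)).exp_left).eq
    have h3 (Z : Matrix (Fin N) (Fin N) ℝ) :
        NormedSpace.exp (b t • X) * (NormedSpace.exp (-(b t • X)) * Z) = Z := by
      rw [← mul_assoc, Matrix.exp_mul_exp_neg, one_mul]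
    rw [h2]
    simp only [mul_assoc, h3]
    simp only [sub_mul, smul_mul_assoc, mul_assoc]
    abel

open scoped Matrix.Norms.Operator in
lemma exists_solution (hL : S.IsUnipotentChain φ d L) {B : ℝ → Matrix (Fin N) (Fin N) ℝ}
    (hB : Continuous B) (hBL : ∀ t, B t ∈ Submodule.span ℝ {Y | Y ∈ L}) :
    ∃ u : ℝ → G, Continuous u ∧ u 0 = 1 ∧ (∀ t, u t ∈ S.chainGroup L) ∧
      ∀ t, HasDerivAt (fun s => S.mat (u s)) (B t * S.mat (u t)) t := by
  induction L generalizing B with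
  | nil =>
    refine ⟨fun _ => 1, continuous_const, rfl, fun _ => one_mem _, fun t => ?_⟩
    have : B t = 0 := by simpa using hBL t
    rw [this, zero_mul]
    exact hasDerivAt_const _ _
  | cons X L ih =>
    obtain ⟨b, u, h1, h2, h3, h4⟩ := hL.exists_solution_cons (fun B => ih hL.2) hB hBL
    exact ⟨_, h1, h2, fun t => mul_mem (hL.E_mem _) (hL.chainGroup_le (h3 t)), h4⟩

/-- For the constant coefficient `Y` the factored solution is `t ↦ E (t • Y)`; evaluate it at `t =
1`. -/
lemma exists_E_eq (hL : S.IsUnipotentChain φ d (X :: L)) {Y : Matrix (Fin N) (Fin N) ℝ}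
    (hY : Y ∈ Submodule.span ℝ {Y | Y ∈ X :: L}) :
    ∃ t : ℝ, ∃ g ∈ S.chainGroup L, S.E Y = S.E (t • X) * g := by
  obtain ⟨b, u, h1, h2, h3, h4⟩ := hL.exists_solution_cons (fun B => hL.2.exists_solution)
    (B := fun _ => Y) continuous_const (fun _ => hY)
  have hYl := hL.mem_lie hY
  have key : (fun t => S.E (b t • X) * u t) = fun t : ℝ => S.E (t • Y) := by
    refine S.eq_of_mat_eq h1 (S.continuous_E (by fun_prop) fun t => S.smul_mem_lie t hYl)
      (fun t => ?_) 0 (by simp [h2, E_zero])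
    rw [S.mat_E (S.smul_mem_lie t hYl)]
    exact Matrix.eq_exp_of_hasDerivAt (by rw [h2, mat_one]) h4 t
  exact ⟨b 1, u 1, h3 1, by simpa using (congrFun key 1).symm⟩

lemma conj_E_mem (hL : S.IsUnipotentChain φ d (X :: L)) (t : ℝ) {g : G}
    (hg : g ∈ S.chainGroup L) : S.E (t • X) * g * (S.E (t • X))⁻¹ ∈ S.chainGroup L :=
  S.conj_mem_analyticSubgroup (fun _ hY => hL.Ad_E_mem t hY) hg

lemma conj_E_mem' (hL : S.IsUnipotentChain φ d (X :: L)) (t : ℝ) {g : G}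
    (hg : g ∈ S.chainGroup L) : (S.E (t • X))⁻¹ * g * S.E (t • X) ∈ S.chainGroup L := by
  have := hL.conj_E_mem (-t) hg
  rwa [neg_smul, S.E_neg (S.smul_mem_lie t hL.1.1), inv_inv] at this

/-- Elements of the group of a chain have a component along its first vector. -/
lemma exists_eq_mul (hL : S.IsUnipotentChain φ d (X :: L)) {g : G}
    (hg : g ∈ S.chainGroup (X :: L)) : ∃ t : ℝ, ∃ g' ∈ S.chainGroup L, g = S.E (t • X) * g' := by
  have hX := hL.1.1
  -- The products form a subgroup because `E (t • X)` normalizes `chainGroup L`, and they include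
  -- the generators by `exists_E_eq`.
  let K : Subgroup G :=
    { carrier := {g | ∃ t : ℝ, ∃ g' ∈ S.chainGroup L, g = S.E (t • X) * g'}
      one_mem' := ⟨0, 1, one_mem _, by simp [E_zero]⟩
      mul_mem' := by
        rintro _ _ ⟨s, g, hg, rfl⟩ ⟨t, h, hh, rfl⟩
        refine ⟨s + t, _, mul_mem (hL.conj_E_mem' t hg) hh, ?_⟩
        rw [add_smul, S.E_add (S.smul_mem_lie s hX) (S.smul_mem_lie t hX)
          (((Commute.refl X).smul_left s).smul_right t)]
        group
      inv_mem' := by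
        rintro _ ⟨s, g, hg, rfl⟩
        refine ⟨-s, _, hL.conj_E_mem s (inv_mem hg), ?_⟩
        rw [neg_smul, S.E_neg (S.smul_mem_lie s hX)]
        group }
  exact (S.analyticSubgroup_le (H := K) (fun _ h => hL.mem_lie h) fun Y hY => hL.exists_E_eq hY) hg

/-- Since `xy - 1 = (x-1)(y-1) + (x-1) + (y-1)` and the product has degree at least `2h`, the map `g
↦ mat g - 1` is additive modulo degree `2h`; it is enough to look at the generators. -/
lemma mat_sub_one_mem (hL : S.IsUnipotentChain φ d L) {h : ℝ} (hh : 0 < h)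
    (hLh : Submodule.span ℝ {Y | Y ∈ L} ≤ Matrix.filtration φ d h) {g : G}
    (hg : g ∈ S.chainGroup L) :
    S.mat g - 1 ∈ Submodule.span ℝ {Y | Y ∈ L} ⊔ Matrix.filtration φ d (2 * h) := by
  have hle : Submodule.span ℝ {Y | Y ∈ L} ⊔ Matrix.filtration φ d (2 * h) ≤
      Matrix.filtration φ d h := sup_le hLh (Matrix.filtration_anti (by linarith))
  have hE {Y : Matrix (Fin N) (Fin N) ℝ} (hY : Y ∈ Submodule.span ℝ {Y | Y ∈ L}) :
      S.mat (S.E Y) - 1 ∈ Submodule.span ℝ {Y | Y ∈ L} ⊔ Matrix.filtration φ d (2 * h) := by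
    rw [S.mat_E (hL.mem_lie hY)]
    have := add_mem (Submodule.mem_sup_left (T := Matrix.filtration φ d (2 * h)) hY)
      (Submodule.mem_sup_right (Matrix.exp_sub_one_sub_mem_filtration hh (hLh hY)))
    simpa using this
  induction hg using Subgroup.closure_induction'' with
  | mem x hx =>
    obtain ⟨Y, hY, hx⟩ := hx
    rw [(S.isExp_iff (hL.mem_lie hY)).1 hx]
    exact hE hY
  | inv_mem x hx =>
    obtain ⟨Y, hY, hx⟩ := hx
    rw [(S.isExp_iff (hL.mem_lie hY)).1 hx, ← S.E_neg (hL.mem_lie hY)]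
    exact hE (neg_mem hY)
  | one => simp [mat_one]
  | mul x y _ _ hx hy =>
    have h1 : S.mat (x * y) - 1 = (S.mat x - 1) * (S.mat y - 1) + (S.mat x - 1) + (S.mat y - 1) := by
      rw [mat_mul]; noncomm_ring
    rw [h1]
    refine add_mem (add_mem (Submodule.mem_sup_right ?_) hx) hy
    rw [two_mul]
    exact Matrix.filtration_mul_mem (hle hx) (hle hy)

/-- The first coordinate on the group of a chain is the restriction of a linear form. -/
lemma exists_coord (hL : S.IsUnipotentChain φ d (X :: L)) :
    ∃ f : Matrix (Fin N) (Fin N) ℝ →ₗ[ℝ] ℝ, ∀ t : ℝ, ∀ g ∈ S.chainGroup L,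
      f (S.mat (S.E (t • X) * g) - 1) = t := by
  obtain ⟨⟨hX, ⟨h, hh, hXh, hLh, hXL⟩, had⟩, hL'⟩ := id hL
  -- `f` equals `1` on `X` and kills both the span of `L` and everything of degree `2h`. The
  -- quadratic and mixed terms of the product `E (t • X) * g` have degree at least `2h`, so only `t
  -- • X` contributes.
  obtain ⟨f, hfX, hf⟩ := Submodule.exists_dual_eq_one hXL
  refine ⟨f, fun t g hg => ?_⟩
  have hs := hL'.mat_sub_one_mem hh hLh hg
  have htX : t • X ∈ Matrix.filtration φ d h := Submodule.smul_mem _ t hXh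
  have hr := Matrix.exp_sub_one_sub_mem_filtration hh htX
  have he := Matrix.exp_sub_one_mem_filtration hh htX
  have hs' : S.mat g - 1 ∈ Matrix.filtration φ d h :=
    sup_le hLh (Matrix.filtration_anti (by linarith)) hs
  have h1 : S.mat (S.E (t • X) * g) - 1 = t • X + (NormedSpace.exp (t • X) - 1 - t • X) +
      (NormedSpace.exp (t • X) - 1) * (S.mat g - 1) + (S.mat g - 1) := by
    rw [mat_mul, S.mat_E (S.smul_mem_lie t hX)]; noncomm_ring
  have h2 := Matrix.filtration_mul_mem he hs'
  rw [← two_mul] at h2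
  rw [h1, map_add, map_add, map_add, map_smul, hfX, hf _ hs,
    hf _ (Submodule.mem_sup_right hr), hf _ (Submodule.mem_sup_right h2)]
  simp

/-- The first coordinate can be read off the matrix, so it is zero and the induction descends. Thus
the covering is injective on the group of a chain, even when `G` is not linear. -/
lemma eq_one_of_mat_eq_one (hL : S.IsUnipotentChain φ d L) {g : G} (hg : g ∈ S.chainGroup L)
    (h : S.mat g = 1) : g = 1 := by
  induction L generalizing g with
  | nil =>
    exact Subgroup.mem_bot.1 (chainGroup_nil.le hg)
  | cons X L ih =>
    obtain ⟨t, g', hg', rfl⟩ := hL.exists_eq_mul hg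
    obtain ⟨f, hf⟩ := hL.exists_coord
    have ht : t = 0 := by rw [← hf t g' hg', h, sub_self, map_zero]
    subst ht
    rw [zero_smul, E_zero, one_mul] at h ⊢
    exact ih hL.2 hg' h

lemma isSigmaCompact (hL : S.IsUnipotentChain φ d L) :
    IsSigmaCompact (S.chainGroup L : Set G) := by
  induction L with
  | nil =>
    rw [chainGroup_nil, Subgroup.coe_bot]
    exact isCompact_singleton.isSigmaCompact
  | cons X L ih =>
    have : (S.chainGroup (X :: L) : Set G) =
        (fun p : ℝ × G => S.E (p.1 • X) * p.2) '' (Set.univ ×ˢ (S.chainGroup L : Set G)) := by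
      ext g
      constructor
      · intro hg
        obtain ⟨t, g', hg', rfl⟩ := hL.exists_eq_mul hg
        exact ⟨(t, g'), ⟨trivial, hg'⟩, rfl⟩
      · rintro ⟨⟨t, g'⟩, ⟨-, hg'⟩, rfl⟩
        exact mul_mem (hL.E_mem t) (hL.chainGroup_le hg')
    rw [this]
    refine (isSigmaCompact_univ.prod (ih hL.2)).image ?_
    exact (S.continuous_E (by fun_prop) fun p => S.smul_mem_lie p.1 hL.1.1).mul continuous_snd

end IsUnipotentChain
end SemisimpleLieGroup

/-! ### Haar measure on the group of a chain. -/

namespace SemisimpleLieGroup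

variable {G : Type*} [Group G] [TopologicalSpace G] {N : ℕ} (S : SemisimpleLieGroup G N)

/-- `G` may have uncountably many components. A σ-compact subgroup is covered by countably many
chart domains of the covering, each of them embedded in the second countable linear group. -/
lemma secondCountableTopology (S : SemisimpleLieGroup G N) {Γ : Subgroup G} (h : IsSigmaCompact (Γ : Set G)) :
    SecondCountableTopology Γ := by
  have : SigmaCompactSpace Γ := isSigmaCompact_iff_sigmaCompactSpace.1 h
  have : SecondCountableTopology (Matrix (Fin N) (Fin N) ℝ) :=
    inferInstanceAs (SecondCountableTopology (Fin N → Fin N → ℝ))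
  have : SecondCountableTopology (Matrix (Fin N) (Fin N) ℝ)ᵐᵒᵖ :=
    MulOpposite.opHomeomorph.symm.isEmbedding.secondCountableTopology
  have : SecondCountableTopology (GL (Fin N) ℝ) :=
    Units.isEmbedding_embedProduct.secondCountableTopology
  have : SecondCountableTopology S.toGL.range :=
    Topology.IsEmbedding.subtypeVal.secondCountableTopology
  choose e he1 he2 using S.isCoveringMap.isLocalHomeomorph
  have hU (x : Γ) : Subtype.val ⁻¹' (e x).source ∈ nhds x :=
    ((e x).open_source.preimage continuous_subtype_val).mem_nhds (he1 x)
  obtain ⟨t, ht, htU⟩ := countable_cover_nhds_of_sigmaCompact hU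
  have : Countable t := ht
  have h2 (x : t) : SecondCountableTopology (Subtype.val ⁻¹' (e x.1).source : Set Γ) := by
    have h1 : Topology.IsEmbedding fun y : (Subtype.val ⁻¹' (e x.1).source : Set Γ) =>
        (⟨y.1.1, y.2⟩ : (e x.1).source) :=
      (Topology.IsEmbedding.subtypeVal.comp Topology.IsEmbedding.subtypeVal).codRestrict _ _
    exact ((e x.1).isOpenEmbedding_restrict.isEmbedding.comp h1).secondCountableTopology
  exact TopologicalSpace.secondCountableTopology_of_countable_cover (ι := t)
    (U := fun x => Subtype.val ⁻¹' (e x.1).source)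
    (fun x => (e x.1).open_source.preimage continuous_subtype_val)
    (by rwa [Set.biUnion_eq_iUnion] at htU)

variable [IsTopologicalGroup G]

section ChainMeasure

variable {Γ : Subgroup G}

/-- The one-parameter subgroup of `X` as a map into a subgroup `Γ` (trivial unless it lies in `Γ`). -/
def oneParam (Γ : Subgroup G) (X : Matrix (Fin N) (Fin N) ℝ) (t : ℝ) : Γ :=
  open Classical in if h : ∀ s : ℝ, S.E (s • X) ∈ Γ then ⟨S.E (t • X), h t⟩ else 1

/-- The image of Lebesgue measure under the product of the one-parameter subgroups of a list. -/
def chainMeasure (Γ : Subgroup G) [MeasurableSpace Γ] :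
    List (Matrix (Fin N) (Fin N) ℝ) → Measure Γ
  | [] => Measure.dirac 1
  | X :: L => ((volume : Measure ℝ).prod (chainMeasure Γ L)).map
      fun p => S.oneParam Γ X p.1 * p.2

instance sFinite_chainMeasure [MeasurableSpace Γ] (L : List (Matrix (Fin N) (Fin N) ℝ)) :
    SFinite (S.chainMeasure Γ L) := by
  induction L with
  | nil => unfold chainMeasure; infer_instance
  | cons X L ih => unfold chainMeasure; infer_instance

variable {S} {φ : Matrix (Fin N) (Fin N) ℝ ≃ₐ[ℝ] Matrix (Fin N) (Fin N) ℝ} {d : Fin N → ℝ}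
  {X : Matrix (Fin N) (Fin N) ℝ} {L : List (Matrix (Fin N) (Fin N) ℝ)}

namespace IsUnipotentChain

lemma coe_oneParam (hL : S.IsUnipotentChain φ d (X :: L)) (hΓ : S.chainGroup (X :: L) ≤ Γ)
    (t : ℝ) : (S.oneParam Γ X t : G) = S.E (t • X) := by
  rw [oneParam, dif_pos fun s => hΓ (hL.E_mem s)]

lemma continuous_oneParam (hL : S.IsUnipotentChain φ d (X :: L))
    (hΓ : S.chainGroup (X :: L) ≤ Γ) : Continuous (S.oneParam Γ X) := by
  rw [continuous_induced_rng]
  have : Subtype.val ∘ S.oneParam Γ X = fun t : ℝ => S.E (t • X) :=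
    funext fun t => hL.coe_oneParam hΓ t
  rw [this]
  exact S.continuous_E (by fun_prop) fun t => S.smul_mem_lie t hL.1.1

variable [MeasurableSpace Γ] [BorelSpace Γ] [SecondCountableTopology Γ]

lemma lintegral_chainMeasure_cons (hL : S.IsUnipotentChain φ d (X :: L))
    (hΓ : S.chainGroup (X :: L) ≤ Γ) {f : Γ → ℝ≥0∞} (hf : Measurable f) :
    ∫⁻ x, f x ∂S.chainMeasure Γ (X :: L) =
      ∫⁻ t, ∫⁻ y, f (S.oneParam Γ X t * y) ∂S.chainMeasure Γ L := by
  have hm : Measurable fun p : ℝ × Γ => S.oneParam Γ X p.1 * p.2 :=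
    ((hL.continuous_oneParam hΓ).measurable.comp measurable_fst).mul measurable_snd
  rw [chainMeasure, lintegral_map hf hm]
  exact lintegral_prod _ (hf.comp hm).aemeasurable

lemma chainMeasure_ne_zero (hL : S.IsUnipotentChain φ d L) (hΓ : S.chainGroup L ≤ Γ) :
    S.chainMeasure Γ L ≠ 0 := by
  induction L with
  | nil => simp [chainMeasure]
  | cons X L ih =>
    intro h0
    have h1 := hL.lintegral_chainMeasure_cons hΓ (measurable_const (a := (1 : ℝ≥0∞)))
    have h2 := ih hL.2 (hL.chainGroup_le.trans hΓ)
    rw [h0] at h1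
    simp only [lintegral_const, Measure.coe_zero, Pi.zero_apply, mul_zero, one_mul,
      Real.volume_univ] at h1
    rw [eq_comm, ENNReal.mul_top (Measure.measure_univ_ne_zero.2 h2)] at h1
    exact ENNReal.top_ne_zero h1

/-- Write `g = E (t • X) g'`. Left translation by `g` moves the first coordinate from `s` to `t + s`
and translates the rest by `c s`, a conjugate of `g'` in the smaller group. For fixed `s` the
induction hypothesis removes `c s`; translation invariance of Lebesgue measure removes `t`. -/
lemma lintegral_mul_left (hL : S.IsUnipotentChain φ d L) (hΓ : S.chainGroup L ≤ Γ) (g : Γ)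
    (hg : (g : G) ∈ S.chainGroup L) {f : Γ → ℝ≥0∞} (hf : Measurable f) :
    ∫⁻ x, f (g * x) ∂S.chainMeasure Γ L = ∫⁻ x, f x ∂S.chainMeasure Γ L := by
  induction L generalizing g f with
  | nil =>
    have hg1 : (g : G) = 1 := Subgroup.mem_bot.1 (chainGroup_nil.le hg)
    have : g = 1 := Subtype.ext hg1
    simp [this]
  | cons X L ih =>
    have hΓ' := hL.chainGroup_le.trans hΓ
    obtain ⟨t, g', hg', hgt⟩ := hL.exists_eq_mul hg
    let c (s : ℝ) : Γ := (S.oneParam Γ X s)⁻¹ * ⟨g', hΓ' hg'⟩ * S.oneParam Γ X s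
    have hc (s : ℝ) : (c s : G) ∈ S.chainGroup L := by
      simpa [c, hL.coe_oneParam hΓ] using hL.conj_E_mem' s hg'
    have key (s : ℝ) (y : Γ) : g * (S.oneParam Γ X s * y) = S.oneParam Γ X (t + s) * (c s * y) := by
      have hX := hL.1.1
      ext
      simp only [c, Subgroup.coe_mul, Subgroup.coe_inv, hL.coe_oneParam hΓ, hgt]
      rw [add_smul, S.E_add (S.smul_mem_lie t hX) (S.smul_mem_lie s hX)
          (((Commute.refl X).smul_left t).smul_right s)]
      group
    have hfm (u : Γ) : Measurable fun y => f (u * y) := hf.comp (measurable_const_mul u)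
    rw [hL.lintegral_chainMeasure_cons hΓ hf, hL.lintegral_chainMeasure_cons hΓ (hfm g)]
    simp_rw [key]
    rw [← lintegral_add_left_eq_self (μ := (volume : Measure ℝ))
      (fun s => ∫⁻ y, f (S.oneParam Γ X s * y) ∂S.chainMeasure Γ L) t]
    refine lintegral_congr fun s => ?_
    exact ih hL.2 hΓ' (c s) (hc s) (hfm (S.oneParam Γ X (t + s)))

/-- An endomorphism of `Γ` which scales the vectors of a chain scales its measure. -/
lemma lintegral_scale (hL : S.IsUnipotentChain φ d L) (hΓ : S.chainGroup L ≤ Γ) {c : Γ →* Γ}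
    (hc : Measurable c) {r : Matrix (Fin N) (Fin N) ℝ → ℝ}
    (hr : ∀ X ∈ L, r X ≠ 0 ∧ ∀ t, c (S.oneParam Γ X t) = S.oneParam Γ X (r X * t))
    {f : Γ → ℝ≥0∞} (hf : Measurable f) :
    ∫⁻ x, f (c x) ∂S.chainMeasure Γ L =
      (L.map fun X => ENNReal.ofReal |(r X)⁻¹|).prod * ∫⁻ x, f x ∂S.chainMeasure Γ L := by
  induction L generalizing f with
  | nil =>
    have h1 := lintegral_dirac' (1 : Γ) (hf.comp hc)
    simp only [Function.comp_apply, map_one] at h1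
    simp [chainMeasure, lintegral_dirac' _ hf, h1]
  | cons X L ih =>
    have hΓ' := hL.chainGroup_le.trans hΓ
    have hfm (u : Γ) : Measurable fun y => f (u * y) := hf.comp (measurable_const_mul u)
    obtain ⟨hr0, hrX⟩ := hr X (by simp)
    have hF : Measurable fun t => ∫⁻ y, f (S.oneParam Γ X t * y) ∂S.chainMeasure Γ L :=
      Measurable.lintegral_prod_right' (f := fun p : ℝ × Γ => f (S.oneParam Γ X p.1 * p.2))
        (hf.comp (((hL.continuous_oneParam hΓ).measurable.comp measurable_fst).mul measurable_snd))
    rw [hL.lintegral_chainMeasure_cons hΓ hf, hL.lintegral_chainMeasure_cons hΓ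
      (f := fun x => f (c x)) (hf.comp hc)]
    simp_rw [map_mul, hrX]
    simp_rw [fun t => ih hL.2 hΓ' (fun Y hY => hr Y (List.mem_cons_of_mem _ hY))
      (hfm (S.oneParam Γ X (r X * t)))]
    -- The substitution `t ↦ r X * t` in the first coordinate gives the factor `|r X|⁻¹`; the
    -- induction hypothesis gives the factors of the tail.
    have h1 := lintegral_map (μ := volume) hF (measurable_const_mul (r X))
    rw [lintegral_const_mul _ (by exact hF.comp (measurable_const_mul (r X))), ← h1, Real.map_volume_mul_left hr0,
      lintegral_smul_measure, List.map_cons, List.prod_cons, smul_eq_mul]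
    ring

variable [T2Space G]

/-- The measures of all tails live on the same ambient `Γ`. Being carried by the smaller groups is
what allows the linear coordinate of `exists_coord` to be used almost everywhere. -/
lemma ae_mem_chainGroup (hL : S.IsUnipotentChain φ d L) (hΓ : S.chainGroup L ≤ Γ) :
    ∀ᵐ x : Γ ∂S.chainMeasure Γ L, (x : G) ∈ S.chainGroup L := by
  have hmeas {L} (hL : S.IsUnipotentChain φ d L) :
      MeasurableSet {x : Γ | (x : G) ∉ S.chainGroup L} := by
    obtain ⟨K, hK, hKL⟩ := hL.isSigmaCompact
    have : {x : Γ | (x : G) ∉ S.chainGroup L} = (⋃ n, (Subtype.val : Γ → G) ⁻¹' K n)ᶜ := by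
      ext x
      rw [← Set.preimage_iUnion, hKL]
      rfl
    rw [this]
    exact (MeasurableSet.iUnion fun n =>
      ((hK n).isClosed.preimage continuous_subtype_val).measurableSet).compl
  induction L with
  | nil =>
    rw [chainMeasure, ae_dirac_iff (by simpa only [Set.compl_ofPred, not_not] using (hmeas hL).compl)]
    exact one_mem (S.chainGroup [])
  | cons X L ih =>
    rw [ae_iff, ← lintegral_indicator_one (hmeas hL),
      hL.lintegral_chainMeasure_cons hΓ (measurable_one.indicator (hmeas hL))]
    refine (lintegral_congr fun t => lintegral_eq_zero_of_ae_eq_zero ?_).trans lintegral_zero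
    filter_upwards [ih hL.2 (hL.chainGroup_le.trans hΓ)] with y hy
    refine Set.indicator_of_notMem (fun h : _ ∉ S.chainGroup (X :: L) => h ?_) _
    rw [Subgroup.coe_mul, hL.coe_oneParam hΓ]
    exact mul_mem (hL.E_mem t) (hL.chainGroup_le hy)

/-- If `E (t • X) y` lies in `C` with `y` in the tail group, then `t` lies in the compact set `I` of
first coordinates of `C`, and `y` in the compact set `K` of products `E (t • X)⁻¹ c` with `t ∈ I`,
`c ∈ C`. So the measure of `C` is at most the length of `I` times the tail measure of `K`. -/
lemma measure_lt_top (hL : S.IsUnipotentChain φ d L) (hΓ : S.chainGroup L ≤ Γ) {C : Set Γ}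
    (hC : IsCompact C) : S.chainMeasure Γ L C < ∞ := by
  induction L generalizing C with
  | nil => simp only [chainMeasure]; exact MeasureTheory.measure_lt_top _ _
  | cons X L ih =>
    have hΓ' := hL.chainGroup_le.trans hΓ
    obtain ⟨f, hf⟩ := hL.exists_coord
    have hcont := hL.continuous_oneParam hΓ
    have hI : IsCompact ((fun x : Γ => f (S.mat x - 1)) '' C) :=
      hC.image (f.continuous_of_finiteDimensional.comp
        ((S.continuous_mat.comp continuous_subtype_val).sub continuous_const))
    set I := (fun x : Γ => f (S.mat x - 1)) '' C
    have hK : IsCompact ((fun p : ℝ × Γ => (S.oneParam Γ X p.1)⁻¹ * p.2) '' (I ×ˢ C)) :=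
      (hI.prod hC).image ((hcont.comp continuous_fst).inv.mul continuous_snd)
    set K := (fun p : ℝ × Γ => (S.oneParam Γ X p.1)⁻¹ * p.2) '' (I ×ˢ C)
    have hind : Measurable (C.indicator (1 : Γ → ℝ≥0∞)) :=
      measurable_one.indicator hC.measurableSet
    rw [← lintegral_indicator_one hC.measurableSet, hL.lintegral_chainMeasure_cons hΓ hind]
    calc _ ≤ ∫⁻ t, I.indicator (fun _ => S.chainMeasure Γ L K) t := by
          refine lintegral_mono fun t => ?_
          by_cases ht : t ∈ I
          · rw [Set.indicator_of_mem ht, ← lintegral_indicator_one hK.measurableSet]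
            refine lintegral_mono fun y => ?_
            by_cases hy : S.oneParam Γ X t * y ∈ C
            · rw [Set.indicator_of_mem hy, Set.indicator_of_mem]
              · rfl
              · exact ⟨(t, _), ⟨ht, hy⟩, by simp⟩
            · rw [Set.indicator_of_notMem hy]
              exact zero_le
          · rw [Set.indicator_of_notMem ht]
            refine (lintegral_eq_zero_of_ae_eq_zero ?_).le
            filter_upwards [hL.2.ae_mem_chainGroup hΓ'] with y hy
            refine Set.indicator_of_notMem (fun hyC => ht ⟨_, hyC, ?_⟩) _
            simp only [Subgroup.coe_mul, hL.coe_oneParam hΓ]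
            exact hf t y hy
      _ = S.chainMeasure Γ L K * volume I := by
          rw [lintegral_indicator_const hI.measurableSet]
      _ < ∞ := ENNReal.mul_lt_top (ih hL.2 hΓ' hK) hI.measure_lt_top

end IsUnipotentChain

end ChainMeasure

end SemisimpleLieGroup

namespace SemisimpleLieGroup

variable {G : Type*} [Group G] [TopologicalSpace G] [IsTopologicalGroup G] {N : ℕ}
  {S : SemisimpleLieGroup G N} {φ : Matrix (Fin N) (Fin N) ℝ ≃ₐ[ℝ] Matrix (Fin N) (Fin N) ℝ}
  {d : Fin N → ℝ} {L : List (Matrix (Fin N) (Fin N) ℝ)}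

/-- An endomorphism which scales the vectors of a chain scales Haar measure. -/
lemma IsUnipotentChain.lintegral_haar_scale (hL : S.IsUnipotentChain φ d L) {Γ : Subgroup G}
    [MeasurableSpace Γ] [BorelSpace Γ] (hΓ : S.chainGroup L = Γ) (μ : Measure Γ)
    [μ.IsHaarMeasure] {c : Γ →* Γ} (hc : Measurable c) {r : Matrix (Fin N) (Fin N) ℝ → ℝ}
    (hr : ∀ X ∈ L, r X ≠ 0 ∧ ∀ t, c (S.oneParam Γ X t) = S.oneParam Γ X (r X * t))
    {f : Γ → ℝ≥0∞} (hf : Measurable f) :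
    ∫⁻ x, f (c x) ∂μ = (L.map fun X => ENNReal.ofReal |(r X)⁻¹|).prod * ∫⁻ x, f x ∂μ := by
  have : T2Space G := S.t2Space
  have hσ : IsSigmaCompact (Γ : Set G) := hΓ ▸ hL.isSigmaCompact
  have : SecondCountableTopology Γ := S.secondCountableTopology hσ
  have : SigmaCompactSpace Γ := isSigmaCompact_iff_sigmaCompactSpace.1 hσ
  let ν := S.chainMeasure Γ L
  have hν (C : Set Γ) (hC : IsCompact C) : ν C < ∞ := hL.measure_lt_top hΓ.le hC
  have : IsFiniteMeasureOnCompacts ν := ⟨fun {C} hC => hν C hC⟩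
  have : ν.IsMulLeftInvariant := by
    refine ⟨fun g => Measure.ext_of_lintegral _ fun f hf => ?_⟩
    rw [lintegral_map hf (measurable_const_mul g)]
    exact hL.lintegral_mul_left hΓ.le g (by rw [hΓ]; exact g.2) hf
  have hν0 : ν ≠ 0 := hL.chainMeasure_ne_zero hΓ.le
  obtain ⟨n, hn⟩ : ∃ n, ν (compactCovering Γ n) ≠ 0 := by
    by_contra! h
    apply hν0
    rw [← Measure.measure_univ_eq_zero, ← iUnion_compactCovering]
    exact measure_iUnion_null h
  -- Both measures are left invariant and σ-finite, so `μ` is a multiple of `ν`, and the scaling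
  -- factor found in coordinates carries over.
  have key := measure_eq_div_smul μ ν hn (hν _ (isCompact_compactCovering Γ n)).ne
  rw [key, lintegral_smul_measure, lintegral_smul_measure, hL.lintegral_scale hΓ.le hc hr hf,
    smul_eq_mul, smul_eq_mul]
  ring

end SemisimpleLieGroup

/-! ### The restricted root decomposition, positive and simple roots. -/

namespace MinimalParabolic

variable {G : Type*} [Group G] [TopologicalSpace G] {N : ℕ}
  {S : SemisimpleLieGroup G N} (P : MinimalParabolic S)

lemma transpose_mem_lie (S : SemisimpleLieGroup G N) {X : Matrix (Fin N) (Fin N) ℝ}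
    (hX : X ∈ S.lie) : Xᵀ ∈ S.lie := by
  rw [S.mem_lie_iff] at hX ⊢
  intro t
  obtain ⟨g, hg⟩ := hX t
  obtain ⟨g', hg'⟩ := S.exists_transpose g
  exact ⟨g', by rw [hg', hg, ← Matrix.exp_transpose, Matrix.transpose_smul]⟩

variable {P}

/-- Elements of `𝔞` are symmetric, so transposing the eigenvalue equation reverses its sign. This
gives `α` and `-α` the same multiplicity. -/
lemma transpose_mem_rootSpace {α : Module.Dual ℝ P.𝔞} {X : Matrix (Fin N) (Fin N) ℝ}
    (hX : X ∈ P.rootSpace α) : Xᵀ ∈ P.rootSpace (-α) := by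
  refine ⟨transpose_mem_lie S hX.1, fun H => ?_⟩
  have h1 := congrArg Matrix.transpose (hX.2 H)
  rw [Matrix.transpose_sub, Matrix.transpose_mul, Matrix.transpose_mul, P.symmetric H H.2,
    Matrix.transpose_smul] at h1
  rw [LinearMap.neg_apply, neg_smul, ← h1, neg_sub]

lemma rootSpace_neg_eq_bot_iff {α : Module.Dual ℝ P.𝔞} :
    P.rootSpace (-α) = ⊥ ↔ P.rootSpace α = ⊥ := by
  have key (β : Module.Dual ℝ P.𝔞) (h : P.rootSpace (-β) = ⊥) : P.rootSpace β = ⊥ := by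
    refine (Submodule.eq_bot_iff _).2 fun X hX => ?_
    have := transpose_mem_rootSpace hX
    rw [h, Submodule.mem_bot, Matrix.transpose_eq_zero] at this
    exact this
  exact ⟨key α, fun h => key (-α) (by rwa [neg_neg])⟩

lemma finrank_rootSpace_neg (α : Module.Dual ℝ P.𝔞) :
    Module.finrank ℝ (P.rootSpace (-α)) = Module.finrank ℝ (P.rootSpace α) := by
  have key (β : Module.Dual ℝ P.𝔞) :
      Module.finrank ℝ (P.rootSpace β) ≤ Module.finrank ℝ (P.rootSpace (-β)) := by
    let T : P.rootSpace β →ₗ[ℝ] P.rootSpace (-β) :=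
      ((Matrix.transposeLinearEquiv (Fin N) (Fin N) ℝ ℝ).toLinearMap.restrict
        (fun X hX => transpose_mem_rootSpace hX))
    refine LinearMap.finrank_le_finrank_of_injective (f := T) fun X Y h => ?_
    exact Subtype.ext (Matrix.transpose_injective (congrArg Subtype.val h))
  refine le_antisymm ?_ (key α)
  have := key (-α)
  rwa [neg_neg] at this

lemma bracket_mem_rootSpace {α β : Module.Dual ℝ P.𝔞} {X Y : Matrix (Fin N) (Fin N) ℝ}
    (hX : X ∈ P.rootSpace α) (hY : Y ∈ P.rootSpace β) : X * Y - Y * X ∈ P.rootSpace (α + β) := by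
  refine ⟨S.lie.lie_mem hX.1 hY.1, fun H => ?_⟩
  have h1 : (H : Matrix (Fin N) (Fin N) ℝ) * (X * Y - Y * X) - (X * Y - Y * X) * H =
      ((H * X - X * H) * Y - Y * (H * X - X * H)) + (X * (H * Y - Y * H) - (H * Y - Y * H) * X) := by
    noncomm_ring
  rw [h1, hX.2, hY.2, LinearMap.add_apply]
  simp only [smul_mul_assoc, mul_smul_comm, add_smul, smul_sub]
  abel

/-- The trace form as an inner product on matrices. -/
@[reducible] def _root_.Matrix.traceCore (N : ℕ) : InnerProductSpace.Core ℝ (Matrix (Fin N) (Fin N) ℝ) where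
  inner X Y := ∑ i, ∑ j, X i j * Y i j
  conj_inner_symm X Y := by simp [mul_comm]
  re_inner_nonneg X := by
    simp only [RCLike.re_to_real]
    exact Finset.sum_nonneg fun i _ => Finset.sum_nonneg fun j _ => mul_self_nonneg _
  add_left X Y Z := by simp [add_mul, Finset.sum_add_distrib]
  smul_left X Y r := by simp [Finset.mul_sum, mul_assoc]
  definite X h := by
    ext i j
    have h1 := (Finset.sum_eq_zero_iff_of_nonneg (fun i _ =>
      Finset.sum_nonneg fun j _ => mul_self_nonneg (X i j))).1 h i (Finset.mem_univ _)
    have h2 := (Finset.sum_eq_zero_iff_of_nonneg (fun j _ =>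
      mul_self_nonneg (X i j))).1 h1 j (Finset.mem_univ _)
    exact mul_self_eq_zero.1 h2

variable (P) in
-- The operators `ad H`, `H ∈ 𝔞`, commute and are symmetric for the trace form because `H` is a
-- symmetric matrix; hence they are simultaneously diagonalizable on the Lie algebra.
lemma span_rootVectors :
    Submodule.span ℝ {X : S.lie.toSubmodule | ∃ α, (X : Matrix (Fin N) (Fin N) ℝ) ∈ P.rootSpace α} =
      ⊤ := by
  let _ : NormedAddCommGroup (Matrix (Fin N) (Fin N) ℝ) := (Matrix.traceCore N).toNormedAddCommGroup
  let _ : InnerProductSpace ℝ (Matrix (Fin N) (Fin N) ℝ) := InnerProductSpace.ofCore _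
  have hin (X Y : Matrix (Fin N) (Fin N) ℝ) : inner ℝ X Y = Matrix.trace (Xᵀ * Y) := by
    simp only [Matrix.trace, Matrix.diag, Matrix.mul_apply, Matrix.transpose_apply]
    rw [Finset.sum_comm]
    rfl
  let T (H : P.𝔞) : S.lie.toSubmodule →ₗ[ℝ] S.lie.toSubmodule :=
    (LinearMap.mulLeft ℝ (H : Matrix (Fin N) (Fin N) ℝ) -
      LinearMap.mulRight ℝ (H : Matrix (Fin N) (Fin N) ℝ)).restrict
      (fun X hX => S.lie.lie_mem (P.mem_lie H H.2) hX)
  have hT (H : P.𝔞) (X : S.lie.toSubmodule) :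
      (T H X : Matrix (Fin N) (Fin N) ℝ) = H * X - X * H := rfl
  have hsymm (H : P.𝔞) : (T H).IsSymmetric := by
    intro X Y
    rw [Submodule.coe_inner, Submodule.coe_inner, hT, hT, hin, hin, Matrix.transpose_sub,
      Matrix.transpose_mul, Matrix.transpose_mul, P.symmetric H H.2, Matrix.sub_mul,
      Matrix.mul_sub, Matrix.trace_sub, Matrix.trace_sub, Matrix.mul_assoc, Matrix.mul_assoc,
      ← Matrix.mul_assoc _ _ (H : Matrix (Fin N) (Fin N) ℝ),
      Matrix.trace_mul_comm _ (H : Matrix (Fin N) (Fin N) ℝ)]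
  have hcomm : Pairwise fun H H' => Commute (T H) (T H') := by
    intro H H' _
    refine LinearMap.ext fun X => Subtype.ext ?_
    change (H : Matrix (Fin N) (Fin N) ℝ) * (H' * X - X * H') - (H' * X - X * H') * H =
      H' * (H * X - X * H) - (H * X - X * H) * H'
    have h := P.commute H H.2 H' H'.2
    have h1 : (H : Matrix (Fin N) (Fin N) ℝ) * (H' * X) = H' * (H * X) := by
      rw [← mul_assoc, h, mul_assoc]
    have h2 : (X : Matrix (Fin N) (Fin N) ℝ) * H' * H = X * H * H' := by
      rw [mul_assoc, ← h, mul_assoc]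
    rw [mul_sub, sub_mul, mul_sub, sub_mul, h1, h2]
    simp only [mul_assoc]
    abel
  rw [eq_top_iff, ← LinearMap.IsSymmetric.iSup_iInf_eq_top_of_commute hsymm hcomm]
  refine iSup_le fun χ X hX => ?_
  by_cases hX0 : X = 0
  · rw [hX0]; exact zero_mem _
  have hX' (H : P.𝔞) : (H : Matrix (Fin N) (Fin N) ℝ) * X - X * H =
      χ H • (X : Matrix (Fin N) (Fin N) ℝ) := by
    have := (Submodule.mem_iInf _).1 hX H
    rw [Module.End.mem_eigenspace_iff] at this
    exact congrArg Subtype.val this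
  have hX0' : (X : Matrix (Fin N) (Fin N) ℝ) ≠ 0 := fun h => hX0 (Subtype.ext h)
  have hinj := smul_left_injective ℝ hX0'
  -- A joint eigenvalue depends linearly on `H`, since the eigenvector is nonzero.
  let α : Module.Dual ℝ P.𝔞 :=
    { toFun := χ
      map_add' := fun H H' => hinj (by
        simp only [← hX', add_smul, Submodule.coe_add, add_mul, mul_add]; abel)
      map_smul' := fun c H => hinj (by
        simp only [← hX', smul_eq_mul, mul_smul, Submodule.coe_smul, smul_mul_assoc,
          mul_smul_comm, smul_sub, RingHom.id_apply]) }
  exact Submodule.subset_span ⟨α, X.2, hX'⟩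

end MinimalParabolic

namespace MinimalParabolic

variable {G : Type*} [Group G] [TopologicalSpace G] {N : ℕ}
  {S : SemisimpleLieGroup G N} (P : MinimalParabolic S)

/-- A basis of the Lie algebra consisting of root vectors. -/
structure RootBasis where
  ι : Type
  [fintype : Fintype ι]
  b : Module.Basis ι ℝ S.lie.toSubmodule
  root : ι → Module.Dual ℝ P.𝔞
  mem : ∀ i, (b i : Matrix (Fin N) (Fin N) ℝ) ∈ P.rootSpace (root i)

attribute [instance] RootBasis.fintype

lemma nonempty_rootBasis : Nonempty P.RootBasis := by
  let b := Module.Basis.ofSpan P.span_rootVectors.ge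
  have hb (i) : ∃ α, (b i : Matrix (Fin N) (Fin N) ℝ) ∈ P.rootSpace α :=
    Module.Basis.ofSpan_subset P.span_rootVectors.ge ⟨i, rfl⟩
  have : Finite _ := Module.Finite.finite_basis b
  let _ := Fintype.ofFinite
    ((linearIndepOn_empty ℝ id).extend (Set.empty_subset
      {X : S.lie.toSubmodule | ∃ α, (X : Matrix (Fin N) (Fin N) ℝ) ∈ P.rootSpace α}))
  exact ⟨{ ι := _, b := b, root := fun i => (hb i).choose, mem := fun i => (hb i).choose_spec }⟩

/-- The operator `ad H` on the Lie algebra. -/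
def adLie (H : P.𝔞) : S.lie.toSubmodule →ₗ[ℝ] S.lie.toSubmodule :=
  (LinearMap.mulLeft ℝ (H : Matrix (Fin N) (Fin N) ℝ) -
    LinearMap.mulRight ℝ (H : Matrix (Fin N) (Fin N) ℝ)).restrict
    (fun _ hX => S.lie.lie_mem (P.mem_lie H H.2) hX)

namespace RootBasis

variable {P} (B : P.RootBasis)

/-- The vectors of the basis as matrices. -/
def vec (i : B.ι) : Matrix (Fin N) (Fin N) ℝ := B.b i

lemma vec_mem_lie (i : B.ι) : B.vec i ∈ S.lie := (B.b i).2

lemma vec_mem (i : B.ι) : B.vec i ∈ P.rootSpace (B.root i) := B.mem i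

lemma linearIndependent_vec : LinearIndependent ℝ B.vec :=
  B.b.linearIndependent.map' S.lie.toSubmodule.subtype (Submodule.ker_subtype _)

lemma vec_ne_zero (i : B.ι) : B.vec i ≠ 0 := B.linearIndependent_vec.ne_zero i

lemma repr_adLie (H : P.𝔞) (X : S.lie.toSubmodule) (i : B.ι) :
    B.b.repr (P.adLie H X) i = B.root i H * B.b.repr X i := by
  have : B.b.coord i ∘ₗ P.adLie H = B.root i H • B.b.coord i := by
    refine B.b.ext fun j => ?_
    have hj : P.adLie H (B.b j) = B.root j H • B.b j := Subtype.ext ((B.mem j).2 H)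
    simp only [LinearMap.comp_apply, hj, map_smul, LinearMap.smul_apply, Module.Basis.coord_apply,
      Module.Basis.repr_self, smul_eq_mul]
    by_cases h : j = i
    · rw [h]
    · rw [Finsupp.single_eq_of_ne' h, mul_zero, mul_zero]
  exact LinearMap.congr_fun this X

lemma repr_eq_zero {α : Module.Dual ℝ P.𝔞} {X : S.lie.toSubmodule}
    (hX : (X : Matrix (Fin N) (Fin N) ℝ) ∈ P.rootSpace α) {i : B.ι} (hi : B.root i ≠ α) :
    B.b.repr X i = 0 := by
  obtain ⟨H, hH⟩ : ∃ H, B.root i H ≠ α H := by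
    by_contra! h; exact hi (LinearMap.ext h)
  have h1 : P.adLie H X = α H • X := Subtype.ext (hX.2 H)
  have h2 := B.repr_adLie H X i
  rw [h1, map_smul, Finsupp.smul_apply, smul_eq_mul] at h2
  have h3 : (B.root i H - α H) * B.b.repr X i = 0 := by linear_combination -h2
  exact (mul_eq_zero.1 h3).resolve_left (sub_ne_zero.2 hH)

lemma mem_span_of_repr {s : Set (Module.Dual ℝ P.𝔞)} {X : S.lie.toSubmodule}
    (h : ∀ i, B.root i ∉ s → B.b.repr X i = 0) :
    (X : Matrix (Fin N) (Fin N) ℝ) ∈ Submodule.span ℝ (B.vec '' {i | B.root i ∈ s}) := by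
  have h1 := congrArg Subtype.val (B.b.sum_repr X)
  rw [← h1, Submodule.coe_sum]
  refine sum_mem fun i _ => ?_
  by_cases hi : B.root i ∈ s
  · exact Submodule.smul_mem _ _ (Submodule.subset_span ⟨i, hi, rfl⟩)
  · rw [h i hi, zero_smul]; exact zero_mem _

lemma rootSpace_eq_span (α : Module.Dual ℝ P.𝔞) :
    P.rootSpace α = Submodule.span ℝ (B.vec '' {i | B.root i = α}) := by
  refine le_antisymm (fun X hX => ?_) (Submodule.span_le.2 ?_)
  · exact B.mem_span_of_repr (s := {α}) (X := ⟨X, hX.1⟩) fun i hi => B.repr_eq_zero hX hi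
  · rintro _ ⟨i, rfl, rfl⟩
    exact B.vec_mem i

lemma iSup_rootSpace (s : Set (Module.Dual ℝ P.𝔞)) :
    ⨆ α ∈ s, P.rootSpace α = Submodule.span ℝ (B.vec '' {i | B.root i ∈ s}) := by
  refine le_antisymm (iSup₂_le fun α hα => ?_) (Submodule.span_le.2 ?_)
  · rw [B.rootSpace_eq_span]
    exact Submodule.span_mono (Set.image_mono fun i (hi : B.root i = α) =>
      show B.root i ∈ s from hi ▸ hα)
  · rintro _ ⟨i, hi, rfl⟩
    exact Submodule.mem_iSup_of_mem (B.root i) (Submodule.mem_iSup_of_mem hi (B.vec_mem i))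

lemma iSup_rootSpace_neg (s : Set (Module.Dual ℝ P.𝔞)) :
    ⨆ α ∈ s, P.rootSpace (-α) = Submodule.span ℝ (B.vec '' {i | -B.root i ∈ s}) := by
  have : ⨆ α ∈ s, P.rootSpace (-α) = ⨆ α ∈ {α | -α ∈ s}, P.rootSpace α := by
    refine le_antisymm (iSup₂_le fun α hα => ?_) (iSup₂_le fun α hα => ?_)
    · exact le_iSup₂_of_le (-α) (by simpa using hα) le_rfl
    · exact le_iSup₂_of_le (-α) hα (by rw [neg_neg])
  rw [this, B.iSup_rootSpace]
  rfl

lemma finrank_rootSpace [DecidableEq (Module.Dual ℝ P.𝔞)] (α : Module.Dual ℝ P.𝔞) :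
    Module.finrank ℝ (P.rootSpace α) = (Finset.univ.filter fun i => B.root i = α).card := by
  rw [B.rootSpace_eq_span]
  have h1 : LinearIndependent ℝ fun i : {i // B.root i = α} => B.vec i :=
    B.linearIndependent_vec.comp _ Subtype.val_injective
  have h2 := finrank_span_eq_card h1
  rw [Fintype.card_subtype] at h2
  rw [← h2, Set.image_eq_range]
  rfl

lemma exists_root_eq {α : Module.Dual ℝ P.𝔞} (h : P.rootSpace α ≠ ⊥) : ∃ i, B.root i = α := by
  by_contra! h1
  apply h
  rw [B.rootSpace_eq_span, Submodule.span_eq_bot]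
  rintro _ ⟨i, hi, rfl⟩
  exact absurd hi (h1 i)

lemma rootSpace_ne_bot (i : B.ι) : P.rootSpace (B.root i) ≠ ⊥ := fun h =>
  B.vec_ne_zero i (by have := B.vec_mem i; rwa [h, Submodule.mem_bot] at this)

lemma finite_posRoots (B : P.RootBasis) : P.posRoots.Finite :=
  (Set.finite_range B.root).subset fun _ hα => B.exists_root_eq hα.1.2

/-- Elements of `𝔞` on which all roots vanish are zero, as the Lie algebra is semisimple. -/
lemma eq_zero_of_roots (B : P.RootBasis) {H : P.𝔞} (h : ∀ α ∈ P.roots, α H = 0) : H = 0 := by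
  have hroot (i : B.ι) : B.root i H = 0 := by
    by_cases h0 : B.root i = 0
    · rw [h0]; rfl
    · exact h _ ⟨h0, B.rootSpace_ne_bot i⟩
  have had (X : S.lie.toSubmodule) : P.adLie H X = 0 := by
    apply B.b.repr.injective
    ext i
    rw [B.repr_adLie, hroot, zero_mul, map_zero, Finsupp.zero_apply]
  have := S.isSemisimple
  -- All eigenvalues of `ad H` vanish, so `H` is central, and a semisimple Lie algebra has trivial
  -- center.
  have hc : (⟨H, P.mem_lie H H.2⟩ : S.lie) ∈ LieAlgebra.center ℝ S.lie := by
    rw [LieModule.mem_maxTrivSubmodule]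
    intro X
    rw [← lie_skew, neg_eq_zero]
    exact Subtype.ext (congrArg Subtype.val (had X))
  rw [LieAlgebra.center_eq_bot, LieSubmodule.mem_bot] at hc
  exact Subtype.ext (congrArg (fun X : S.lie => (X : Matrix (Fin N) (Fin N) ℝ)) hc)

end RootBasis

variable {P}

lemma IsPos.add {α β : Module.Dual ℝ P.𝔞} (hα : P.IsPos α) (hβ : P.IsPos β) : P.IsPos (α + β) := by
  obtain ⟨i, hi, hi'⟩ := hα
  obtain ⟨j, hj, hj'⟩ := hβ
  rcases lt_trichotomy i j with h | h | h
  · exact ⟨i, by simp [hj' i h, hi], fun k hk => by simp [hi' k hk, hj' k (hk.trans h)]⟩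
  · subst h
    exact ⟨i, by simpa using add_pos hi hj, fun k hk => by simp [hi' k hk, hj' k hk]⟩
  · exact ⟨j, by simp [hi' j h, hj], fun k hk => by simp [hj' k hk, hi' k (hk.trans h)]⟩

lemma isPos_or_isPos_neg {α : Module.Dual ℝ P.𝔞} (hα : α ≠ 0) : P.IsPos α ∨ P.IsPos (-α) := by
  classical
  have hne : (Finset.univ.filter fun i => α (P.order i) ≠ 0).Nonempty := by
    by_contra h
    rw [Finset.not_nonempty_iff_eq_empty, Finset.filter_eq_empty_iff] at h
    exact hα (P.order.ext fun i => by simpa using h (Finset.mem_univ i))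
  set i := (Finset.univ.filter fun i => α (P.order i) ≠ 0).min' hne
  have hi : α (P.order i) ≠ 0 := (Finset.mem_filter.1 (Finset.min'_mem _ hne)).2
  have hlt : ∀ j < i, α (P.order j) = 0 := fun j hj => by
    by_contra h
    exact absurd (Finset.min'_le _ j (Finset.mem_filter.2 ⟨Finset.mem_univ _, h⟩)) (not_le.2 hj)
  rcases lt_or_gt_of_ne hi with h | h
  · exact Or.inr ⟨i, by simpa using h, fun j hj => by simpa using hlt j hj⟩
  · exact Or.inl ⟨i, h, hlt⟩

lemma IsPos.ne_zero {α : Module.Dual ℝ P.𝔞} (hα : P.IsPos α) : α ≠ 0 := by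
  rintro rfl
  obtain ⟨i, hi, -⟩ := hα
  simp at hi

lemma mem_posRoots_or_neg {α : Module.Dual ℝ P.𝔞} (hα : α ∈ P.roots) :
    α ∈ P.posRoots ∨ -α ∈ P.posRoots := by
  rcases isPos_or_isPos_neg hα.1 with h | h
  · exact Or.inl ⟨hα, h⟩
  · exact Or.inr ⟨⟨neg_ne_zero.2 hα.1, mt rootSpace_neg_eq_bot_iff.1 hα.2⟩, h⟩

/-- The powers of a small `ε` imitate the lexicographic order: if `i` is the first index with a
nonzero coordinate, the value is `ε ^ i * q ε` with `q` continuous and `q 0` equal to that positive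
coordinate. -/
lemma IsPos.eventually_pos {α : Module.Dual ℝ P.𝔞} (hα : P.IsPos α) :
    ∀ᶠ ε : ℝ in nhdsWithin 0 (Set.Ioi 0), 0 < α (∑ i : Fin _, ε ^ (i : ℕ) • P.order i) := by
  obtain ⟨i, hi, hlt⟩ := hα
  let q : ℝ → ℝ := fun ε => ∑ j, if i ≤ j then ε ^ ((j : ℕ) - i) * α (P.order j) else 0
  have hq0 : q 0 = α (P.order i) := by
    simp only [q]
    rw [Finset.sum_eq_single i]
    · simp
    · intro j _ hj
      split_ifs with h
      · have : (j : ℕ) - i ≠ 0 := by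
          have : i < j := lt_of_le_of_ne h (Ne.symm hj)
          have : (i : ℕ) < j := this
          omega
        simp [this]
      · rfl
    · simp
  have hqc : Continuous q := by
    refine continuous_finsetSum _ fun j _ => ?_
    split_ifs
    · fun_prop
    · fun_prop
  have h1 : ∀ᶠ ε in nhdsWithin 0 (Set.Ioi 0), 0 < q ε :=
    (hqc.tendsto 0).mono_left nhdsWithin_le_nhds |>.eventually (lt_mem_nhds (by rw [hq0]; exact hi))
  filter_upwards [h1, self_mem_nhdsWithin] with ε hε hε0
  have : α (∑ j : Fin _, ε ^ (j : ℕ) • P.order j) = ε ^ (i : ℕ) * q ε := by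
    simp only [q, map_sum, map_smul, smul_eq_mul, Finset.mul_sum]
    refine Finset.sum_congr rfl fun j _ => ?_
    split_ifs with h
    · have h' : (i : ℕ) ≤ j := h
      rw [← mul_assoc, ← pow_add, Nat.add_sub_cancel' h']
    · rw [hlt j (not_le.1 h)]; simp
  rw [this]
  exact mul_pos (pow_pos hε0 _) hε

/-- There is an element of `𝔞` in the positive chamber. -/
lemma RootBasis.exists_chamber (B : P.RootBasis) : ∃ H : P.𝔞, ∀ α ∈ P.posRoots, 0 < α H := by
  have h : ∀ᶠ ε : ℝ in nhdsWithin 0 (Set.Ioi 0), ∀ α ∈ P.posRoots,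
      0 < α (∑ i : Fin _, ε ^ (i : ℕ) • P.order i) :=
    (Filter.eventually_all_finite B.finite_posRoots).2 fun α hα => IsPos.eventually_pos hα.2
  obtain ⟨ε, hε⟩ := h.exists
  exact ⟨_, hε⟩

/-- The simple roots span the dual of `𝔞`. -/
lemma RootBasis.span_simpleRoots (B : P.RootBasis) : Submodule.span ℝ P.simpleRoots = ⊤ := by
  refine Submodule.span_eq_top_of_ne_zero fun H hH => ?_
  by_contra! h0
  refine hH (B.eq_zero_of_roots fun α hα => ?_)
  have key : ∀ β ∈ P.posRoots, β H = 0 := by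
    obtain ⟨H₀, hH₀⟩ := B.exists_chamber
    by_contra! h1
    obtain ⟨β, hβ, hβH⟩ := h1
    -- Among the positive roots not vanishing at `H`, take one of least value at the chamber element
    -- `H₀`. It is not simple, so it is a sum of two positive roots of smaller value, both zero at
    -- `H`: a contradiction.
    obtain ⟨γ, ⟨hγ, hγH⟩, hmin⟩ := Set.exists_min_image {β | β ∈ P.posRoots ∧ β H ≠ 0}
      (fun β => β H₀) (B.finite_posRoots.subset fun _ h => h.1) ⟨β, hβ, hβH⟩
    have hns : γ ∉ P.simpleRoots := fun h => hγH (h0 γ h)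
    obtain ⟨δ, hδ, ε, hε, rfl⟩ : ∃ δ ∈ P.posRoots, ∃ ε ∈ P.posRoots, γ = δ + ε := by
      by_contra! h
      exact hns ⟨hγ, h⟩
    have h2 : δ H = 0 := by
      by_contra h
      have := hmin δ ⟨hδ, h⟩
      simp only [LinearMap.add_apply] at this
      linarith [hH₀ ε hε]
    have h3 : ε H = 0 := by
      by_contra h
      have := hmin ε ⟨hε, h⟩
      simp only [LinearMap.add_apply] at this
      linarith [hH₀ δ hδ]
    exact hγH (by rw [LinearMap.add_apply, h2, h3, add_zero])
  rcases mem_posRoots_or_neg hα with h | h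
  · exact key α h
  · simpa using key _ h

end MinimalParabolic

/-! ### Root vectors arranged in unipotent chains. -/

namespace Matrix

variable {N : ℕ} {φ : Matrix (Fin N) (Fin N) ℝ ≃ₐ[ℝ] Matrix (Fin N) (Fin N) ℝ} {d : Fin N → ℝ}
  {H : Matrix (Fin N) (Fin N) ℝ}

/-- The projection onto the component of `ad H`-degree `c`, where `φ H = diagonal d`. -/
def gradeProj (φ : Matrix (Fin N) (Fin N) ℝ ≃ₐ[ℝ] Matrix (Fin N) (Fin N) ℝ) (d : Fin N → ℝ)
    (c : ℝ) : Matrix (Fin N) (Fin N) ℝ →ₗ[ℝ] Matrix (Fin N) (Fin N) ℝ :=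
  φ.symm.toLinearMap ∘ₗ
    { toFun := fun Y => of fun i j => if d i - d j = c then Y i j else 0
      map_add' := fun X Y => by ext i j; by_cases h : d i - d j = c <;> simp [h]
      map_smul' := fun t X => by ext i j; by_cases h : d i - d j = c <;> simp [h] } ∘ₗ φ.toLinearMap

lemma apply_gradeProj (c : ℝ) (X : Matrix (Fin N) (Fin N) ℝ) (i j : Fin N) :
    φ (gradeProj φ d c X) i j = if d i - d j = c then φ X i j else 0 := by
  simp [gradeProj]

lemma gradeProj_of_ad_eq (hφ : φ H = diagonal d) {c : ℝ} {X : Matrix (Fin N) (Fin N) ℝ}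
    (hX : H * X - X * H = c • X) : gradeProj φ d c X = X := by
  apply φ.injective
  ext i j
  rw [apply_gradeProj]
  split_ifs with h
  · rfl
  · rw [apply_eq_zero_of_ad_eq hφ hX h]

lemma gradeProj_of_ad_ne (hφ : φ H = diagonal d) {c c' : ℝ} {X : Matrix (Fin N) (Fin N) ℝ}
    (hX : H * X - X * H = c' • X) (h : c' ≠ c) : gradeProj φ d c X = 0 := by
  apply φ.injective
  ext i j
  rw [apply_gradeProj, map_zero, zero_apply]
  split_ifs with hij
  · exact apply_eq_zero_of_ad_eq hφ hX (by rw [hij]; exact h.symm)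
  · rfl

lemma gradeProj_of_mem_filtration {c c' : ℝ} (h : c < c') {X : Matrix (Fin N) (Fin N) ℝ}
    (hX : X ∈ filtration φ d c') : gradeProj φ d c X = 0 := by
  apply φ.injective
  ext i j
  rw [apply_gradeProj, map_zero, zero_apply]
  split_ifs with hij
  · exact hX i j (by rw [hij]; exact h)
  · rfl

end Matrix

namespace MinimalParabolic

variable {G : Type*} [Group G] [TopologicalSpace G] {N : ℕ}
  {S : SemisimpleLieGroup G N} {P : MinimalParabolic S}

namespace RootBasis

variable (B : P.RootBasis) {φ : Matrix (Fin N) (Fin N) ℝ ≃ₐ[ℝ] Matrix (Fin N) (Fin N) ℝ}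
  {d : Fin N → ℝ} {R : Set (Module.Dual ℝ P.𝔞)} {H : P.𝔞}

/-- The list is sorted by degree, and `hsat` says that it omits no root vector of `R` of degree
above one of its entries. A bracket with the head has degree strictly above that of the head, so it
falls in the span of the tail. Independence modulo degree `2h` follows by projecting to the degree
of the head, which preserves the span of the tail and kills degree `2h`. -/
lemma isUnipotentChain (hφ : φ (H : Matrix (Fin N) (Fin N) ℝ) = Matrix.diagonal d)
    (hpos : ∀ α ∈ R, 0 < α H)
    (hadd : ∀ α ∈ R, ∀ β ∈ R, P.rootSpace (α + β) ≠ ⊥ → α + β ∈ R) {l : List B.ι}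
    (hnd : l.Nodup) (hs : l.Pairwise fun i j => B.root i H ≤ B.root j H)
    (hR : ∀ i ∈ l, B.root i ∈ R)
    (hsat : ∀ i ∈ l, ∀ k, B.root k ∈ R → B.root i H < B.root k H → k ∈ l) :
    S.IsUnipotentChain φ d (l.map B.vec) := by
  induction l with
  | nil => trivial
  | cons i l ih =>
    obtain ⟨hil, hnd'⟩ := List.nodup_cons.1 hnd
    obtain ⟨hi, hs'⟩ := List.pairwise_cons.1 hs
    have hiR := hR i (by simp)
    have hi0 := hpos _ hiR
    have hspan : {Y | Y ∈ l.map B.vec} = B.vec '' {j | j ∈ l} := by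
      ext Y; simp
    have hdeg (j : B.ι) : (H : Matrix (Fin N) (Fin N) ℝ) * B.vec j - B.vec j * H =
        B.root j H • B.vec j := (B.vec_mem j).2 H
    refine ⟨⟨B.vec_mem_lie i, ⟨B.root i H, hi0, Matrix.mem_filtration_of_ad_eq hφ (hdeg i), ?_, ?_⟩,
      ?_⟩, ih hnd' hs' (fun j hj => hR j (List.mem_cons_of_mem _ hj)) fun j hj k hk hjk => ?_⟩
    · rw [hspan, Submodule.span_le]
      rintro _ ⟨j, hj, rfl⟩
      exact Matrix.filtration_anti (hi j hj) (Matrix.mem_filtration_of_ad_eq hφ (hdeg j))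
    · intro hmem
      obtain ⟨Y, hY, Z, hZ, hYZ⟩ := Submodule.mem_sup.1 hmem
      have h1 := congrArg (Matrix.gradeProj φ d (B.root i H)) hYZ
      rw [map_add, Matrix.gradeProj_of_mem_filtration (by linarith) hZ, add_zero,
        Matrix.gradeProj_of_ad_eq hφ (hdeg i)] at h1
      have h2 : Submodule.span ℝ {Y | Y ∈ l.map B.vec} ≤
          (Submodule.span ℝ {Y | Y ∈ l.map B.vec}).comap (Matrix.gradeProj φ d (B.root i H)) := by
        refine Submodule.span_le.2 fun X hX => ?_
        obtain ⟨j, hj, rfl⟩ := List.mem_map.1 hX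
        by_cases h : B.root j H = B.root i H
        · change Matrix.gradeProj φ d (B.root i H) (B.vec j) ∈
            Submodule.span ℝ {Y | Y ∈ l.map B.vec}
          rw [← h, Matrix.gradeProj_of_ad_eq hφ (hdeg j)]
          exact Submodule.subset_span hX
        · change Matrix.gradeProj φ d (B.root i H) (B.vec j) ∈
            Submodule.span ℝ {Y | Y ∈ l.map B.vec}
          rw [Matrix.gradeProj_of_ad_ne hφ (hdeg j) h]
          exact zero_mem _
      have h3 : B.vec i ∈ Submodule.span ℝ (B.vec '' {j | j ∈ l}) := by
        rw [← hspan, ← h1]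
        exact h2 hY
      exact B.linearIndependent_vec.notMem_span_image (s := {j | j ∈ l}) hil h3
    · have h1 : Submodule.span ℝ {Y | Y ∈ l.map B.vec} ≤
          (Submodule.span ℝ {Y | Y ∈ l.map B.vec}).comap
            (LinearMap.mulLeft ℝ (B.vec i) - LinearMap.mulRight ℝ (B.vec i)) := by
        refine Submodule.span_le.2 fun X hX => ?_
        obtain ⟨j, hj, rfl⟩ := List.mem_map.1 hX
        have h2 := bracket_mem_rootSpace (B.vec_mem i) (B.vec_mem j)
        have hjR := hR j (List.mem_cons_of_mem _ hj)
        change B.vec i * B.vec j - B.vec j * B.vec i ∈ Submodule.span ℝ {Y | Y ∈ l.map B.vec}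
        rw [B.rootSpace_eq_span] at h2
        refine Submodule.span_mono ?_ h2
        rintro _ ⟨k, hk, rfl⟩
        have hk' : B.root k = B.root i + B.root j := hk
        have hkR : B.root k ∈ R := hk' ▸ hadd _ hiR _ hjR (hk' ▸ B.rootSpace_ne_bot k)
        have hlt : B.root i H < B.root k H := by
          rw [hk', LinearMap.add_apply]
          linarith [hpos _ hjR]
        refine List.mem_map.2 ⟨k, ?_, rfl⟩
        rcases List.mem_cons.1 (hsat i (by simp) k hkR hlt) with h | h
        · rw [h] at hlt; exact absurd hlt (lt_irrefl _)
        · exact h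
      exact fun Y hY => h1 hY
    · rcases List.mem_cons.1 (hsat j (List.mem_cons_of_mem _ hj) k hk hjk) with h | h
      · rw [h] at hjk; exact absurd hjk (not_lt.2 (hi j hj))
      · exact h

/-- The root vectors for a closed set of roots which are positive on `H` form a chain. -/
lemma exists_chain (hφ : φ (H : Matrix (Fin N) (Fin N) ℝ) = Matrix.diagonal d)
    (hpos : ∀ α ∈ R, 0 < α H)
    (hadd : ∀ α ∈ R, ∀ β ∈ R, P.rootSpace (α + β) ≠ ⊥ → α + β ∈ R) :
    ∃ l : List B.ι, l.Nodup ∧ (∀ i, i ∈ l ↔ B.root i ∈ R) ∧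
      S.IsUnipotentChain φ d (l.map B.vec) ∧
      Submodule.span ℝ {Y | Y ∈ l.map B.vec} = Submodule.span ℝ (B.vec '' {i | B.root i ∈ R}) := by
  classical
  let r : B.ι → B.ι → Prop := fun i j => B.root i H ≤ B.root j H
  have : Std.Total r := ⟨fun i j => le_total _ _⟩
  have : IsTrans B.ι r := ⟨fun i j k => le_trans⟩
  let l := ((Finset.univ.filter fun i => B.root i ∈ R).toList).insertionSort r
  have hperm := List.perm_insertionSort r (Finset.univ.filter fun i => B.root i ∈ R).toList
  have hl (i : B.ι) : i ∈ l ↔ B.root i ∈ R := by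
    rw [hperm.mem_iff]; simp
  have hnd : l.Nodup := hperm.nodup_iff.2 (Finset.nodup_toList _)
  refine ⟨l, hnd, hl, B.isUnipotentChain hφ hpos hadd hnd (List.pairwise_insertionSort r _)
    (fun i hi => (hl i).1 hi) (fun _ _ k hk _ => (hl k).2 hk), ?_⟩
  congr 1
  ext Y
  simp [hl]

end RootBasis

/-- A chain of root vectors which generates `V`. -/
structure OppositeChain (P : MinimalParabolic S) (B : P.RootBasis)
    (φ : Matrix (Fin N) (Fin N) ℝ ≃ₐ[ℝ] Matrix (Fin N) (Fin N) ℝ) (d : Fin N → ℝ) where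
  l : List B.ι
  nodup : l.Nodup
  mem_iff : ∀ i, i ∈ l ↔ -B.root i ∈ P.posRoots
  chain : S.IsUnipotentChain φ d (l.map B.vec)
  span_eq : Submodule.span ℝ {Y | Y ∈ l.map B.vec} = P.𝔳

lemma exists_oppositeChain (B : P.RootBasis) {H : P.𝔞} (hH : ∀ α ∈ P.posRoots, 0 < α H)
    {φ : Matrix (Fin N) (Fin N) ℝ ≃ₐ[ℝ] Matrix (Fin N) (Fin N) ℝ} {d : Fin N → ℝ}
    (hφ : φ (H : Matrix (Fin N) (Fin N) ℝ) = Matrix.diagonal d) :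
    Nonempty (P.OppositeChain B φ (-d)) := by
  -- The roots of `𝔳` are negative on `H`, so the grading is reversed to make their degrees
  -- positive.
  obtain ⟨l, h1, h2, h3, h4⟩ := B.exists_chain (R := {α | -α ∈ P.posRoots}) (H := -H) (d := -d)
    (φ := φ) (by rw [Submodule.coe_neg, map_neg, hφ]; exact Matrix.diagonal_neg d)
    (fun α hα => by simpa using hH _ hα)
    (fun α hα β hβ h => by
      have hαβ : P.IsPos (-(α + β)) := by
        rw [neg_add]; exact IsPos.add hα.2 hβ.2
      exact ⟨⟨hαβ.ne_zero, mt rootSpace_neg_eq_bot_iff.1 h⟩, hαβ⟩)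
  exact ⟨⟨l, h1, h2, h3, by rw [h4, MinimalParabolic.𝔳, B.iSup_rootSpace_neg]; rfl⟩⟩

lemma exists_chain_𝔫 (B : P.RootBasis) {H : P.𝔞} (hH : ∀ α ∈ P.posRoots, 0 < α H)
    {φ : Matrix (Fin N) (Fin N) ℝ ≃ₐ[ℝ] Matrix (Fin N) (Fin N) ℝ} {d : Fin N → ℝ}
    (hφ : φ (H : Matrix (Fin N) (Fin N) ℝ) = Matrix.diagonal d) :
    ∃ L, S.IsUnipotentChain φ d L ∧ Submodule.span ℝ {Y | Y ∈ L} = P.𝔫 := by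
  obtain ⟨l, h1, h2, h3, h4⟩ := B.exists_chain (R := P.posRoots) hφ hH
    (fun α hα β hβ h => ⟨⟨(IsPos.add hα.2 hβ.2).ne_zero, h⟩, IsPos.add hα.2 hβ.2⟩)
  exact ⟨_, h3, by rw [h4, MinimalParabolic.𝔫, B.iSup_rootSpace]⟩

end MinimalParabolic

/-! ### Exponential and logarithm on `A`; uniqueness of the `VMAN` decomposition. -/

namespace Matrix

variable {N : ℕ}

open scoped Matrix.Norms.Operator in
lemma algEquiv_exp (φ : Matrix (Fin N) (Fin N) ℝ ≃ₐ[ℝ] Matrix (Fin N) (Fin N) ℝ)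
    (X : Matrix (Fin N) (Fin N) ℝ) : φ (NormedSpace.exp X) = NormedSpace.exp (φ X) := by
  let _ : NormedAlgebra ℚ (Matrix (Fin N) (Fin N) ℝ) := NormedAlgebra.restrictScalars ℚ ℝ _
  exact NormedSpace.map_exp φ φ.toLinearMap.continuous_of_finiteDimensional X

lemma eq_zero_of_exp_eq_one {Z : Matrix (Fin N) (Fin N) ℝ} (hZ : Zᵀ = Z)
    (h : NormedSpace.exp Z = 1) : Z = 0 := by
  obtain ⟨φ, d, hφ⟩ := exists_algEquiv_eq_diagonal hZ
  have h1 := algEquiv_exp φ Z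
  rw [h, map_one, hφ, exp_diagonal, ← diagonal_one] at h1
  have h2 : d = 0 := by
    funext i
    have h3 := congrFun (diagonal_injective h1) i
    rw [Pi.coe_exp, ← Real.exp_eq_exp_ℝ] at h3
    exact Real.exp_eq_one_iff _ |>.1 h3.symm
  apply φ.injective
  rw [hφ, h2, map_zero]
  exact diagonal_zero

end Matrix

lemma SemisimpleLieGroup.IsUnipotentChain.exists_le_filtration {G : Type*} [Group G]
    [TopologicalSpace G] {N : ℕ} {S : SemisimpleLieGroup G N}
    {φ : Matrix (Fin N) (Fin N) ℝ ≃ₐ[ℝ] Matrix (Fin N) (Fin N) ℝ}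
    {d : Fin N → ℝ} {L : List (Matrix (Fin N) (Fin N) ℝ)} (hL : S.IsUnipotentChain φ d L) :
    ∃ h > 0, Submodule.span ℝ {Y | Y ∈ L} ≤ Matrix.filtration φ d h := by
  cases L with
  | nil => exact ⟨1, one_pos, by simp⟩
  | cons X L =>
    obtain ⟨h, hh, hX, hLh, -⟩ := hL.1.2.1
    refine ⟨h, hh, ?_⟩
    rw [SemisimpleLieGroup.span_cons_eq]
    exact sup_le ((Submodule.span_singleton_le_iff_mem _ _).2 hX) hLh

lemma SemisimpleLieGroup.IsUnipotentChain.exists_mat_sub_one_mem {G : Type*} [Group G]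
    [TopologicalSpace G] [IsTopologicalGroup G] {N : ℕ} {S : SemisimpleLieGroup G N}
    {φ : Matrix (Fin N) (Fin N) ℝ ≃ₐ[ℝ] Matrix (Fin N) (Fin N) ℝ}
    {d : Fin N → ℝ} {L : List (Matrix (Fin N) (Fin N) ℝ)} (hL : S.IsUnipotentChain φ d L) :
    ∃ h > 0, ∀ g ∈ S.chainGroup L, S.mat g - 1 ∈ Matrix.filtration φ d h := by
  obtain ⟨h, hh, hLh⟩ := hL.exists_le_filtration
  exact ⟨h, hh, fun g hg => sup_le hLh (Matrix.filtration_anti (by linarith))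
    (hL.mat_sub_one_mem hh hLh hg)⟩

namespace MinimalParabolic

variable {G : Type*} [Group G] [TopologicalSpace G] [IsTopologicalGroup G] {N : ℕ}
  {S : SemisimpleLieGroup G N} {P : MinimalParabolic S}

lemma coe_expA (H : P.𝔞) : (P.expA H : G) = S.E (H : Matrix (Fin N) (Fin N) ℝ) :=
  S.exp_eq_E (P.mem_lie H H.2)

lemma mat_expA (H : P.𝔞) : S.mat (P.expA H) = NormedSpace.exp (H : Matrix (Fin N) (Fin N) ℝ) := by
  rw [coe_expA, S.mat_E (P.mem_lie H H.2)]

lemma expA_add (H H' : P.𝔞) : P.expA (H + H') = P.expA H * P.expA H' := by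
  ext
  rw [Subgroup.coe_mul, coe_expA, coe_expA, coe_expA, Submodule.coe_add,
    S.E_add (P.mem_lie H H.2) (P.mem_lie H' H'.2) (P.commute H H.2 H' H'.2)]

lemma expA_zero : P.expA 0 = 1 := by
  ext
  rw [coe_expA, Submodule.coe_zero, S.E_zero, Subgroup.coe_one]

lemma expA_neg (H : P.𝔞) : P.expA (-H) = (P.expA H)⁻¹ := by
  rw [eq_inv_iff_mul_eq_one, ← expA_add, neg_add_cancel, expA_zero]

lemma continuous_coe_expA : Continuous fun H : P.𝔞 => (P.expA H : G) := by
  simp_rw [coe_expA]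
  exact S.continuous_E continuous_subtype_val fun H => P.mem_lie H H.2

lemma continuous_expA : Continuous P.expA := continuous_induced_rng.2 continuous_coe_expA

lemma eq_zero_of_mat_expA {H : P.𝔞} (h : S.mat (P.expA H) = 1) : H = 0 := by
  rw [mat_expA] at h
  exact Subtype.ext (Matrix.eq_zero_of_exp_eq_one (P.symmetric H H.2) h)

lemma expA_injective : Function.Injective P.expA := by
  intro H H' h
  rw [← sub_eq_zero]
  apply eq_zero_of_mat_expA
  rw [sub_eq_add_neg, expA_add, expA_neg, h, mul_inv_cancel, Subgroup.coe_one, S.mat_one]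

/-- Since `𝔞` is abelian, the exponentials already form a subgroup. -/
lemma exists_expA_eq (a : P.A) : ∃ H, P.expA H = a := by
  let K : Subgroup G :=
    { carrier := {g | ∃ H, (P.expA H : G) = g}
      one_mem' := ⟨0, by rw [expA_zero, Subgroup.coe_one]⟩
      mul_mem' := by
        rintro _ _ ⟨H, rfl⟩ ⟨H', rfl⟩
        exact ⟨H + H', by rw [expA_add, Subgroup.coe_mul]⟩
      inv_mem' := by
        rintro _ ⟨H, rfl⟩
        exact ⟨-H, by rw [expA_neg, Subgroup.coe_inv]⟩ }
  have hK : P.A ≤ K := S.analyticSubgroup_le P.mem_lie fun X hX => ⟨⟨X, hX⟩, coe_expA _⟩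
  obtain ⟨H, hH⟩ := hK a.2
  exact ⟨H, Subtype.ext hH⟩

lemma log_expA (H : P.𝔞) : P.log (P.expA H) = H := by
  have h : ∃ H' : P.𝔞, S.IsExp (H' : Matrix (Fin N) (Fin N) ℝ) (P.expA H : G) :=
    ⟨H, by rw [coe_expA]; exact S.isExp_E (P.mem_lie H H.2)⟩
  rw [log, dif_pos h]
  apply expA_injective
  ext
  rw [coe_expA]
  exact ((S.isExp_iff (P.mem_lie _ h.choose.2)).1 h.choose_spec).symm

lemma expA_log (a : P.A) : P.expA (P.log a) = a := by
  obtain ⟨H, rfl⟩ := exists_expA_eq a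
  rw [log_expA]

lemma log_mul (a b : P.A) : P.log (a * b) = P.log a + P.log b := by
  apply expA_injective
  rw [expA_log, expA_add, expA_log, expA_log]

lemma log_inv (a : P.A) : P.log a⁻¹ = -P.log a := by
  apply expA_injective
  rw [expA_log, expA_neg, expA_log]

/-- The groups `V` and `N` are generated by chains of root vectors, for opposite gradings. -/
structure ChainData (P : MinimalParabolic S) where
  B : P.RootBasis
  H : P.𝔞
  φ : Matrix (Fin N) (Fin N) ℝ ≃ₐ[ℝ] Matrix (Fin N) (Fin N) ℝ
  d : Fin N → ℝ
  hφ : φ (H : Matrix (Fin N) (Fin N) ℝ) = Matrix.diagonal d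
  V : P.OppositeChain B φ (-d)
  L : List (Matrix (Fin N) (Fin N) ℝ)
  chain : S.IsUnipotentChain φ d L
  span_eq : Submodule.span ℝ {Y | Y ∈ L} = P.𝔫

omit [IsTopologicalGroup G] in
variable (P) in
lemma nonempty_chainData : Nonempty P.ChainData := by
  obtain ⟨B⟩ := P.nonempty_rootBasis
  obtain ⟨H, hH⟩ := B.exists_chamber
  obtain ⟨φ, d, hφ⟩ := Matrix.exists_algEquiv_eq_diagonal (P.symmetric H H.2)
  obtain ⟨V⟩ := exists_oppositeChain B hH hφ
  obtain ⟨L, h1, h2⟩ := exists_chain_𝔫 B hH hφ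
  exact ⟨⟨B, H, φ, d, hφ, V, L, h1, h2⟩⟩

namespace ChainData

variable (D : P.ChainData)

omit [IsTopologicalGroup G] in
lemma chainGroup_V : S.chainGroup (D.V.l.map D.B.vec) = P.V := by
  rw [SemisimpleLieGroup.chainGroup, D.V.span_eq]; rfl

omit [IsTopologicalGroup G] in
lemma chainGroup_N : S.chainGroup D.L = P.Nplus := by
  rw [SemisimpleLieGroup.chainGroup, D.span_eq]; rfl

omit [IsTopologicalGroup G] in
lemma mat_centralizer_mem {g : G} (hg : g ∈ P.centralizer) :
    S.mat g ∈ Matrix.filtration D.φ D.d 0 ∧ S.mat g ∈ Matrix.filtration D.φ (-D.d) 0 := by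
  have h := hg D.H D.H.2
  refine ⟨Matrix.mem_filtration_of_ad_eq D.hφ (by rw [h, sub_self, zero_smul]),
    Matrix.mem_filtration_of_ad_eq (H := -(D.H : Matrix (Fin N) (Fin N) ℝ)) ?_ ?_⟩
  · rw [map_neg, D.hφ]; exact Matrix.diagonal_neg D.d
  · rw [neg_mul, mul_neg, h, sub_self, zero_smul]

end ChainData

omit [IsTopologicalGroup G] in
lemma M_le_centralizer : P.M ≤ P.centralizer := inf_le_left

/-- Uniqueness of the decomposition in `VMAN`. -/
lemma cell_unique {v v' : P.V} {m m' : P.M} {a a' : P.A} {n n' : P.Nplus}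
    (h : (v * m * a * n : G) = v' * m' * a' * n') : v = v' ∧ m = m' ∧ a = a' := by
  obtain ⟨D⟩ := P.nonempty_chainData
  obtain ⟨c, hc, hV⟩ := D.V.chain.exists_mat_sub_one_mem
  obtain ⟨c', hc', hN⟩ := D.chain.exists_mat_sub_one_mem
  rw [D.chainGroup_V] at hV
  rw [D.chainGroup_N] at hN
  have hz (z : P.M) (b : P.A) : (z * b : G) ∈ P.centralizer :=
    mul_mem (M_le_centralizer z.2) (P.A_le_centralizer b.2)
  have hmem0 {e : Fin N → ℝ} {X Y : Matrix (Fin N) (Fin N) ℝ}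
      (hX : X ∈ Matrix.filtration D.φ e 0) (hY : Y ∈ Matrix.filtration D.φ e 0) :
      X * Y ∈ Matrix.filtration D.φ e 0 := by
    simpa using Matrix.filtration_mul_mem hX hY
  have hv : v = v' := by
    -- The left side minus `1` has strictly negative `ad H`-degrees, while the right side has only
    -- nonnegative ones. So both matrices are `1`, and the covering is injective on `V`. The
    -- argument for `n` is the mirror image.
    have h1 : ((v'⁻¹ * v : P.V) : G) =
        (m' * a') * ((n' * n⁻¹ : P.Nplus) : G) * (m * a : G)⁻¹ := by
      simp only [Subgroup.coe_mul, Subgroup.coe_inv]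
      have : (v : G) = v' * m' * a' * n' * (n : G)⁻¹ * (m * a : G)⁻¹ := by rw [← h]; group
      rw [this]; group
    have h2 := hV _ (v'⁻¹ * v).2
    have h3 := hN _ (n' * n⁻¹).2
    have h4 : S.mat ((n' * n⁻¹ : P.Nplus) : G) ∈ Matrix.filtration D.φ D.d 0 := by
      have := add_mem (Matrix.filtration_anti hc'.le h3) (Matrix.one_mem_filtration (d := D.d))
      simpa only [sub_add_cancel] using this
    have h5 : S.mat ((v'⁻¹ * v : P.V) : G) - 1 ∈ Matrix.filtration D.φ D.d 0 := by
      refine sub_mem ?_ Matrix.one_mem_filtration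
      rw [h1, S.mat_mul, S.mat_mul]
      exact hmem0 (hmem0 (D.mat_centralizer_mem (hz m' a')).1 h4)
        (D.mat_centralizer_mem (inv_mem (hz m a))).1
    have h6 := Matrix.eq_zero_of_mem_filtration_neg hc h2 (by rwa [neg_neg])
    have h7 := D.V.chain.eq_one_of_mat_eq_one (by rw [D.chainGroup_V]; exact (v'⁻¹ * v).2)
      (sub_eq_zero.1 h6)
    have h8 : v'⁻¹ * v = 1 := Subtype.ext h7
    exact (inv_mul_eq_one.1 h8).symm
  subst hv
  have h' : (m * a * n : G) = m' * a' * n' := by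
    simpa only [mul_assoc, mul_right_inj] using h
  have hn : n = n' := by
    have h1 : ((n' * n⁻¹ : P.Nplus) : G) = (m' * a' : G)⁻¹ * (m * a) := by
      simp only [Subgroup.coe_mul, Subgroup.coe_inv]
      rw [eq_inv_mul_iff_mul_eq, ← mul_assoc, mul_inv_eq_iff_eq_mul, h']
    have h2 := hN _ (n' * n⁻¹).2
    have h5 : S.mat ((n' * n⁻¹ : P.Nplus) : G) - 1 ∈ Matrix.filtration D.φ (-D.d) 0 := by
      refine sub_mem ?_ Matrix.one_mem_filtration
      rw [h1, S.mat_mul]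
      exact hmem0 (D.mat_centralizer_mem (inv_mem (hz m' a'))).2 (D.mat_centralizer_mem (hz m a)).2
    have h6 := Matrix.eq_zero_of_mem_filtration_neg hc' h2 h5
    have h7 := D.chain.eq_one_of_mat_eq_one (by rw [D.chainGroup_N]; exact (n' * n⁻¹).2)
      (sub_eq_zero.1 h6)
    have h8 : n' * n⁻¹ = 1 := Subtype.ext h7
    exact (mul_inv_eq_one.1 h8).symm
  subst hn
  have h'' : (m * a : G) = m' * a' := mul_right_cancel h'
  have hma : ((m'⁻¹ * m : P.M) : G) = ((a' * a⁻¹ : P.A) : G) := by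
    simp only [Subgroup.coe_mul, Subgroup.coe_inv]
    rw [inv_mul_eq_iff_eq_mul, ← mul_assoc, ← h'', mul_inv_cancel_right]
  -- An element `exp H` lying in `M` is orthogonal with `H` symmetric, so `exp (2H) = 1` and `H =
  -- 0`.
  obtain ⟨H, hH⟩ := exists_expA_eq (a' * a⁻¹)
  have hH0 : H = 0 := by
    have h1 : S.mat ((m'⁻¹ * m : P.M) : G) * (S.mat ((m'⁻¹ * m : P.M) : G))ᵀ = 1 :=
      (m'⁻¹ * m).2.2
    rw [hma, ← hH, mat_expA, ← Matrix.exp_transpose, P.symmetric H H.2,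
      ← Matrix.exp_add_of_commute _ _ (Commute.refl _)] at h1
    have h2 : (H : Matrix (Fin N) (Fin N) ℝ) + H = 0 :=
      Matrix.eq_zero_of_exp_eq_one (by rw [Matrix.transpose_add, P.symmetric H H.2]) h1
    have h3 : (2 : ℝ) • (H : Matrix (Fin N) (Fin N) ℝ) = 0 := by rw [two_smul, h2]
    exact Subtype.ext ((smul_eq_zero.1 h3).resolve_left two_ne_zero)
  rw [hH0, expA_zero] at hH
  have ha : a = a' := (mul_inv_eq_one.1 hH.symm).symm
  subst ha
  exact ⟨rfl, Subtype.ext (mul_right_cancel h''), rfl⟩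

/-- By uniqueness the components selected by choice are those of any exhibited factorization; every
later computation of `vPart`, `mPart`, `aPart` and `xi` goes through this. -/
lemma cell_parts {x : G} {v : P.V} {m : P.M} {a : P.A} {n : P.Nplus} (h : x = v * m * a * n) :
    P.InCell x ∧ P.vPart x = v ∧ P.mPart x = m ∧ P.aPart x = a := by
  have hx : P.InCell x := ⟨v, m, a, n, h⟩
  refine ⟨hx, ?_⟩
  rw [vPart, mPart, aPart, dif_pos hx, dif_pos hx, dif_pos hx]
  have h1 := hx.choose_spec.choose_spec.choose_spec.choose_spec
  exact cell_unique (h1.symm.trans h)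

end MinimalParabolic

/-! ### The long element, and how `A` scales the density and the Haar measure. -/

namespace MinimalParabolic

variable {G : Type*} [Group G] [TopologicalSpace G] {N : ℕ}
  {S : SemisimpleLieGroup G N} {P : MinimalParabolic S}

lemma two_mul_rho (B : P.RootBasis) (H : P.𝔞) : 2 * P.rho H =
    ∑ α ∈ B.finite_posRoots.toFinset, (Module.finrank ℝ (P.rootSpace α) : ℝ) * α H := by
  rw [rho, finsum_mem_eq_finite_toFinset_sum _ B.finite_posRoots]
  simp only [LinearMap.smul_apply, LinearMap.sum_apply, smul_eq_mul]
  ring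

namespace RepresentsLongElement

variable {w : G} (hw : P.RepresentsLongElement w)

/-- The action of the long element on `𝔞`. -/
def lin : P.𝔞 →ₗ[ℝ] P.𝔞 := (S.AdLin w).restrict fun H hH => hw.normalizes ⟨H, hH⟩

lemma coe_lin (H : P.𝔞) : (hw.lin H : Matrix (Fin N) (Fin N) ℝ) = S.Ad w H := rfl

lemma lin_injective : Function.Injective hw.lin := by
  intro H H' h
  have h1 : S.Ad w⁻¹ (S.Ad w H) = S.Ad w⁻¹ (S.Ad w H') := by
    rw [← hw.coe_lin, h, hw.coe_lin]
  rw [← S.Ad_mul, ← S.Ad_mul, inv_mul_cancel, S.Ad_one, S.Ad_one] at h1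
  exact Subtype.ext h1

lemma lin_surjective : Function.Surjective hw.lin :=
  LinearMap.injective_iff_surjective.1 hw.lin_injective

lemma _root_.SemisimpleLieGroup.Ad_bracket (S : SemisimpleLieGroup G N) (g : G)
    (X Y : Matrix (Fin N) (Fin N) ℝ) :
    S.Ad g (X * Y - Y * X) = S.Ad g X * S.Ad g Y - S.Ad g Y * S.Ad g X := by
  have h (X Y : Matrix (Fin N) (Fin N) ℝ) : S.Ad g X * S.Ad g Y = S.Ad g (X * Y) := by
    simp only [SemisimpleLieGroup.Ad]
    calc S.mat g * X * S.mat g⁻¹ * (S.mat g * Y * S.mat g⁻¹)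
        = S.mat g * X * (S.mat g⁻¹ * S.mat g) * Y * S.mat g⁻¹ := by simp only [mul_assoc]
      _ = _ := by rw [S.mat_inv_mul, mul_one]; simp only [mul_assoc]
  rw [h, h]
  exact map_sub (S.AdLin g) _ _

/-- `Ad w` and `Ad w⁻¹` carry the two root spaces injectively into each other. -/
lemma finrank_rootSpace_comp (β : Module.Dual ℝ P.𝔞) :
    Module.finrank ℝ (P.rootSpace (β ∘ₗ hw.lin)) = Module.finrank ℝ (P.rootSpace β) := by
  have hinj (g : G) : Function.Injective (S.AdLin g) := by
    intro X Y h
    have h1 : S.Ad g⁻¹ (S.Ad g X) = S.Ad g⁻¹ (S.Ad g Y) := congrArg (S.Ad g⁻¹) h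
    rwa [← S.Ad_mul, ← S.Ad_mul, inv_mul_cancel, S.Ad_one, S.Ad_one] at h1
  refine le_antisymm ?_ ?_
  · refine LinearMap.finrank_le_finrank_of_injective (f := (S.AdLin w).restrict ?_)
      (fun X Y h => Subtype.ext (hinj w (congrArg Subtype.val h)))
    intro X hX
    refine ⟨S.Ad_mem_lie w hX.1, fun H => ?_⟩
    obtain ⟨H, rfl⟩ := hw.lin_surjective H
    change (hw.lin H : Matrix (Fin N) (Fin N) ℝ) * S.Ad w X - S.Ad w X * hw.lin H =
      β (hw.lin H) • S.Ad w X
    rw [hw.coe_lin, ← S.Ad_bracket, hX.2, S.Ad_smul]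
    rfl
  · refine LinearMap.finrank_le_finrank_of_injective (f := (S.AdLin w⁻¹).restrict ?_)
      (fun X Y h => Subtype.ext (hinj w⁻¹ (congrArg Subtype.val h)))
    intro X hX
    refine ⟨S.Ad_mem_lie w⁻¹ hX.1, fun H => ?_⟩
    have h1 : (H : Matrix (Fin N) (Fin N) ℝ) = S.Ad w⁻¹ (hw.lin H) := by
      rw [hw.coe_lin, ← S.Ad_mul, inv_mul_cancel, S.Ad_one]
    change (H : Matrix (Fin N) (Fin N) ℝ) * S.Ad w⁻¹ X - S.Ad w⁻¹ X * H =
      β (hw.lin H) • S.Ad w⁻¹ X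
    rw [h1, ← S.Ad_bracket, hX.2, S.Ad_smul]

/-- The long element maps the positive roots bijectively to the negative ones and preserves
multiplicities, so it negates their weighted sum. -/
lemma rho_lin (H : P.𝔞) : P.rho (hw.lin H) = -P.rho H := by
  obtain ⟨B⟩ := P.nonempty_rootBasis
  choose! τ hτ hτ' using hw.neg
  have hτ'' : ∀ α ∈ P.posRoots, τ α ∘ₗ hw.lin = -α :=
    fun α hα => LinearMap.ext fun H => hτ' α hα H
  have hinj : Set.InjOn τ (B.finite_posRoots.toFinset : Set (Module.Dual ℝ P.𝔞)) := by
    intro α hα β hβ h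
    rw [Set.Finite.coe_toFinset] at hα hβ
    have h1 := hτ'' α hα
    rw [h, hτ'' β hβ, neg_inj] at h1
    exact h1.symm
  have hmaps : ∀ α ∈ B.finite_posRoots.toFinset, τ α ∈ B.finite_posRoots.toFinset := by
    intro α hα
    rw [Set.Finite.mem_toFinset] at hα ⊢
    exact hτ α hα
  have h2 : 2 * P.rho (hw.lin H) = -(2 * P.rho H) := by
    rw [two_mul_rho B, two_mul_rho B, ← Finset.sum_neg_distrib]
    symm
    refine Finset.sum_nbij τ hmaps hinj
      (Finset.surjOn_of_injOn_of_card_le τ hmaps hinj le_rfl) fun α hα => ?_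
    rw [Set.Finite.mem_toFinset] at hα
    have h3 : τ α (hw.lin H) = -α H := hτ' α hα H
    rw [h3, ← hw.finrank_rootSpace_comp (τ α), hτ'' α hα, finrank_rootSpace_neg]
    ring
  linarith

variable [IsTopologicalGroup G]

lemma exists_conj_expA {w : G} (hw : P.RepresentsLongElement w) (H : P.𝔞) :
    ∃ H' : P.𝔞, (w⁻¹ * P.expA H * w : G) = P.expA H' ∧ P.rho H' = -P.rho H := by
  obtain ⟨H', rfl⟩ := hw.lin_surjective H
  refine ⟨H', ?_, by rw [hw.rho_lin, neg_neg]⟩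
  rw [coe_expA, coe_expA, hw.coe_lin, ← S.conj_E w (P.mem_lie H' H'.2)]
  group

end RepresentsLongElement

variable [IsTopologicalGroup G]

lemma conj_mem_Nplus {g : G} (hg : g ∈ P.centralizer) {n : G} (hn : n ∈ P.Nplus) :
    g * n * g⁻¹ ∈ P.Nplus := by
  refine S.conj_mem_analyticSubgroup (fun X hX => ?_) hn
  have h : P.𝔫 ≤ P.𝔫.comap (S.AdLin g) :=
    iSup₂_le fun β hβ Y hY => Submodule.mem_comap.2
      (le_iSup₂ (f := fun β (_ : β ∈ P.posRoots) => P.rootSpace β) β hβ (P.Ad_mem_rootSpace hg hY))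
  exact h hX

lemma conj_mem_V {g : G} (hg : g ∈ P.centralizer) {v : G} (hv : v ∈ P.V) :
    g * v * g⁻¹ ∈ P.V :=
  S.conj_mem_analyticSubgroup (fun _ hX => P.Ad_mem_iSup hg _ hX) hv

lemma commute_expA_M (H : P.𝔞) (m : P.M) : (P.expA H : G) * m = m * P.expA H := by
  have h : S.Ad m H = H := by
    rw [SemisimpleLieGroup.Ad, M_le_centralizer m.2 H H.2, mul_assoc, S.mat_mul_inv, mul_one]
  have h1 := S.conj_E m (P.mem_lie H H.2)
  rw [h, ← coe_expA] at h1
  rw [eq_comm, ← mul_inv_eq_iff_eq_mul, h1]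

lemma commute_A_M (a : P.A) (m : P.M) : (a : G) * m = m * a := by
  obtain ⟨H, rfl⟩ := exists_expA_eq a
  exact commute_expA_M H m

lemma commute_A (a b : P.A) : a * b = b * a := by
  obtain ⟨H, rfl⟩ := exists_expA_eq a
  obtain ⟨H', rfl⟩ := exists_expA_eq b
  rw [← expA_add, ← expA_add, add_comm]

/-- `A` normalizes `V` and `N` and commutes with `M`, so the outer factors can be moved to the
middle, where they only affect the `A`-component. -/
lemma inCell_mul_mul {x : G} (hx : P.InCell x) (a b : P.A) :
    P.InCell (b * x * (a : G)⁻¹) ∧ P.aPart (b * x * (a : G)⁻¹) = b * P.aPart x * a⁻¹ := by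
  obtain ⟨v, m, c, n, rfl⟩ := hx
  have h : (b * (v * m * c * n) * (a : G)⁻¹ : G) =
      ((⟨_, conj_mem_V (P.A_le_centralizer b.2) v.2⟩ : P.V) : G) * m *
        ((b * c * a⁻¹ : P.A) : G) *
        ((⟨_, conj_mem_Nplus (P.A_le_centralizer a.2) n.2⟩ : P.Nplus) : G) := by
    simp only [Subgroup.coe_mul, Subgroup.coe_inv]
    have := commute_A_M b m
    calc (b * (v * m * c * n) * (a : G)⁻¹ : G)
        = b * v * (b : G)⁻¹ * (b * m) * c * n * (a : G)⁻¹ := by group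
      _ = _ := by rw [this]; group
  have h1 := cell_parts h
  exact ⟨h1.1, by rw [h1.2.2.2, (cell_parts (rfl : (v * m * c * n : G) = _)).2.2.2]⟩

lemma inCell_mul_mul_iff {x : G} (a b : P.A) : P.InCell (b * x * (a : G)⁻¹) ↔ P.InCell x := by
  refine ⟨fun h => ?_, fun h => (inCell_mul_mul h a b).1⟩
  have h1 := (inCell_mul_mul h a⁻¹ b⁻¹).1
  have h2 : ((b⁻¹ : P.A) : G) * (b * x * (a : G)⁻¹) * ((a⁻¹ : P.A) : G)⁻¹ = x := by
    simp only [Subgroup.coe_inv]; group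
  rwa [h2] at h1

lemma coe_smul_V (a : P.A) (v : P.V) : ((a • v : P.V) : G) = a * v * (a : G)⁻¹ := rfl

/-- Write `w⁻¹ a v a⁻¹ = (w⁻¹ a w)(w⁻¹ v) a⁻¹`. The right factor `a⁻¹` contributes `e^{ρ(log a)}`,
and the left factor contributes the same because `w` negates `ρ`. -/
lemma RepresentsLongElement.xi_smul {w : G} (hw : P.RepresentsLongElement w) (a : P.A) (v : P.V) :
    P.xi (w⁻¹ * (a • v : P.V)) = Real.exp (2 * P.rho (P.log a)) * P.xi (w⁻¹ * v) := by
  obtain ⟨H', h1, h2⟩ := hw.exists_conj_expA (P.log a)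
  rw [expA_log] at h1
  have h3 : w⁻¹ * ((a • v : P.V) : G) = P.expA H' * (w⁻¹ * v) * (a : G)⁻¹ := by
    rw [coe_smul_V, ← h1]; group
  rw [h3, xi, xi]
  by_cases hx : P.InCell (w⁻¹ * v)
  · rw [if_pos ((inCell_mul_mul_iff a _).2 hx), if_pos hx, (inCell_mul_mul hx a _).2,
      log_mul, log_mul, log_expA, log_inv, ← Real.exp_add, map_add, map_add, map_neg, h2]
    congr 1
    ring
  · rw [if_neg (mt (inCell_mul_mul_iff a _).1 hx), if_neg hx, mul_zero]

lemma _root_.Matrix.exp_conj_of_ad_eq {H X : Matrix (Fin N) (Fin N) ℝ} (hH : Hᵀ = H) {c : ℝ}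
    (h : H * X - X * H = c • X) :
    NormedSpace.exp H * X * NormedSpace.exp (-H) = Real.exp c • X := by
  obtain ⟨φ, d, hφ⟩ := Matrix.exists_algEquiv_eq_diagonal hH
  have hφ' : φ (-H) = Matrix.diagonal (-d) := by
    rw [map_neg, hφ]; exact Matrix.diagonal_neg d
  apply φ.injective
  rw [map_mul, map_mul, Matrix.algEquiv_exp, Matrix.algEquiv_exp, hφ, hφ', Matrix.exp_diagonal,
    Matrix.exp_diagonal, map_smul]
  ext i j
  rw [Matrix.mul_diagonal, Matrix.diagonal_mul, Matrix.smul_apply, Pi.coe_exp, Pi.coe_exp,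
    ← Real.exp_eq_exp_ℝ, smul_eq_mul, Pi.neg_apply]
  by_cases hij : d i - d j = c
  · rw [mul_right_comm, ← Real.exp_add, ← sub_eq_add_neg, hij]
  · rw [Matrix.apply_eq_zero_of_ad_eq hφ h hij]
    simp

lemma RootBasis.Ad_expA_vec (B : P.RootBasis) (H : P.𝔞) (i : B.ι) :
    S.Ad (P.expA H) (B.vec i) = Real.exp (B.root i H) • B.vec i := by
  have hH := P.mem_lie H H.2
  rw [SemisimpleLieGroup.Ad, coe_expA, ← S.E_neg hH, S.mat_E hH, S.mat_E (neg_mem hH)]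
  exact Matrix.exp_conj_of_ad_eq (P.symmetric H H.2) ((B.vec_mem i).2 H)

lemma continuous_smul_V (a : P.A) : Continuous fun v : P.V => a • v :=
  continuous_induced_rng.2 ((continuous_const.mul continuous_subtype_val).mul continuous_const)

lemma _root_.SemisimpleLieGroup.coe_oneParam (S : SemisimpleLieGroup G N) {Γ : Subgroup G}
    {X : Matrix (Fin N) (Fin N) ℝ} (h : ∀ s : ℝ, S.E (s • X) ∈ Γ) (t : ℝ) :
    (S.oneParam Γ X t : G) = S.E (t • X) := by
  rw [SemisimpleLieGroup.oneParam, dif_pos h]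

namespace ChainData

/-- The multiplicity of a root is the number of basis vectors with that root, so the sum over roots
becomes a sum over the chain. -/
lemma two_mul_rho_eq_sum (D : P.ChainData) (H : P.𝔞) :
    2 * P.rho H = (D.V.l.map fun i => -D.B.root i H).sum := by
  classical
  rw [two_mul_rho D.B, ← List.sum_toFinset _ D.V.nodup,
    ← Finset.sum_fiberwise_of_maps_to (g := fun i => -D.B.root i)
      (t := D.B.finite_posRoots.toFinset)]
  · refine Finset.sum_congr rfl fun α hα => ?_
    rw [Set.Finite.mem_toFinset] at hα
    rw [← finrank_rootSpace_neg, D.B.finrank_rootSpace, ← nsmul_eq_mul, ← Finset.sum_const]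
    refine Finset.sum_congr ?_ fun i hi => ?_
    · ext i
      simp only [Finset.mem_filter, Finset.mem_univ, true_and, List.mem_toFinset, D.V.mem_iff,
        neg_eq_iff_eq_neg]
      exact ⟨fun h => ⟨by rwa [h, neg_neg], h⟩, fun h => h.2⟩
    · rw [← (Finset.mem_filter.1 hi).2]; rfl
  · intro i hi
    rw [List.mem_toFinset, D.V.mem_iff] at hi
    simpa using hi

lemma smul_vec_mem (D : P.ChainData) {i : D.B.ι} (hi : i ∈ D.V.l) (s : ℝ) : S.E (s • D.B.vec i) ∈ P.V :=
  S.E_mem_analyticSubgroup (S.smul_mem_lie s (D.B.vec_mem_lie i)) (Submodule.smul_mem _ _ (by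
    rw [← D.V.span_eq]; exact Submodule.subset_span (List.mem_map_of_mem hi)))

/-- Conjugation by `a` scales each vector of the chain by the exponential of its (negative) root at
`log a`; the product of the inverse factors is `e^{2ρ(log a)}`. -/
lemma lintegral_smul [MeasurableSpace G] [BorelSpace G] (D : P.ChainData) (dx : Measure P.V) [dx.IsHaarMeasure] (a : P.A) {f : P.V → ℝ≥0∞}
    (hf : Measurable f) :
    ∫⁻ x, f (a • x) ∂dx = ENNReal.ofReal (Real.exp (2 * P.rho (P.log a))) * ∫⁻ x, f x ∂dx := by
  let c : P.V →* P.V :=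
    { toFun := fun v => a • v
      map_one' := Subtype.ext (by rw [coe_smul_V]; simp)
      map_mul' := fun x y => Subtype.ext (by
        simp only [Subgroup.coe_mul, coe_smul_V]; group) }
  let r : Matrix (Fin N) (Fin N) ℝ → ℝ :=
    Function.extend D.B.vec (fun i => Real.exp (D.B.root i (P.log a))) 1
  have hr (i) : r (D.B.vec i) = Real.exp (D.B.root i (P.log a)) :=
    D.B.linearIndependent_vec.injective.extend_apply _ _ _
  have hrL : ∀ X ∈ D.V.l.map D.B.vec,
      r X ≠ 0 ∧ ∀ t, c (S.oneParam P.V X t) = S.oneParam P.V X (r X * t) := by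
    intro X hX
    obtain ⟨i, hi, rfl⟩ := List.mem_map.1 hX
    rw [hr]
    refine ⟨(Real.exp_pos _).ne', fun t => Subtype.ext ?_⟩
    change ((a • S.oneParam P.V (D.B.vec i) t : P.V) : G) = _
    rw [coe_smul_V, S.coe_oneParam (D.smul_vec_mem hi), S.coe_oneParam (D.smul_vec_mem hi),
      S.conj_E _ (S.smul_mem_lie t (D.B.vec_mem_lie i)), S.Ad_smul]
    conv_lhs => rw [← expA_log a]
    rw [RootBasis.Ad_expA_vec, smul_smul, mul_comm]
  have := D.V.chain.lintegral_haar_scale D.chainGroup_V dx (c := c)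
    (continuous_smul_V a).measurable hrL hf
  change ∫⁻ x, f (a • x) ∂dx = _ at this
  rw [this, D.two_mul_rho_eq_sum]
  congr 1
  rw [List.map_map]
  generalize D.V.l = l
  induction l with
  | nil => simp
  | cons i l ih =>
    rw [List.map_cons, List.prod_cons, ih, List.map_cons, List.sum_cons, Real.exp_add,
      ENNReal.ofReal_mul (Real.exp_pos _).le, Function.comp_apply, hr, ← Real.exp_neg,
      abs_of_pos (Real.exp_pos _)]

end ChainData

end MinimalParabolic

/-! ### Measurability of the density and of `V'`; invariance of the measure. -/

namespace MinimalParabolic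

variable {G : Type*} [Group G] [TopologicalSpace G] [IsTopologicalGroup G] {N : ℕ}
  {S : SemisimpleLieGroup G N} {P : MinimalParabolic S}

variable (P)

lemma isSigmaCompact_V : IsSigmaCompact (P.V : Set G) := by
  obtain ⟨D⟩ := P.nonempty_chainData
  rw [← D.chainGroup_V]
  exact D.V.chain.isSigmaCompact

lemma isSigmaCompact_Nplus : IsSigmaCompact (P.Nplus : Set G) := by
  obtain ⟨D⟩ := P.nonempty_chainData
  rw [← D.chainGroup_N]
  exact D.chain.isSigmaCompact

lemma isSigmaCompact_expA {C : Set P.𝔞} (hC : IsClosed C) :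
    IsSigmaCompact ((fun H => (P.expA H : G)) '' C) :=
  (by
    have : SigmaCompactSpace (Matrix (Fin N) (Fin N) ℝ) :=
      inferInstanceAs (SigmaCompactSpace (Fin N → Fin N → ℝ))
    have : SigmaCompactSpace P.𝔞 :=
      (P.𝔞.closed_of_finiteDimensional.isClosedEmbedding_subtypeVal).sigmaCompactSpace
    exact isSigmaCompact_univ.of_isClosed_subset hC (Set.subset_univ C) : IsSigmaCompact C).image continuous_coe_expA

lemma isClosed_M : IsClosed (P.M : Set G) := by
  have h1 : (P.M : Set G) = (⋂ H ∈ P.𝔞, {g | S.mat g * H = H * S.mat g}) ∩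
      {g | S.mat g * (S.mat g)ᵀ = 1} := by
    ext g
    simp only [Set.mem_inter_iff, Set.mem_iInter]
    rfl
  rw [h1]
  have hc := S.continuous_mat
  refine IsClosed.inter (isClosed_biInter fun H _ => ?_) ?_
  · exact isClosed_eq (hc.mul continuous_const) (continuous_const.mul hc)
  · exact isClosed_eq (hc.mul hc.matrix_transpose) continuous_const

lemma sigmaCompactSpace_V : SigmaCompactSpace P.V :=
  isSigmaCompact_iff_sigmaCompactSpace.1 P.isSigmaCompact_V

lemma secondCountableTopology_V : SecondCountableTopology P.V :=
  S.secondCountableTopology P.isSigmaCompact_V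

lemma xi_nonneg (x : G) : 0 ≤ P.xi x := by
  unfold xi
  split_ifs
  · exact (Real.exp_pos _).le
  · exact le_rfl

lemma inCell_of_xi_ne_zero {x : G} (h : P.xi x ≠ 0) : P.InCell x := by
  by_contra h1
  exact h (by rw [xi, if_neg h1])

/-- The function `x ↦ ξ_{-ρ} (w⁻¹ x)` is measurable on `V`. -/
lemma measurable_xi [MeasurableSpace G] [BorelSpace G] (w : G) : Measurable fun x : P.V => P.xi (w⁻¹ * x) := by
  have := S.t2Space
  refine measurable_of_Ici fun c => ?_
  rcases le_or_gt c 0 with hc | hc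
  · convert MeasurableSet.univ
    exact Set.eq_univ_of_forall fun x => hc.trans (P.xi_nonneg _)
  have hV := P.isSigmaCompact_V
  have hN := P.isSigmaCompact_Nplus
  have hA := P.isSigmaCompact_expA isClosed_univ
  -- `M` need not be σ-compact, as `G` may have uncountably many components. Only the `M`-components
  -- of points of `w⁻¹ V` matter; they lie in `Q`, which is σ-compact because `M` is closed. Hence
  -- the superlevel set is the preimage of the σ-compact set `R`.
  let Q : Set G := (fun p : G × G × G × G => p.1⁻¹ * w⁻¹ * p.2.1 * p.2.2.1⁻¹ * p.2.2.2⁻¹) ''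
    ((P.V : Set G) ×ˢ (P.V : Set G) ×ˢ (P.Nplus : Set G) ×ˢ
      ((fun H => (P.expA H : G)) '' Set.univ)) ∩ P.M
  have hQ : IsSigmaCompact Q :=
    ((hV.prod (hV.prod (hN.prod hA))).image (by fun_prop)).inter_isClosed P.isClosed_M
  have hC : IsClosed {H : P.𝔞 | c ≤ Real.exp (-P.rho H)} :=
    isClosed_le continuous_const
      (Real.continuous_exp.comp (P.rho.continuous_of_finiteDimensional).neg)
  let R : Set G := (fun p : G × G × G × G => p.1 * p.2.1 * p.2.2.1 * p.2.2.2) ''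
    ((P.V : Set G) ×ˢ Q ×ˢ ((fun H => (P.expA H : G)) '' {H : P.𝔞 | c ≤ Real.exp (-P.rho H)}) ×ˢ
      (P.Nplus : Set G))
  have hR : IsSigmaCompact R :=
    (hV.prod (hQ.prod ((P.isSigmaCompact_expA hC).prod hN))).image (by fun_prop)
  have h1 : (fun x : P.V => P.xi (w⁻¹ * x)) ⁻¹' Set.Ici c = (fun x : P.V => w⁻¹ * (x : G)) ⁻¹' R := by
    ext x
    rw [Set.mem_preimage, Set.mem_preimage, Set.mem_Ici]
    constructor
    · intro h
      obtain ⟨v, m, a, n, hx⟩ := P.inCell_of_xi_ne_zero (hc.trans_le h).ne'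
      have h2 := cell_parts hx
      rw [xi, if_pos h2.1, h2.2.2.2] at h
      refine ⟨(v, m, a, n), ⟨v.2, ⟨⟨(v, x, n, a), ⟨v.2, x.2, n.2, P.log a, trivial, ?_⟩, ?_⟩, m.2⟩,
        ⟨P.log a, h, ?_⟩, n.2⟩, hx.symm⟩
      · simp only [expA_log]
      · simp only
        rw [mul_assoc _ w⁻¹, hx]; group
      · simp only [expA_log]
    · rintro ⟨⟨v, m, b, n⟩, ⟨hv, hm, ⟨H, hH, rfl⟩, hn⟩, hx⟩
      have h2 := cell_parts (v := ⟨v, hv⟩) (m := ⟨m, hm.2⟩) (a := P.expA H) (n := ⟨n, hn⟩) hx.symm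
      rw [xi, if_pos h2.1, h2.2.2.2, log_expA]
      exact hH
  rw [h1]
  exact (continuous_const.mul continuous_subtype_val).measurable hR.measurableSet

/-- A single truncated logarithm inverts the exponential on all of `𝔳`, because the nilpotency
exponent is uniform there. -/
lemma exists_logV : ∃ ℒ : P.V → Matrix (Fin N) (Fin N) ℝ, Continuous ℒ ∧
    (∀ X ∈ P.𝔳, ∀ v : P.V, (v : G) = S.E X → ℒ v = X) := by
  obtain ⟨D⟩ := P.nonempty_chainData
  obtain ⟨c, hc, hle⟩ := D.V.chain.exists_le_filtration
  obtain ⟨m, hm⟩ := Matrix.exists_pow_eq_zero (φ := D.φ) (-D.d) hc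
  rw [D.V.span_eq] at hle
  refine ⟨fun v => Matrix.nilLog m (S.mat v), (Matrix.continuous_nilLog m).comp
    (S.continuous_mat.comp continuous_subtype_val), fun X hX v hv => ?_⟩
  have hXl : X ∈ S.lie := D.V.chain.mem_lie (by rwa [D.V.span_eq])
  simp only
  rw [hv, S.mat_E hXl]
  exact Matrix.nilLog_exp fun t =>
    hm _ (Matrix.exp_sub_one_mem_filtration hc (Submodule.smul_mem _ t (hle hX)))

lemma 𝔳_le_lie : P.𝔳 ≤ S.lie.toSubmodule := iSup₂_le fun _ _ _ hX => hX.1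

lemma mem_V'_iff {v : P.V} : v ∈ P.V' ↔ ∃ X ∈ P.𝔳', (v : G) = S.E X := by
  refine exists_congr fun X => and_congr_right fun hX => ?_
  exact S.isExp_iff (P.𝔳_le_lie hX.1)

lemma eq_of_mat_eq_V {v v' : P.V} (h : S.mat v = S.mat v') : v = v' := by
  obtain ⟨D⟩ := P.nonempty_chainData
  have h1 : S.mat ((v'⁻¹ * v : P.V) : G) = 1 := by
    rw [Subgroup.coe_mul, Subgroup.coe_inv, S.mat_mul, h, S.mat_inv_mul]
  have h2 := D.V.chain.eq_one_of_mat_eq_one (by rw [D.chainGroup_V]; exact (v'⁻¹ * v).2) h1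
  have h3 : v'⁻¹ * v = 1 := Subtype.ext h2
  exact (inv_mul_eq_one.1 h3).symm

lemma isClosed_submodule (U : Submodule ℝ (Matrix (Fin N) (Fin N) ℝ)) :
    IsClosed (U : Set (Matrix (Fin N) (Fin N) ℝ)) := U.closed_of_finiteDimensional

lemma finite_simpleRoots : P.simpleRoots.Finite := by
  obtain ⟨B⟩ := P.nonempty_rootBasis
  exact B.finite_posRoots.subset fun _ h => h.1

/-- Through the continuous logarithm, membership becomes finitely many closed conditions and
complements of closed conditions. The equation `mat v = exp (ℒ v)` certifies that `v` is an
exponential, so surjectivity of `exp` onto `V` is not needed. -/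
lemma measurableSet_V' [MeasurableSpace G] [BorelSpace G] : MeasurableSet P.V' := by
  obtain ⟨ℒ, hc, hℒ⟩ := P.exists_logV
  have h : P.V' = {v : P.V | S.mat v = NormedSpace.exp (ℒ v)} ∩ (ℒ ⁻¹' (P.𝔳 : Set (Matrix (Fin N) (Fin N) ℝ)) ∩
      ⋂ α ∈ P.simpleRoots, (ℒ ⁻¹' (P.complementOf α : Set (Matrix (Fin N) (Fin N) ℝ)))ᶜ) := by
    ext v
    rw [mem_V'_iff]
    constructor
    · rintro ⟨X, hX, hv⟩
      have h1 := hℒ X hX.1 v hv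
      refine ⟨?_, ?_, ?_⟩
      · change S.mat v = _
        rw [h1, hv, S.mat_E (P.𝔳_le_lie hX.1)]
      · rw [Set.mem_preimage, h1]; exact hX.1
      · simp only [Set.mem_iInter, Set.mem_compl_iff, Set.mem_preimage, h1]
        exact hX.2
    · rintro ⟨h1, h2, h3⟩
      simp only [Set.mem_iInter, Set.mem_compl_iff, Set.mem_preimage] at h3
      refine ⟨ℒ v, ⟨h2, h3⟩, ?_⟩
      have h4 : S.E (ℒ v) ∈ P.V := S.E_mem_analyticSubgroup (P.𝔳_le_lie h2) h2
      have h5 : v = ⟨_, h4⟩ := P.eq_of_mat_eq_V (by rw [S.mat_E (P.𝔳_le_lie h2)]; exact h1)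
      exact congrArg Subtype.val h5
  rw [h]
  refine (isClosed_eq (S.continuous_mat.comp continuous_subtype_val)
    ((Matrix.continuous_exp N).comp hc)).measurableSet.inter
    (((isClosed_submodule _).preimage hc).measurableSet.inter
    (MeasurableSet.biInter P.finite_simpleRoots.countable fun α _ =>
      ((isClosed_submodule _).preimage hc).measurableSet.compl))

variable {P}

lemma smul_mem_V'_iff (a : P.A) {v : P.V} : a • v ∈ P.V' ↔ v ∈ P.V' := by
  refine ⟨fun h => ?_, P.smul_mem_V' a⟩
  have := P.smul_mem_V' a⁻¹ h
  rwa [inv_smul_smul] at this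

section InvMeasure

variable [MeasurableSpace G] [BorelSpace G]

variable (w : G) (dx : Measure P.V) [dx.IsHaarMeasure]

lemma sFinite_haar : SFinite dx := by
  have := P.sigmaCompactSpace_V
  infer_instance

lemma sFinite_invMeasure : SFinite (P.invMeasure w dx) := by
  have := sFinite_haar dx
  unfold invMeasure
  infer_instance

lemma measurable_ofReal_xi : Measurable fun x : P.V => ENNReal.ofReal (P.xi (w⁻¹ * x)) :=
  (P.measurable_xi w).ennreal_ofReal

lemma lintegral_invMeasure {φ : P.V → ℝ≥0∞} (hφ : Measurable φ) :
    ∫⁻ x, φ x ∂P.invMeasure w dx =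
      ∫⁻ x, P.V'.indicator (fun x => ENNReal.ofReal (P.xi (w⁻¹ * x)) * φ x) x ∂dx := by
  rw [invMeasure, lintegral_withDensity_eq_lintegral_mul _ (measurable_ofReal_xi w) hφ,
    lintegral_indicator P.measurableSet_V']
  rfl

variable {w}

/-- The measure `ξ_{-ρ} (w⁻¹ x) dx` is invariant under `A`. -/
lemma RepresentsLongElement.lintegral_smul_invMeasure (hw : P.RepresentsLongElement w) (a : P.A)
    {φ : P.V → ℝ≥0∞} (hφ : Measurable φ) :
    ∫⁻ x, φ (a • x) ∂P.invMeasure w dx = ∫⁻ x, φ x ∂P.invMeasure w dx := by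
  obtain ⟨D⟩ := P.nonempty_chainData
  rw [lintegral_invMeasure w dx (φ := fun x => φ (a • x))
      (hφ.comp (continuous_smul_V a).measurable),
    lintegral_invMeasure w dx hφ]
  set ψ := P.V'.indicator (fun x => ENNReal.ofReal (P.xi (w⁻¹ * x)) * φ x) with hψ
  have hψm : Measurable ψ := ((measurable_ofReal_xi w).mul hφ).indicator P.measurableSet_V'
  -- Replacing `ξ(w⁻¹x)` by `ξ(w⁻¹(a • x))` costs `e^{-2ρ(log a)}`, exactly what the Haar measure
  -- then restores.
  have h1 : P.V'.indicator (fun x => ENNReal.ofReal (P.xi (w⁻¹ * x)) * φ (a • x)) =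
      fun x => ENNReal.ofReal (Real.exp (-(2 * P.rho (P.log a)))) * ψ (a • x) := by
    funext x
    rw [hψ]
    by_cases hx : x ∈ P.V'
    · rw [Set.indicator_of_mem hx, Set.indicator_of_mem ((smul_mem_V'_iff a).2 hx), hw.xi_smul,
        ENNReal.ofReal_mul (Real.exp_pos _).le, ← mul_assoc, ← mul_assoc,
        ← ENNReal.ofReal_mul (Real.exp_pos _).le, ← Real.exp_add, neg_add_cancel, Real.exp_zero,
        ENNReal.ofReal_one, one_mul]
    · rw [Set.indicator_of_notMem hx, Set.indicator_of_notMem (mt (smul_mem_V'_iff a).1 hx),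
        mul_zero]
  rw [show (∫⁻ x, P.V'.indicator (fun x => ENNReal.ofReal (P.xi (w⁻¹ * x)) * φ (a • x)) x ∂dx)
    = ∫⁻ x, ENNReal.ofReal (Real.exp (-(2 * P.rho (P.log a)))) * ψ (a • x) ∂dx from
    congrArg _ h1, lintegral_const_mul (f := fun x => ψ (a • x)) _
      (hψm.comp (continuous_smul_V a).measurable),
    D.lintegral_smul dx a hψm, ← mul_assoc, ← ENNReal.ofReal_mul (Real.exp_pos _).le,
    ← Real.exp_add, neg_add_cancel, Real.exp_zero, ENNReal.ofReal_one, one_mul]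

/-- Points where `xi` takes its default value `0` are null, so there is no loss in inverting
`ξ_{-ρ}^{1/2}`. -/
lemma ae_invMeasure (w : G) : ∀ᵐ x ∂P.invMeasure w dx, x ∈ P.V' ∧ 0 < P.xi (w⁻¹ * x) := by
  rw [invMeasure, ae_withDensity_iff (measurable_ofReal_xi w)]
  filter_upwards [ae_restrict_mem P.measurableSet_V'] with x hx h
  refine ⟨hx, ?_⟩
  by_contra h1
  exact h (ENNReal.ofReal_eq_zero.2 (not_lt.1 h1))

end InvMeasure

end MinimalParabolic

/-! ### Homogeneous functions on `𝔳'`, the equivariant map to `𝔞`, and the section. -/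

namespace MinimalParabolic

variable {G : Type*} [Group G] [TopologicalSpace G] [IsTopologicalGroup G] {N : ℕ}
  {S : SemisimpleLieGroup G N} {P : MinimalParabolic S}

variable (P) in
/-- The simple roots contain coordinates of `𝔞`. -/
lemma exists_simple_coordinates : ∃ (ι : Type) (_ : Fintype ι) (α : ι → Module.Dual ℝ P.𝔞)
    (T : (ι → ℝ) →ₗ[ℝ] P.𝔞), (∀ j, α j ∈ P.simpleRoots) ∧ (∀ c j, α j (T c) = c j) ∧
      ∀ H, (∀ j, α j H = 0) → H = 0 := by
  obtain ⟨B⟩ := P.nonempty_rootBasis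
  let b := Module.Basis.ofSpan B.span_simpleRoots.ge
  have : Finite _ := Module.Finite.finite_basis b
  let _ := Fintype.ofFinite ((linearIndepOn_empty ℝ id).extend (Set.empty_subset P.simpleRoots))
  let n := Fintype.card ((linearIndepOn_empty ℝ id).extend (Set.empty_subset P.simpleRoots))
  let b' : Module.Basis (Fin n) ℝ (Module.Dual ℝ P.𝔞) := b.reindex (Fintype.equivFin _)
  have hb (j) : b' j ∈ P.simpleRoots := by
    rw [Module.Basis.reindex_apply]
    exact Module.Basis.ofSpan_subset B.span_simpleRoots.ge ⟨_, rfl⟩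
  let T : (Fin n → ℝ) →ₗ[ℝ] P.𝔞 := (Module.evalEquiv ℝ P.𝔞).symm.toLinearMap ∘ₗ
    (Fintype.linearCombination ℝ b'.dualBasis)
  refine ⟨Fin n, inferInstance, b', T, hb, fun c j => ?_, fun H hH => ?_⟩
  · simp only [T, LinearMap.comp_apply, LinearEquiv.coe_coe, Module.apply_evalEquiv_symm_apply,
      Fintype.linearCombination_apply, LinearMap.sum_apply, LinearMap.smul_apply]
    simp [Finsupp.single_apply]
  · refine (Module.forall_dual_apply_eq_zero_iff ℝ H).1 fun f => ?_
    rw [← b'.sum_repr f, LinearMap.sum_apply]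
    exact Finset.sum_eq_zero fun j _ => by rw [LinearMap.smul_apply, hH, smul_zero]

namespace RootBasis

variable (B : P.RootBasis)

lemma exists_coord : ∃ f : B.ι → Matrix (Fin N) (Fin N) ℝ →ₗ[ℝ] ℝ,
    ∀ i (X : S.lie.toSubmodule), f i X = B.b.repr X i := by
  have h (i : B.ι) := LinearMap.exists_extend (B.b.coord i)
  choose f hf using h
  exact ⟨f, fun i X => by rw [← Module.Basis.coord_apply, ← hf]; rfl⟩

lemma repr_Ad_expA (H : P.𝔞) (X : S.lie.toSubmodule) (i : B.ι) :
    B.b.repr ⟨S.Ad (P.expA H) X, S.Ad_mem_lie _ X.2⟩ i = Real.exp (B.root i H) * B.b.repr X i := by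
  let A : S.lie.toSubmodule →ₗ[ℝ] S.lie.toSubmodule :=
    (S.AdLin (P.expA H)).restrict fun X hX => S.Ad_mem_lie _ hX
  have : B.b.coord i ∘ₗ A = Real.exp (B.root i H) • B.b.coord i := by
    refine B.b.ext fun j => ?_
    have hj : A (B.b j) = Real.exp (B.root j H) • B.b j := Subtype.ext (B.Ad_expA_vec H j)
    simp only [LinearMap.comp_apply, hj, map_smul, LinearMap.smul_apply, Module.Basis.coord_apply,
      Module.Basis.repr_self, smul_eq_mul]
    by_cases h : j = i
    · rw [h]
    · rw [Finsupp.single_eq_of_ne' h, mul_zero, mul_zero]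
  exact LinearMap.congr_fun this X

/-- A function on `𝔳'` which is homogeneous under `A`, with weight a given simple root. -/
lemma exists_homogeneous (B : P.RootBasis) {α : Module.Dual ℝ P.𝔞} (hα : α ∈ P.simpleRoots) :
    ∃ r : Matrix (Fin N) (Fin N) ℝ → ℝ, Continuous r ∧ (∀ X ∈ P.𝔳', 0 < r X) ∧
      ∀ X ∈ P.𝔳', ∀ H, r (S.Ad (P.expA H) X) = Real.exp (-α H) * r X := by
  classical
  obtain ⟨f, hf⟩ := B.exists_coord
  let c (i : B.ι) : ℝ := if h : ∃ c : ℝ, 0 < c ∧ -B.root i = c • α then h.choose else 1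
  have hc0 (i) : 0 < c i := by
    simp only [c]
    split_ifs with h
    · exact h.choose_spec.1
    · exact one_pos
  let I := Finset.univ.filter fun i => ∃ c : ℝ, 0 < c ∧ -B.root i = c • α
  have hcI (i) (hi : i ∈ I) : -B.root i = c i • α := by
    have h := (Finset.mem_filter.1 hi).2
    simp only [c]
    rw [dif_pos h]
    exact h.choose_spec.2
  -- The coordinate along a root `-c α` scales by `e^{-c α(H)}`; the power `1/c` of its absolute
  -- value gives every term the common weight `-α`.
  refine ⟨fun X => ∑ i ∈ I, |f i X| ^ (c i)⁻¹, ?_, fun X hX => ?_, fun X hX H => ?_⟩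
  · refine continuous_finsetSum _ fun i _ => Continuous.rpow_const ?_ fun _ =>
      Or.inr (inv_pos.2 (hc0 i)).le
    exact (f i).continuous_of_finiteDimensional.abs
  · by_contra h0
    -- If all coordinates along negative multiples of `α` vanish, `X` has components only along
    -- roots not proportional to `α`, which the definition of `𝔳'` forbids.
    have h1 : ∀ i ∈ I, f i X = 0 := by
      intro i hi
      by_contra h2
      exact h0 (lt_of_lt_of_le (Real.rpow_pos_of_pos (abs_pos.2 h2) _)
        (Finset.single_le_sum (f := fun i => |f i X| ^ (c i)⁻¹)
          (fun j _ => Real.rpow_nonneg (abs_nonneg _) _) hi))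
    obtain ⟨H₀, hH₀⟩ := B.exists_chamber
    have hXl := P.𝔳_le_lie hX.1
    refine hX.2 α hα ?_
    rw [complementOf, B.iSup_rootSpace_neg]
    refine B.mem_span_of_repr (s := {β | -β ∈ {β | β ∈ P.posRoots ∧ ∀ t : ℝ, β ≠ t • α}})
      (X := ⟨X, hXl⟩) fun i h2 => ?_
    by_contra hi
    change ¬(-B.root i ∈ P.posRoots ∧ ∀ t : ℝ, -B.root i ≠ t • α) at h2
    have h3 : -B.root i ∈ P.posRoots := by
      by_contra h4
      have h5 : P.𝔳 ≤ LinearMap.ker (f i) := iSup₂_le fun β hβ Y hY => by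
        rw [LinearMap.mem_ker]
        refine (hf i ⟨Y, hY.1⟩).trans (B.repr_eq_zero hY fun h6 => h4 ?_)
        rwa [h6, neg_neg]
      exact hi ((hf i ⟨X, hXl⟩).symm.trans (h5 hX.1))
    have h4 : ∃ t : ℝ, -B.root i = t • α := by
      by_contra! h5
      exact h2 ⟨h3, h5⟩
    obtain ⟨t, ht⟩ := h4
    have h5 := hH₀ _ h3
    rw [ht, LinearMap.smul_apply, smul_eq_mul] at h5
    have ht0 : 0 < t := (pos_iff_pos_of_mul_pos h5).2 (hH₀ _ hα.1)
    exact hi ((hf i ⟨X, hXl⟩).symm.trans (h1 i (Finset.mem_filter.2 ⟨Finset.mem_univ _, t, ht0, ht⟩)))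
  · have hXl := P.𝔳_le_lie hX.1
    simp only
    rw [Finset.mul_sum]
    refine Finset.sum_congr rfl fun i hi => ?_
    have h1 : f i (S.Ad (P.expA H) X) = Real.exp (B.root i H) * f i X := by
      have := B.repr_Ad_expA H ⟨X, hXl⟩ i
      rwa [← hf, ← hf] at this
    have h2 : B.root i H = -(c i * α H) := by
      rw [← smul_eq_mul, ← LinearMap.smul_apply, ← hcI i hi, LinearMap.neg_apply, neg_neg]
    rw [h1, abs_mul, Real.mul_rpow (abs_nonneg _) (abs_nonneg _), abs_of_pos (Real.exp_pos _),
      ← Real.exp_mul, h2]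
    congr 2
    field_simp [(hc0 i).ne']

end RootBasis

lemma coe_smul_V' (a : P.A) (x : P.V') : ((a • x : P.V') : P.V) = a • (x : P.V) := rfl

variable (P) in
/-- `V'` has an `A`-equivariant continuous map to `𝔞`. -/
lemma exists_equivariant : ∃ T : P.V' → P.𝔞, Continuous T ∧ ∀ a x, T (a • x) = T x + P.log a := by
  obtain ⟨B⟩ := P.nonempty_rootBasis
  obtain ⟨ι, _, α, T₀, hα, hT, hinj⟩ := P.exists_simple_coordinates
  choose r hrc hr0 hr using fun j => B.exists_homogeneous (hα j)
  obtain ⟨ℒ, hc, hℒ⟩ := P.exists_logV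
  have hmem (x : P.V') : ℒ x ∈ P.𝔳' := by
    obtain ⟨X, hX, hx⟩ := P.mem_V'_iff.1 x.2
    rwa [hℒ X hX.1 x hx]
  have hsmul (a : P.A) (x : P.V') : ℒ (a • x : P.V') = S.Ad a (ℒ x) := by
    obtain ⟨X, hX, hx⟩ := P.mem_V'_iff.1 x.2
    rw [hℒ X hX.1 x hx]
    refine hℒ _ (P.Ad_mem_𝔳' (P.A_le_centralizer a.2) hX).1 _ ?_
    rw [coe_smul_V', coe_smul_V, hx, S.conj_E _ (P.𝔳_le_lie hX.1)]
  -- Under `a` the quantity `-log (r j)` increases by `α j (log a)`. These are coordinates of `log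
  -- a`, and `T₀` reassembles them.
  refine ⟨fun x => T₀ fun j => -Real.log (r j (ℒ x)), ?_, fun a x => ?_⟩
  · refine T₀.continuous_of_finiteDimensional.comp (continuous_pi fun j => Continuous.neg ?_)
    exact Continuous.log ((hrc j).comp (hc.comp continuous_subtype_val))
      fun x => (hr0 j _ (hmem x)).ne'
  · rw [← sub_eq_zero]
    refine hinj _ fun j => ?_
    rw [map_sub, map_add, hT, hT, hsmul]
    conv_lhs => rw [← expA_log a]
    rw [hr j _ (hmem x), Real.log_mul (Real.exp_pos _).ne' (hr0 j _ (hmem x)).ne', Real.log_exp,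
      expA_log]
    ring

lemma continuous_smul_V_of {A : Type*} [TopologicalSpace A] {u : A → P.A} {v : A → P.V}
    (hu : Continuous u) (hv : Continuous v) : Continuous fun x => u x • v x :=
  continuous_induced_rng.2 (((continuous_subtype_val.comp hu).mul
    (continuous_subtype_val.comp hv)).mul (continuous_subtype_val.comp hu).inv)

lemma continuous_smul_V'_of {A : Type*} [TopologicalSpace A] {u : A → P.A} {v : A → P.V'}
    (hu : Continuous u) (hv : Continuous v) : Continuous fun x => u x • v x :=
  continuous_induced_rng.2 (continuous_smul_V_of hu (continuous_subtype_val.comp hv))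

variable (P) in
-- Each orbit has a unique point with `T = 0`, namely `expA (-T x) • x` for any `x` on it. This
-- formula is continuous and constant on orbits, so it descends to the quotient.
lemma exists_isSection : ∃ s : P.OrbitSpace → P.V', P.IsSection s := by
  obtain ⟨T, hc, hT⟩ := P.exists_equivariant
  have h (x y : P.V') (hxy : MulAction.orbitRel P.A P.V' x y) :
      P.expA (-T x) • x = P.expA (-T y) • y := by
    obtain ⟨a, rfl⟩ := hxy
    simp only
    rw [hT, smul_smul, neg_add, expA_add, expA_neg (P.log a), expA_log, inv_mul_cancel_right]
  refine ⟨Quotient.lift (fun x => P.expA (-T x) • x) h, ?_, fun ω => ?_⟩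
  · exact Continuous.quotient_lift
      (continuous_smul_V'_of (continuous_expA.comp hc.neg) continuous_id) h
  · induction ω using Quotient.inductionOn with
    | h x => exact Quotient.sound ⟨P.expA (-T x), rfl⟩

end MinimalParabolic

/-! ### Disintegration of the invariant measure along the `A`-orbits. -/

lemma MeasurableEmbedding.sFinite_comap {α β : Type*} [MeasurableSpace α] [MeasurableSpace β]
    {f : α → β} (hf : MeasurableEmbedding f) (μ : Measure β) [SFinite μ] : SFinite (μ.comap f) := by
  refine ⟨fun n => (sfiniteSeq μ n).comap f, fun n => ⟨?_⟩, ?_⟩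
  · rw [hf.comap_apply]; exact measure_lt_top _ _
  · ext s hs
    rw [hf.comap_apply, Measure.sum_apply _ hs]
    simp_rw [hf.comap_apply]
    rw [← Measure.sum_apply _ (hf.measurableSet_image.2 hs), sum_sfiniteSeq]

lemma exists_lintegral_eq_one (E : Type*) [NormedAddCommGroup E] [NormedSpace ℝ E]
    [FiniteDimensional ℝ E] [MeasurableSpace E] [BorelSpace E] (μ : Measure E)
    [μ.IsAddHaarMeasure] : ∃ h : E → ℝ≥0∞, Measurable h ∧ ∫⁻ t, h t ∂μ = 1 := by
  refine ⟨(Metric.closedBall 0 1).indicator fun _ => (μ (Metric.closedBall 0 1))⁻¹,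
    measurable_const.indicator Metric.isClosed_closedBall.measurableSet, ?_⟩
  rw [lintegral_indicator_const Metric.isClosed_closedBall.measurableSet]
  exact ENNReal.inv_mul_cancel (Metric.measure_closedBall_pos μ 0 one_pos).ne'
    (isCompact_closedBall 0 1).measure_lt_top.ne

/-- Disintegration of an invariant measure along the orbits of an action with an equivariant
map to the group. -/
lemma lintegral_eq_lintegral_time {E X : Type*} [NormedAddCommGroup E] [NormedSpace ℝ E]
    [FiniteDimensional ℝ E] [MeasurableSpace E] [BorelSpace E] {m : Measure E} [m.IsAddHaarMeasure]
    [MeasurableSpace X] {ν : Measure X} [SFinite ν]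
    {act : E → X → X} (hact : Measurable fun p : E × X => act p.1 p.2) {τ : X → E}
    (hτm : Measurable τ) (hτ : ∀ t x, τ (act t x) = τ x + t)
    (hinv : ∀ t, ∀ φ : X → ℝ≥0∞, Measurable φ → ∫⁻ x, φ (act t x) ∂ν = ∫⁻ x, φ x ∂ν)
    {h : E → ℝ≥0∞} (hm : Measurable h) (h1 : ∫⁻ t, h t ∂m = 1) {φ : X → ℝ≥0∞}
    (hφ : Measurable φ) :
    ∫⁻ x, φ x ∂ν = ∫⁻ x, h (τ x) * ∫⁻ t, φ (act t x) ∂m ∂ν := by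
  have hpm : Measurable fun p : X × E => h (τ p.1) * φ (act p.2 p.1) :=
    ((hm.comp hτm).comp measurable_fst).mul (hφ.comp (hact.comp measurable_swap))
  have hqm : Measurable fun p : E × X => h (τ p.2 - p.1) * φ p.2 :=
    (hm.comp ((hτm.comp measurable_snd).sub measurable_fst)).mul (hφ.comp measurable_snd)
  -- Insert `1 = ∫ h(τ x - t) dt`, exchange the integrals, and replace `x` by `act t x`, which turns
  -- `τ x - t` into `τ x`.
  calc ∫⁻ x, φ x ∂ν = ∫⁻ x, ∫⁻ t, h (τ x - t) * φ x ∂m ∂ν := by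
        refine lintegral_congr fun x => ?_
        rw [lintegral_mul_const (f := fun t => h (τ x - t)) _
          (hm.comp (measurable_const.sub measurable_id)),
          lintegral_sub_left_eq_self h, h1, one_mul]
    _ = ∫⁻ t, ∫⁻ x, h (τ x - t) * φ x ∂ν ∂m :=
        lintegral_lintegral_swap (hqm.comp measurable_swap).aemeasurable
    _ = ∫⁻ t, ∫⁻ x, h (τ x) * φ (act t x) ∂ν ∂m := by
        refine lintegral_congr fun t => ?_
        rw [← hinv t (fun x => h (τ x - t) * φ x) (hqm.comp measurable_prodMk_left)]
        simp only [hτ, add_sub_cancel_right]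
    _ = ∫⁻ x, ∫⁻ t, h (τ x) * φ (act t x) ∂m ∂ν :=
        (lintegral_lintegral_swap hpm.aemeasurable).symm
    _ = _ := by
        refine lintegral_congr fun x => ?_
        rw [lintegral_const_mul (f := fun t => φ (act t x)) _
          (hφ.comp (hact.comp (measurable_id.prodMk measurable_const)))]

namespace MinimalParabolic

variable {G : Type*} [Group G] [TopologicalSpace G] [IsTopologicalGroup G] {N : ℕ}
  {S : SemisimpleLieGroup G N} {P : MinimalParabolic S} [MeasurableSpace G] [BorelSpace G]

section Orbits

variable {l : ℕ} (e : EuclideanSpace ℝ (Fin l) ≃ₗ[ℝ] P.𝔞)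

lemma continuous_expA_comp : Continuous fun t => P.expA (e t) :=
  continuous_expA.comp (e.toLinearMap.continuous_of_finiteDimensional)

lemma expA_smul_add (s t : EuclideanSpace ℝ (Fin l)) (x : P.V') :
    P.expA (e s) • P.expA (e t) • x = P.expA (e (t + s)) • x := by
  rw [smul_smul, ← expA_add, ← map_add, add_comm]

lemma measurable_orbit :
    Measurable fun p : EuclideanSpace ℝ (Fin l) × P.V' => P.expA (e p.1) • p.2 := by
  have := P.secondCountableTopology_V
  exact (continuous_smul_V'_of ((continuous_expA_comp e).comp continuous_fst)
    continuous_snd).measurable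

lemma measurable_mk : Measurable fun x : P.V' => (Quotient.mk _ x : P.OrbitSpace) :=
  fun _ h => h

lemma mk_expA_smul (t : EuclideanSpace ℝ (Fin l)) (x : P.V') :
    (Quotient.mk _ (P.expA (e t) • x) : P.OrbitSpace) = Quotient.mk _ x :=
  Quotient.sound ⟨P.expA (e t), rfl⟩

lemma IsSection.measurable {s : P.OrbitSpace → P.V'} (hs : P.IsSection s) : Measurable s := by
  have h : Measurable (s ∘ Quotient.mk _) := (hs.continuous.comp continuous_quotient_mk').measurable
  exact measurable_from_quotient.2 h

/-- Integrals over orbits do not depend on the representative. -/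
lemma lintegral_orbit_eq {x y : P.V'} (h : (Quotient.mk _ x : P.OrbitSpace) = Quotient.mk _ y)
    (φ : P.V' → ℝ≥0∞) :
    ∫⁻ t : EuclideanSpace ℝ (Fin l), φ (P.expA (e t) • x) = ∫⁻ t, φ (P.expA (e t) • y) := by
  obtain ⟨a, rfl⟩ := Quotient.exact h
  have h1 : a = P.expA (e (e.symm (P.log a))) := by rw [e.apply_symm_apply, expA_log]
  simp only
  rw [← lintegral_add_left_eq_self (fun t => φ (P.expA (e t) • y)) (e.symm (P.log a))]
  conv_lhs => rw [h1]
  simp_rw [expA_smul_add]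

variable (P) in
lemma exists_time : ∃ τ : P.V' → EuclideanSpace ℝ (Fin l), Measurable τ ∧
    ∀ t x, τ (P.expA (e t) • x) = τ x + t := by
  obtain ⟨T, hc, hT⟩ := P.exists_equivariant
  refine ⟨fun x => e.symm (T x),
    (e.symm.toLinearMap.continuous_of_finiteDimensional.comp hc).measurable, fun t x => ?_⟩
  simp only [hT, log_expA, map_add, e.symm_apply_apply]

variable (w : G) (dx : Measure P.V) [dx.IsHaarMeasure]

variable (P) in
lemma measurableEmbedding_V' : MeasurableEmbedding (Subtype.val : P.V' → P.V) :=
  MeasurableEmbedding.subtype_coe P.measurableSet_V'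

lemma lintegral_invMeasure_eq_comap (φ : P.V → ℝ≥0∞) :
    ∫⁻ x, φ x ∂P.invMeasure w dx = ∫⁻ x : P.V', φ x ∂(P.invMeasure w dx).comap Subtype.val := by
  rw [lintegral_subtype_comap P.measurableSet_V', Measure.restrict_eq_self_of_ae_mem]
  exact (ae_invMeasure dx w).mono fun _ h => h.1

variable {w}

lemma RepresentsLongElement.lintegral_smul_comap (hw : P.RepresentsLongElement w) (a : P.A)
    {φ : P.V' → ℝ≥0∞} (hφ : Measurable φ) :
    ∫⁻ x : P.V', φ (a • x) ∂(P.invMeasure w dx).comap Subtype.val =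
      ∫⁻ x : P.V', φ x ∂(P.invMeasure w dx).comap Subtype.val := by
  have he := P.measurableEmbedding_V'
  let ψ : P.V → ℝ≥0∞ := Function.extend Subtype.val φ 0
  have hψ : Measurable ψ := he.measurable_extend hφ measurable_const
  have hψφ (x : P.V') : ψ x = φ x := Subtype.val_injective.extend_apply _ _ _
  have h := hw.lintegral_smul_invMeasure dx a hψ
  rw [lintegral_invMeasure_eq_comap, lintegral_invMeasure_eq_comap] at h
  simp_rw [hψφ, ← coe_smul_V', hψφ] at h
  exact h

lemma isQuotientMeasure_iff {dω : Measure P.OrbitSpace} : P.IsQuotientMeasure e w dx dω ↔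
    ∀ φ : P.V' → ℝ≥0∞, Measurable φ →
      ∫⁻ x, φ x ∂(P.invMeasure w dx).comap Subtype.val =
        ∫⁻ ω, (∫⁻ t : EuclideanSpace ℝ (Fin l), φ (P.expA (e t) • ω.out)) ∂dω := by
  constructor
  · intro h φ hφ
    have he := P.measurableEmbedding_V'
    let ψ : P.V → ℝ≥0∞ := Function.extend Subtype.val φ 0
    have hψ : Measurable ψ := he.measurable_extend hφ measurable_const
    have hψφ (x : P.V') : ψ x = φ x := Subtype.val_injective.extend_apply _ _ _
    have h1 := h ψ hψ
    rw [lintegral_invMeasure_eq_comap] at h1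
    simp_rw [← coe_smul_V', hψφ] at h1
    exact h1
  · intro h φ hφ
    rw [lintegral_invMeasure_eq_comap]
    exact h (fun x => φ x) (hφ.comp measurable_subtype_coe)

lemma lintegral_out {s : P.OrbitSpace → P.V'} (hs : P.IsSection s) (φ : P.V' → ℝ≥0∞)
    (ω : P.OrbitSpace) :
    ∫⁻ t : EuclideanSpace ℝ (Fin l), φ (P.expA (e t) • ω.out) =
      ∫⁻ t, φ (P.expA (e t) • s ω) :=
  lintegral_orbit_eq e (by rw [hs.rightInverse, Quotient.out_eq]) φ

/-- The quotient measure is the image of `h(τ x) dν`: the weight `h ∘ τ` has total mass `1` on each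
orbit, so the push-forward counts every orbit once. -/
lemma RepresentsLongElement.exists_isQuotientMeasure (hw : P.RepresentsLongElement w) :
    ∃ dω : Measure P.OrbitSpace, SFinite dω ∧ P.IsQuotientMeasure e w dx dω := by
  obtain ⟨τ, hτm, hτ⟩ := P.exists_time e
  obtain ⟨h, hm, h1⟩ := exists_lintegral_eq_one (EuclideanSpace ℝ (Fin l)) volume
  obtain ⟨s, hs⟩ := P.exists_isSection
  have := sFinite_invMeasure w dx
  have := P.measurableEmbedding_V'.sFinite_comap (P.invMeasure w dx)
  set ν := (P.invMeasure w dx).comap (Subtype.val : P.V' → P.V)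
  refine ⟨(ν.withDensity (h ∘ τ)).map (Quotient.mk _), inferInstance,
    (isQuotientMeasure_iff e dx).2 fun φ hφ => ?_⟩
  have ho := measurable_orbit e
  simp_rw [lintegral_out e hs φ]
  have hJ : Measurable fun ω => ∫⁻ t : EuclideanSpace ℝ (Fin l), φ (P.expA (e t) • s ω) :=
    Measurable.lintegral_prod_left' (f := fun p : EuclideanSpace ℝ (Fin l) × P.OrbitSpace =>
      φ (P.expA (e p.1) • s p.2))
      (hφ.comp (ho.comp (measurable_fst.prodMk (hs.measurable.comp measurable_snd))))
  rw [lintegral_map hJ measurable_mk,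
    lintegral_withDensity_eq_lintegral_mul _ (hm.comp hτm) (g := fun x : P.V' =>
      ∫⁻ t : EuclideanSpace ℝ (Fin l), φ (P.expA (e t) • s (Quotient.mk _ x)))
      (hJ.comp measurable_mk)]
  change ∫⁻ x, φ x ∂ν = _
  have h2 (x : P.V') : ∫⁻ t : EuclideanSpace ℝ (Fin l),
      φ (P.expA (e t) • s (Quotient.mk _ x)) = ∫⁻ t, φ (P.expA (e t) • x) :=
    lintegral_orbit_eq e (hs.rightInverse _) φ
  rw [lintegral_eq_lintegral_time ho hτm hτ (fun t _ hφ => hw.lintegral_smul_comap dx _ hφ) hm h1 hφ]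
  simp only [Pi.mul_apply, Function.comp_apply, h2]
  rfl

/-- Testing with the indicator of `B` times `η ∘ τ`, whose integral over each orbit is `1`, recovers
`dω B` from the measure on `V'`. -/
lemma IsQuotientMeasure.eq {dω dω' : Measure P.OrbitSpace} (h : P.IsQuotientMeasure e w dx dω)
    (h' : P.IsQuotientMeasure e w dx dω') : dω = dω' := by
  obtain ⟨τ, hτm, hτ⟩ := P.exists_time e
  obtain ⟨η, hm, h1⟩ := exists_lintegral_eq_one (EuclideanSpace ℝ (Fin l)) volume
  have key {dω : Measure P.OrbitSpace} (h : P.IsQuotientMeasure e w dx dω) {B : Set P.OrbitSpace}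
      (hB : MeasurableSet B) : dω B = ∫⁻ x : P.V',
        B.indicator 1 (Quotient.mk _ x : P.OrbitSpace) * η (τ x)
          ∂(P.invMeasure w dx).comap Subtype.val := by
    rw [(isQuotientMeasure_iff e dx).1 h (fun x => B.indicator 1 (Quotient.mk _ x : P.OrbitSpace) *
      η (τ x)) (((measurable_one.indicator hB).comp measurable_mk).mul (hm.comp hτm)),
      ← lintegral_indicator_one hB]
    refine lintegral_congr fun ω => ?_
    simp_rw [mk_expA_smul, hτ, Quotient.out_eq]
    rw [lintegral_const_mul (f := fun t => η (τ ω.out + t)) _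
        (hm.comp (measurable_const.add measurable_id)),
      lintegral_add_left_eq_self η, h1, mul_one]
  ext B hB
  rw [key h hB, key h' hB]

/-- By uniqueness any quotient measure is the one constructed, which is an image of an s-finite
measure. Fubini's theorem on `A × A \ V'` depends on this. -/
lemma RepresentsLongElement.sFinite_of_isQuotientMeasure (hw : P.RepresentsLongElement w)
    {dω : Measure P.OrbitSpace} (h : P.IsQuotientMeasure e w dx dω) : SFinite dω := by
  obtain ⟨dω', h1, h2⟩ := hw.exists_isQuotientMeasure e dx
  rw [h.eq e dx h2]
  exact h1

/-- A section identifies `A × A \ V'` with `V'`, as measure spaces. -/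
lemma RepresentsLongElement.measurePreserving (hw : P.RepresentsLongElement w)
    {dω : Measure P.OrbitSpace} (h : P.IsQuotientMeasure e w dx dω)
    {s : P.OrbitSpace → P.V'} (hs : P.IsSection s) :
    MeasurePreserving (fun p : EuclideanSpace ℝ (Fin l) × P.OrbitSpace =>
      P.expA (e p.1) • (s p.2 : P.V)) (volume.prod dω) (P.invMeasure w dx) := by
  have := hw.sFinite_of_isQuotientMeasure e dx h
  have hm : Measurable fun p : EuclideanSpace ℝ (Fin l) × P.OrbitSpace =>
      P.expA (e p.1) • (s p.2 : P.V) :=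
    measurable_subtype_coe.comp ((measurable_orbit e).comp
      (measurable_fst.prodMk (hs.measurable.comp measurable_snd)))
  refine ⟨hm, Measure.ext_of_lintegral _ fun φ hφ => ?_⟩
  rw [lintegral_map hφ hm, lintegral_prod_symm' (fun p => φ (P.expA (e p.1) • (s p.2 : P.V)))
    (hφ.comp hm), h φ hφ]
  exact lintegral_congr fun ω => (lintegral_out e hs (fun x => φ x) ω).symm

end Orbits

end MinimalParabolic

/-! ### The `L²` Fourier transform with measurable dependence on parameters. -/

section FourierL2

open scoped FourierTransform
open Filter Topology

variable {E W : Type*} [NormedAddCommGroup E] [InnerProductSpace ℝ E] [FiniteDimensional ℝ E]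
  [MeasurableSpace E] [BorelSpace E] [NormedAddCommGroup W] [InnerProductSpace ℂ W]
  [CompleteSpace W]

namespace MeasureTheory.Lp

/-- The multiplication formula, obtained from the agreement of the `L²` and the distributional
Fourier transforms. -/
lemma integral_smul_fourier (f : Lp (α := E) W 2 volume) {ψ : E → ℂ} (h : HasCompactSupport ψ)
    (h' : ContDiff ℝ (⊤ : ℕ∞) ψ) :
    ∫ x, ψ x • (𝓕 f : Lp (α := E) W 2 volume) x = ∫ x, 𝓕 ψ x • f x := by
  have h1 := congrArg (fun T => T (h.toSchwartzMap h')) (fourier_toTemperedDistribution_eq f)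
  simp only [TemperedDistribution.fourier_apply, toTemperedDistribution_apply,
    SchwartzMap.fourier_coe] at h1
  exact h1.symm

/-- An `L²` transform has no pointwise integral formula, so both sides are tested against smooth
compactly supported functions; the exponential factor is moved onto the test function, whose
transform it translates. -/
lemma fourier_translate {f f' : Lp (α := E) W 2} {b : E} (h : f' =ᵐ[volume] fun t => f (t - b)) :
    (𝓕 f' : Lp (α := E) W 2 volume) =ᵐ[volume]
      fun ξ => (𝐞 (-inner ℝ ξ b) : ℂ) • (𝓕 f : Lp (α := E) W 2 volume) ξ := by
  have hc : Continuous fun ξ : E => (𝐞 (-inner ℝ ξ b) : ℂ) := by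
    have := Real.continuous_fourierChar
    fun_prop
  have hm : MemLp (fun ξ => (𝐞 (-inner ℝ ξ b) : ℂ) • (𝓕 f : Lp (α := E) W 2 volume) ξ) 2 volume := by
    refine (Lp.memLp (𝓕 f : Lp (α := E) W 2 volume)).mono
      (hc.aestronglyMeasurable.smul (Lp.aestronglyMeasurable _)) (ae_of_all _ fun ξ => ?_)
    rw [norm_smul, Circle.norm_coe, one_mul]
  refine ae_eq_of_integral_contDiff_smul_eq ((Lp.memLp (𝓕 f' : Lp (α := E) W 2 volume)).locallyIntegrable one_le_two)
    (hm.locallyIntegrable one_le_two) fun g hg hgc => ?_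
  have hgc1 : HasCompactSupport fun x => (g x : ℂ) := hgc.comp_left (g := Complex.ofReal) rfl
  have hg1 : ContDiff ℝ (⊤ : ℕ∞) fun x => (g x : ℂ) := Complex.ofRealCLM.contDiff.comp hg
  have hgc2 : HasCompactSupport fun x => (𝐞 (-inner ℝ x b) : ℂ) * (g x : ℂ) := hgc1.mul_left
  have hg2 : ContDiff ℝ (⊤ : ℕ∞) fun x => (𝐞 (-inner ℝ x b) : ℂ) * (g x : ℂ) := by
    refine ContDiff.mul ?_ hg1
    simp only [Real.fourierChar_apply]
    exact ((Complex.ofRealCLM.contDiff.comp (contDiff_const.mul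
      (contDiff_id.inner ℝ contDiff_const).neg)).mul contDiff_const).cexp
  have h1 := integral_smul_fourier f' hgc1 hg1
  have h2 := integral_smul_fourier f hgc2 hg2
  simp only [Complex.coe_smul] at h1
  rw [h1]
  have h3 : ∀ x, g x • (𝐞 (-inner ℝ x b) : ℂ) • (𝓕 f : Lp (α := E) W 2 volume) x =
      ((𝐞 (-inner ℝ x b) : ℂ) * (g x : ℂ)) • (𝓕 f : Lp (α := E) W 2 volume) x := fun x => by
    rw [← Complex.coe_smul, smul_smul, mul_comm]
  simp only [h3]
  rw [h2, ← integral_add_right_eq_self _ b]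
  have h4 := (measurePreserving_add_right volume b).quasiMeasurePreserving.ae_eq_comp h
  refine integral_congr_ae (h4.mono fun t ht => ?_)
  simp only [Function.comp_apply, add_sub_cancel_right] at ht
  simp only [ht]
  congr 1
  rw [Real.fourier_eq', Real.fourier_eq']
  refine integral_congr_ae (ae_of_all _ fun v => ?_)
  simp only [smul_eq_mul, Real.fourierChar_apply]
  rw [← mul_assoc, ← Complex.exp_add, inner_add_right]
  congr 2
  push_cast
  ring

/-- A sequence of smooth approximate identities. -/
def approxBump (E : Type*) [NormedAddCommGroup E] (n : ℕ) : ContDiffBump (0 : E) where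
  rIn := 1 / (n + 1)
  rOut := 2 / (n + 1)
  rIn_pos := by positivity
  rIn_lt_rOut := by gcongr; norm_num

/-- The Fourier transform of a translated approximate identity. -/
def approxKernel (n : ℕ) (ξ : E) : E → ℂ :=
  𝓕 fun η : E => (((approxBump E n).normed volume (ξ - η) : ℝ) : ℂ)

lemma stronglyMeasurable_approxKernel (n : ℕ) :
    StronglyMeasurable fun p : E × E => approxKernel n p.1 p.2 := by
  have := FiniteDimensional.proper ℝ E
  simp only [approxKernel, Real.fourier_eq']
  have hc : Continuous (fun q : (E × E) × E => Complex.exp (↑(-2 * Real.pi * inner ℝ q.2 q.1.2) *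
      Complex.I) • (((approxBump E n).normed volume (q.1.1 - q.2) : ℝ) : ℂ)) := by
    have : Continuous ((approxBump E n).normed volume) := (approxBump E n).continuous_normed
    fun_prop
  exact hc.stronglyMeasurable.integral_prod_right

/-- By the multiplication formula the integral is the convolution of the transform with a bump at
`ξ`, which converges almost everywhere by Lebesgue differentiation. The transform is thus a
pointwise limit of integrals that depend measurably on `ξ` and on further parameters. -/
lemma tendsto_approxKernel (f : Lp (α := E) W 2 volume) :
    ∀ᵐ ξ : E, Tendsto (fun n => ∫ t, approxKernel n ξ t • f t) atTop
      (𝓝 ((𝓕 f : Lp (α := E) W 2 volume) ξ)) := by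
  have h1 : Tendsto (fun n : ℕ => (approxBump E n).rOut) atTop (𝓝 0) := by
    simp only [approxBump]
    have := (tendsto_one_div_add_atTop_nhds_zero_nat (𝕜 := ℝ)).const_mul 2
    simpa [div_eq_mul_inv] using this
  have h2 : ∀ᶠ n in atTop, (approxBump E n).rOut ≤ 2 * (approxBump E n).rIn :=
    Eventually.of_forall fun n => le_of_eq (by simp only [approxBump]; ring)
  filter_upwards [ContDiffBump.ae_convolution_tendsto_right_of_locallyIntegrable h1 h2
    ((Lp.memLp (𝓕 f : Lp (α := E) W 2 volume)).locallyIntegrable one_le_two)] with ξ hξ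
  refine hξ.congr fun n => ?_
  rw [convolution_eq_swap]
  have hc : HasCompactSupport fun η : E => (((approxBump E n).normed volume (ξ - η) : ℝ) : ℂ) := by
    refine HasCompactSupport.comp_left (g := Complex.ofReal) ?_ rfl
    exact (approxBump E n).hasCompactSupport_normed.comp_homeomorph (Homeomorph.subLeft ξ)
  have hd : ContDiff ℝ (⊤ : ℕ∞) fun η : E => (((approxBump E n).normed volume (ξ - η) : ℝ) : ℂ) :=
    Complex.ofRealCLM.contDiff.comp
      ((approxBump E n).contDiff_normed.comp (contDiff_const.sub contDiff_id))
  rw [approxKernel, ← integral_smul_fourier f hc hd]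
  simp only [Complex.coe_smul, ContinuousLinearMap.lsmul_apply]

/-- The `L²` Fourier transforms of the slices of a measurable function are the slices of a
measurable function. -/
lemma exists_measurable_fourier {Ω : Type*} [MeasurableSpace Ω] {F : E × Ω → W}
    (hF : StronglyMeasurable F) : ∃ Φ : E × Ω → W, StronglyMeasurable Φ ∧
      ∀ ω, ∀ hf : MemLp (fun t => F (t, ω)) 2 volume,
        ∀ᵐ ξ : E, Φ (ξ, ω) = (𝓕 (hf.toLp _) : Lp (α := E) W 2 volume) ξ := by
  have hm (n : ℕ) : StronglyMeasurable fun p : E × Ω =>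
      ∫ t, approxKernel n p.1 t • F (t, p.2) := by
    refine StronglyMeasurable.integral_prod_right (f := fun (p : E × Ω) t =>
      approxKernel n p.1 t • F (t, p.2)) ?_
    exact ((stronglyMeasurable_approxKernel n).comp_measurable
      ((measurable_fst.comp measurable_fst).prodMk measurable_snd)).smul
      (hF.comp_measurable (measurable_snd.prodMk (measurable_snd.comp measurable_fst)))
  -- Where the limit fails to exist `limUnder` has a junk value, but for each square integrable
  -- slice this happens only on a null set of `ξ`.
  refine ⟨_, StronglyMeasurable.limUnder (l := atTop) hm, fun ω hf => ?_⟩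
  filter_upwards [tendsto_approxKernel (hf.toLp _)] with ξ hξ
  refine Tendsto.limUnder_eq (hξ.congr fun n => ?_)
  refine integral_congr_ae (hf.coeFn_toLp.mono fun t ht => ?_)
  simp only [ht]

lemma lintegral_enorm_sq {X : Type*} [MeasurableSpace X] {μ : Measure X} (f : X → W) :
    ∫⁻ x, ‖f x‖ₑ ^ 2 ∂μ = eLpNorm f 2 μ ^ 2 := by
  have := eLpNorm_nnreal_pow_eq_lintegral (f := f) (μ := μ) (p := 2) two_ne_zero
  norm_num at this
  exact this.symm

lemma eLpNorm_two_lt_top_iff {X : Type*} [MeasurableSpace X] {μ : Measure X} (f : X → W) :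
    eLpNorm f 2 μ < ∞ ↔ ∫⁻ x, ‖f x‖ₑ ^ 2 ∂μ < ∞ := by
  rw [lintegral_enorm_sq, ENNReal.pow_lt_top_iff]
  simp

section Slices

variable {Ω : Type*} [MeasurableSpace Ω] {ν : Measure Ω} [SFinite ν] {F Φ G Γ : E × Ω → W}

lemma _root_.MeasureTheory.MemLp.ae_slice (hF : MemLp F 2 (volume.prod ν)) :
    ∀ᵐ ω ∂ν, MemLp (fun t => F (t, ω)) 2 volume := by
  have h1 := hF.1.prodMk_right
  have h2 := (memLp_two_iff_integrable_sq_norm hF.1).1 hF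
  filter_upwards [h1, h2.prod_left_ae] with ω h3 h4
  exact (memLp_two_iff_integrable_sq_norm h3).2 h4

/-- The slices of `Φ` are the `L²` Fourier transforms of the slices of `F`. -/
def IsSliceFourier (ν : Measure Ω) (F Φ : E × Ω → W) : Prop :=
  ∀ᵐ ω ∂ν, ∃ hf : MemLp (fun t => F (t, ω)) 2 volume,
    ∀ᵐ ξ : E, Φ (ξ, ω) = (𝓕 (hf.toLp _) : Lp (α := E) W 2 volume) ξ

/-- Plancherel on each slice, then Tonelli. -/
lemma IsSliceFourier.memLp (h : IsSliceFourier ν F Φ) (hΦ : AEStronglyMeasurable Φ (volume.prod ν))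
    (hF : MemLp F 2 (volume.prod ν)) : MemLp Φ 2 (volume.prod ν) := by
  refine ⟨hΦ, ?_⟩
  have h1 := (eLpNorm_two_lt_top_iff F).1 hF.2
  rw [eLpNorm_two_lt_top_iff]
  rw [lintegral_prod_symm _ (hF.1.enorm.pow_const 2)] at h1
  rw [lintegral_prod_symm _ (hΦ.enorm.pow_const 2)]
  refine lt_of_eq_of_lt (lintegral_congr_ae (h.mono fun ω hω => ?_)) h1
  obtain ⟨hf, hω⟩ := hω
  simp only
  rw [lintegral_enorm_sq, lintegral_enorm_sq, eLpNorm_congr_ae hω, ← eLpNorm_congr_ae hf.coeFn_toLp,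
    ← Lp.enorm_def, ← Lp.enorm_def]
  congr 1
  rw [← ofReal_norm, ← ofReal_norm, norm_fourier_eq]

lemma _root_.MeasureTheory.MemLp.integrable_inner_two {X : Type*} [MeasurableSpace X] {μ : Measure X}
    {f g : X → W} (hf : MemLp f 2 μ) (hg : MemLp g 2 μ) :
    Integrable (fun x => inner ℂ (f x) (g x)) μ := by
  refine (L2.integrable_inner (𝕜 := ℂ) (hf.toLp f) (hg.toLp g)).congr ?_
  filter_upwards [hf.coeFn_toLp, hg.coeFn_toLp] with x h1 h2
  rw [h1, h2]

lemma _root_.MeasureTheory.MemLp.translate (hF : MemLp F 2 (volume.prod ν)) (b : E) :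
    MemLp (fun p : E × Ω => F (p.1 - b, p.2)) 2 (volume.prod ν) :=
  hF.comp_measurePreserving ((measurePreserving_sub_right volume b).prod (MeasurePreserving.id ν))

/-- Plancherel's formula for the matrix coefficients of translations. -/
lemma IsSliceFourier.integral_eq (hΦ : IsSliceFourier ν F Φ) (hΓ : IsSliceFourier ν G Γ)
    (hΦm : AEStronglyMeasurable Φ (volume.prod ν)) (hΓm : AEStronglyMeasurable Γ (volume.prod ν))
    (hF : MemLp F 2 (volume.prod ν)) (hG : MemLp G 2 (volume.prod ν)) (b : E) :
    ∫ ξ : E, (𝐞 (-inner ℝ ξ b) : ℂ) * ∫ ω, inner ℂ (Γ (ξ, ω)) (Φ (ξ, ω)) ∂ν =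
      ∫ p, inner ℂ (G p) (F (p.1 - b, p.2)) ∂(volume.prod ν) := by
  have hi := (hΓ.memLp hΓm hG).integrable_inner_two (hΦ.memLp hΦm hF)
  have hi' := hG.integrable_inner_two (hF.translate b)
  have hc : Continuous fun ξ : E => (𝐞 (-inner ℝ ξ b) : ℂ) := by
    have := Real.continuous_fourierChar
    fun_prop
  have hi2 : Integrable (fun p : E × Ω => (𝐞 (-inner ℝ p.1 b) : ℂ) * inner ℂ (Γ p) (Φ p))
      (volume.prod ν) := by
    refine hi.mono ((hc.comp_aestronglyMeasurable
      measurable_fst.aestronglyMeasurable).mul hi.1) (ae_of_all _ fun p => ?_)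
    rw [norm_mul, Circle.norm_coe, one_mul]
  -- Fubini on both sides reduces the claim to a single slice, where Plancherel applies to the
  -- translated function and `fourier_translate` supplies the exponential.
  simp_rw [← integral_const_mul]
  rw [← integral_prod (fun p : E × Ω => (𝐞 (-inner ℝ p.1 b) : ℂ) * inner ℂ (Γ p) (Φ p)) hi2,
    integral_prod_symm _ hi2, integral_prod_symm _ hi']
  refine integral_congr_ae ?_
  filter_upwards [hΦ, hΓ] with ω hω hω'
  obtain ⟨hf, hω⟩ := hω
  obtain ⟨hg, hω'⟩ := hω'
  have hfb : MemLp (fun t => F (t - b, ω)) 2 volume :=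
    hf.comp_measurePreserving (measurePreserving_sub_right volume b)
  have h1 : (hfb.toLp _ : Lp (α := E) W 2 volume) =ᵐ[volume] fun t => hf.toLp _ (t - b) := by
    have h2 := (measurePreserving_sub_right volume b).quasiMeasurePreserving.ae_eq_comp
      hf.coeFn_toLp
    filter_upwards [hfb.coeFn_toLp, h2] with t h3 h4
    rw [h3]
    exact h4.symm
  have h2 := inner_fourier_eq (hg.toLp _) (hfb.toLp _)
  rw [L2.inner_def, L2.inner_def] at h2
  calc ∫ ξ, (𝐞 (-inner ℝ ξ b) : ℂ) * inner ℂ (Γ (ξ, ω)) (Φ (ξ, ω))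
      = ∫ ξ, inner ℂ ((𝓕 (hg.toLp _) : Lp (α := E) W 2 volume) ξ)
          ((𝓕 (hfb.toLp _) : Lp (α := E) W 2 volume) ξ) := by
        refine integral_congr_ae ?_
        filter_upwards [hω, hω', fourier_translate h1] with ξ h3 h4 h5
        rw [h3, h4, h5, inner_smul_right]
    _ = _ := h2
    _ = _ := by
        refine integral_congr_ae ?_
        filter_upwards [hg.coeFn_toLp, hfb.coeFn_toLp] with t h3 h4
        rw [h3, h4]

end Slices

end MeasureTheory.Lp

end FourierL2

lemma MeasureTheory.MeasurePreserving.integral_comp_of_aestronglyMeasurable {X Y F : Type*}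
    [MeasurableSpace X] [MeasurableSpace Y] [NormedAddCommGroup F] [NormedSpace ℝ F]
    {μ : Measure X} {ν : Measure Y} {h : X → Y} (hh : MeasurePreserving h μ ν) {f : Y → F}
    (hf : AEStronglyMeasurable f ν) : ∫ x, f (h x) ∂μ = ∫ y, f y ∂ν := by
  rw [← hh.map_eq] at hf ⊢
  exact (integral_map hh.measurable.aemeasurable hf).symm

/-! ### The adapted realization on `A`, and modified Fourier transforms. -/

namespace MinimalParabolic

section DualMeasure

variable (l : ℕ)

/-- The dilation by `2 π`. -/
def dilation : EuclideanSpace ℝ (Fin l) ≃ₜ EuclideanSpace ℝ (Fin l) :=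
  Homeomorph.smulOfNeZero (2 * Real.pi) (by positivity)

variable {l}

lemma dilation_apply (ξ : EuclideanSpace ℝ (Fin l)) : dilation l ξ = (2 * Real.pi) • ξ := rfl

lemma inv_smul_dilation (ξ : EuclideanSpace ℝ (Fin l)) :
    (2 * Real.pi)⁻¹ • dilation l ξ = ξ := (dilation l).symm_apply_apply ξ

variable (l)

/-- Dilation by `2π` passes from the kernel `exp (-2πi ξ·t)` with Lebesgue measure to the kernel
`exp (-i υ·t)` with the dual measure. -/
lemma dualMeasure_eq_map : dualMeasure l = volume.map (dilation l) := by
  have h := Measure.map_addHaar_smul (volume : Measure (EuclideanSpace ℝ (Fin l)))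
    (r := 2 * Real.pi) (by positivity)
  rw [finrank_euclideanSpace_fin, abs_of_nonneg (by positivity)] at h
  exact h.symm

lemma measurePreserving_dilation : MeasurePreserving (dilation l) volume (dualMeasure l) :=
  ⟨(dilation l).continuous.measurable, (dualMeasure_eq_map l).symm⟩

lemma dualMeasure_absolutelyContinuous : dualMeasure l ≪ volume :=
  Measure.smul_absolutelyContinuous

lemma absolutelyContinuous_dualMeasure : volume ≪ dualMeasure l :=
  Measure.absolutelyContinuous_smul (ENNReal.ofReal_pos.2 (by positivity)).ne'

end DualMeasure

variable {G : Type*} [Group G] [TopologicalSpace G] [IsTopologicalGroup G] {N : ℕ}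
  {S : SemisimpleLieGroup G N} {P : MinimalParabolic S}
  {W : Type*} [NormedAddCommGroup W] [InnerProductSpace ℂ W]

/-- A number of modulus one is its own conjugate inverse, so `f` and `g` are twisted by the same
character. -/
lemma chi_contragredient {lam : P.𝔞 →ₗ[ℝ] ℂ} (hlam : ∀ a : P.A, ‖P.chi lam a‖ = 1) (a : P.A) :
    P.chi (P.contragredient lam) a = P.chi lam a := by
  have h1 : P.chi (P.contragredient lam) a = (starRingEnd ℂ (P.chi lam a))⁻¹ := by
    rw [chi, chi, ← Complex.exp_conj, ← Complex.exp_neg]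
    rfl
  rw [h1, Complex.inv_def, Complex.conj_conj, Complex.normSq_conj, Complex.normSq_eq_norm_sq, hlam]
  simp

lemma twist_contragredient {l : ℕ} (e : EuclideanSpace ℝ (Fin l) ≃ₗ[ℝ] P.𝔞)
    (s : P.OrbitSpace → P.V') {lam : P.𝔞 →ₗ[ℝ] ℂ} (hlam : ∀ a : P.A, ‖P.chi lam a‖ = 1)
    (f : P.V → W) : P.twist e s (P.contragredient lam) f = P.twist e s lam f := by
  funext ω t
  rw [twist, twist, chi_contragredient hlam]

lemma chi_mul (μ : P.𝔞 →ₗ[ℝ] ℂ) (a b : P.A) : P.chi μ (a * b) = P.chi μ a * P.chi μ b := by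
  rw [chi, log_mul, map_add, Complex.exp_add]; rfl

/-- In the adapted realization, `A` acts by translations and a character. -/
lemma RepresentsLongElement.Uadapted_apply {w : G} (hw : P.RepresentsLongElement w)
    (σ : P.M →* (W ≃ₗᵢ[ℂ] W)) (lam : P.𝔞 →ₗ[ℝ] ℂ) (a : P.A) (f : P.V → W) {x : P.V}
    (hx : 0 < P.xi (w⁻¹ * x)) :
    P.Uadapted w σ lam (a : G) f x = P.chi lam a • f (a⁻¹ • x) := by
  -- The decomposition `a⁻¹ x = (a⁻¹ x a) · 1 · a⁻¹ · 1` has trivial `M`- and `N`-components. The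
  -- factor `e^{ρ(log a)}` from `χ_{λ+ρ}` then cancels against the ratio of the square roots of
  -- `ξ_{-ρ}`.
  have h := cell_parts (x := (a : G)⁻¹ * x) (v := a⁻¹ • x) (m := 1) (a := a⁻¹) (n := 1) (by
    rw [coe_smul_V]; simp)
  obtain ⟨h1, h2, h3, h4⟩ := h
  have hpow : P.xi (w⁻¹ * (a⁻¹ • x : P.V)) ^ (1 / 2 : ℝ) =
      Real.exp (-P.rho (P.log a)) * P.xi (w⁻¹ * x) ^ (1 / 2 : ℝ) := by
    rw [hw.xi_smul, Real.mul_rpow (Real.exp_pos _).le hx.le, ← Real.exp_mul, log_inv, map_neg]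
    congr 2
    ring
  have hchi : (P.chi (lam + P.rhoC) a⁻¹)⁻¹ =
      P.chi lam a * (Real.exp (P.rho (P.log a)) : ℂ) := by
    rw [chi, chi, ← Complex.exp_neg, log_inv, map_neg, neg_neg, LinearMap.add_apply,
      Complex.exp_add, Complex.ofReal_exp]
    rfl
  rw [Uadapted, T, U, if_pos h1, h2, h3, h4, Tinv, map_one, inv_one, LinearIsometryEquiv.coe_one,
    id, hpow, hchi, smul_smul, smul_smul]
  congr 1
  rw [Real.rpow_neg hx.le]
  have hne : P.xi (w⁻¹ * x) ^ (1 / 2 : ℝ) ≠ 0 := (Real.rpow_pos_of_pos hx _).ne'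
  have hexp : Real.exp (P.rho (P.log a)) * Real.exp (-P.rho (P.log a)) = 1 := by
    rw [← Real.exp_add, add_neg_cancel, Real.exp_zero]
  generalize P.xi (w⁻¹ * x) ^ (1 / 2 : ℝ) = r at hne ⊢
  have h5 : r⁻¹ * (Real.exp (P.rho (P.log a)) * (Real.exp (-P.rho (P.log a)) * r)) = 1 := by
    rw [← mul_assoc (Real.exp _), hexp, one_mul, inv_mul_cancel₀ hne]
  have h6 := congrArg (fun z : ℝ => (z : ℂ)) h5
  push_cast at h6 ⊢
  linear_combination P.chi lam a * h6

variable [MeasurableSpace G] [BorelSpace G] {l : ℕ} (e : EuclideanSpace ℝ (Fin l) ≃ₗ[ℝ] P.𝔞)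
  {w : G} (hw : P.RepresentsLongElement w) (dx : Measure P.V) [dx.IsHaarMeasure]
  {dω : Measure P.OrbitSpace} (hq : P.IsQuotientMeasure e w dx dω)
  {s : P.OrbitSpace → P.V'} (hs : P.IsSection s) {lam : P.𝔞 →ₗ[ℝ] ℂ}
  (hlam : ∀ a : P.A, ‖P.chi lam a‖ = 1)

lemma continuous_chi (lam : P.𝔞 →ₗ[ℝ] ℂ) : Continuous fun t => P.chi lam (P.expA (e t)) := by
  simp only [chi, log_expA]
  exact Complex.continuous_exp.comp
    ((lam ∘ₗ e.toLinearMap).continuous_of_finiteDimensional)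

lemma stronglyMeasurable_twist (hs : P.IsSection s) (lam : P.𝔞 →ₗ[ℝ] ℂ) {f : P.V → W}
    (hf : StronglyMeasurable f) :
    StronglyMeasurable fun p : EuclideanSpace ℝ (Fin l) × P.OrbitSpace =>
      P.twist e s lam f p.2 p.1 := by
  have h1 : Measurable fun p : EuclideanSpace ℝ (Fin l) × P.OrbitSpace =>
      P.expA (e p.1) • (s p.2 : P.V) :=
    measurable_subtype_coe.comp ((measurable_orbit e).comp
      (measurable_fst.prodMk (hs.measurable.comp measurable_snd)))
  have h2 : Measurable fun p : EuclideanSpace ℝ (Fin l) × P.OrbitSpace =>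
      (P.chi lam (P.expA (e p.1)))⁻¹ :=
    ((continuous_chi e lam).measurable.comp measurable_fst).inv
  exact h2.stronglyMeasurable.smul (hf.comp_measurable h1)

include hw hq hs hlam in
lemma memLp_twist {f : P.V → W} (hf : StronglyMeasurable f)
    (hf2 : MemLp f 2 (P.invMeasure w dx)) :
    MemLp (fun p : EuclideanSpace ℝ (Fin l) × P.OrbitSpace => P.twist e s lam f p.2 p.1) 2
      (volume.prod dω) := by
  refine (hf2.comp_measurePreserving (hw.measurePreserving e dx hq hs)).mono
    (stronglyMeasurable_twist e hs lam hf).aestronglyMeasurable (ae_of_all _ fun p => ?_)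
  rw [twist, norm_smul, norm_inv, hlam, inv_one, one_mul]
  rfl

variable (lam)

include hw in
lemma coeffIntegrand_ae_eq (σ : P.M →* (W ≃ₗᵢ[ℂ] W)) (f g : P.V → W) (a : P.A) :
    P.coeffIntegrand w σ lam f g (a : G) =ᵐ[P.invMeasure w dx]
      fun x => inner ℂ (g x) (P.chi lam a • f (a⁻¹ • x)) := by
  filter_upwards [ae_invMeasure dx w] with x hx
  rw [coeffIntegrand, hw.Uadapted_apply σ lam a f hx.2]

variable {lam}

include hlam in
-- The factor `χ_λ(a)` is absorbed into the twist of `f` at the translated point, and the remaining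
-- factors `χ_λ(t)⁻¹` on the two sides of the inner product cancel by unitarity.
lemma inner_translate (f g : P.V → W) (a : P.A) (p : EuclideanSpace ℝ (Fin l) × P.OrbitSpace) :
    inner ℂ (g (P.expA (e p.1) • (s p.2 : P.V)))
        (P.chi lam a • f (a⁻¹ • P.expA (e p.1) • (s p.2 : P.V))) =
      inner ℂ (P.twist e s lam g p.2 p.1)
        (P.twist e s lam f p.2 (p.1 - e.symm (P.log a))) := by
  have h1 : P.expA (e (p.1 - e.symm (P.log a))) = a⁻¹ * P.expA (e p.1) := by
    rw [map_sub, e.apply_symm_apply, sub_eq_add_neg, expA_add, expA_neg, expA_log, commute_A]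
  have h2 : P.chi lam a⁻¹ = (P.chi lam a)⁻¹ := by
    rw [chi, chi, log_inv, map_neg, Complex.exp_neg]
  have h3 (b : P.A) : starRingEnd ℂ (P.chi lam b)⁻¹ = P.chi lam b := by
    rw [Complex.inv_def, map_mul, Complex.conj_conj, Complex.normSq_eq_norm_sq, hlam]
    simp
  have h4 : P.chi lam (P.expA (e p.1)) ≠ 0 := Complex.exp_ne_zero _
  rw [twist, twist, h1, chi_mul, h2, mul_smul, inner_smul_left, h3, inner_smul_right,
    inner_smul_right, mul_inv, inv_inv]
  field_simp

section Main

variable [FiniteDimensional ℂ W]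

open Lp in
include hs in
lemma exists_isModifiedFourierTransform [SFinite dω] (lam : P.𝔞 →ₗ[ℝ] ℂ) {f : P.V → W}
    (hf : StronglyMeasurable f)
    (hF : MemLp (fun p : EuclideanSpace ℝ (Fin l) × P.OrbitSpace => P.twist e s lam f p.2 p.1) 2
      (volume.prod dω)) :
    ∃ F, P.IsModifiedFourierTransform e dω s lam f F := by
  have : CompleteSpace W := FiniteDimensional.complete ℂ W
  obtain ⟨Φ, hΦ, h⟩ := exists_measurable_fourier (stronglyMeasurable_twist e hs lam hf)
  refine ⟨fun υ ω => Φ ((dilation l).symm υ, ω), ?_, ?_⟩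
  · exact (hΦ.comp_measurable (((dilation l).symm.continuous.measurable.comp
      measurable_fst).prodMk measurable_snd)).aestronglyMeasurable
  · filter_upwards [hF.ae_slice] with ω hω
    refine ⟨hω, absolutelyContinuous_dualMeasure l ?_⟩
    rw [dualMeasure_eq_map]
    refine ((dilation l).measurableEmbedding.ae_map_iff).2 ?_
    filter_upwards [h ω hω] with ξ hξ
    rw [inv_smul_dilation, (dilation l).symm_apply_apply]
    exact hξ

open Lp in
lemma IsModifiedFourierTransform.isSliceFourier [CompleteSpace W] [SFinite dω]
    {lam : P.𝔞 →ₗ[ℝ] ℂ} {f : P.V → W}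
    {F : EuclideanSpace ℝ (Fin l) → P.OrbitSpace → W}
    (h : P.IsModifiedFourierTransform e dω s lam f F) :
    IsSliceFourier dω (fun p : EuclideanSpace ℝ (Fin l) × P.OrbitSpace => P.twist e s lam f p.2 p.1)
        (fun p => F (dilation l p.1) p.2) ∧
      AEStronglyMeasurable (fun p : EuclideanSpace ℝ (Fin l) × P.OrbitSpace =>
        F (dilation l p.1) p.2) (volume.prod dω) := by
  refine ⟨h.2.mono ?_, ?_⟩
  · rintro ω ⟨hf, hω⟩
    refine ⟨hf, ?_⟩
    have h1 := dualMeasure_absolutelyContinuous l hω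
    rw [dualMeasure_eq_map] at h1
    filter_upwards [((dilation l).measurableEmbedding.ae_map_iff).1 h1] with ξ hξ
    rw [hξ, inv_smul_dilation]
    rfl
  · exact h.1.comp_measurePreserving
      ((measurePreserving_dilation l).prod (MeasurePreserving.id dω))

end Main

end MinimalParabolic

end

/-! ### The coefficients on `A` as Fourier integrals. -/

theorem theorem4p1
    {G : Type*} [Group G] [TopologicalSpace G] [IsTopologicalGroup G]
    [MeasurableSpace G] [BorelSpace G] {N : ℕ} (S : SemisimpleLieGroup G N)
    (P : MinimalParabolic S) {l : ℕ} (e : EuclideanSpace ℝ (Fin l) ≃ₗ[ℝ] P.𝔞)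
    (w : G) (hw : P.RepresentsLongElement w)
    (dx : Measure P.V) [dx.IsHaarMeasure]
    {W : Type*} [NormedAddCommGroup W] [InnerProductSpace ℂ W] [FiniteDimensional ℂ W]
    (σ : P.M →* (W ≃ₗᵢ[ℂ] W)) (hσ : ∀ u : W, Continuous fun m : P.M => σ m u)
    (lam : P.𝔞 →ₗ[ℝ] ℂ) (hlam : ∀ a : P.A, ‖P.chi lam a‖ = 1) :
    (∃! dω : Measure P.OrbitSpace, P.IsQuotientMeasure e w dx dω) ∧
    (∃ s : P.OrbitSpace → P.V', P.IsSection s) ∧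
    ∀ dω : Measure P.OrbitSpace, P.IsQuotientMeasure e w dx dω →
    ∀ s : P.OrbitSpace → P.V', P.IsSection s →
    ∀ f g : P.AdaptedSpace W w dx,
      (∃ F, P.IsModifiedFourierTransform e dω s lam f F) ∧
      (∃ F, P.IsModifiedFourierTransform e dω s (P.contragredient lam) g F) ∧
      ∀ f' g' : EuclideanSpace ℝ (Fin l) → P.OrbitSpace → W,
        P.IsModifiedFourierTransform e dω s lam f f' →
        P.IsModifiedFourierTransform e dω s (P.contragredient lam) g g' →
        (∀ᵐ υ ∂(MinimalParabolic.dualMeasure l),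
          Integrable (fun ω => inner ℂ (g' υ ω) (f' υ ω)) dω) ∧
        Integrable (fun υ => ∫ ω, inner ℂ (g' υ ω) (f' υ ω) ∂dω)
          (MinimalParabolic.dualMeasure l) ∧
        ∀ a : P.A,
          Integrable (P.coeffIntegrand w σ lam f g (a : G)) (P.invMeasure w dx) ∧
          P.coeff w dx σ lam f g (a : G) =
            ∫ υ, Complex.exp (-(Complex.I * (inner ℝ υ (e.symm (P.log a)) : ℝ))) *
              (∫ ω, inner ℂ (g' υ ω) (f' υ ω) ∂dω) ∂(MinimalParabolic.dualMeasure l) := by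
  have : CompleteSpace W := FiniteDimensional.complete ℂ W
  refine ⟨?_, P.exists_isSection, ?_⟩
  · obtain ⟨dω, -, hq⟩ := hw.exists_isQuotientMeasure e dx
    exact ⟨dω, hq, fun dω' h => MinimalParabolic.IsQuotientMeasure.eq e dx h hq⟩
  intro dω hq s hs f g
  have : SFinite dω := hw.sFinite_of_isQuotientMeasure e dx hq
  have hfm := Lp.stronglyMeasurable f
  have hgm := Lp.stronglyMeasurable g
  have hF := MinimalParabolic.memLp_twist e hw dx hq hs hlam hfm (Lp.memLp f)
  have hG := MinimalParabolic.memLp_twist e hw dx hq hs hlam hgm (Lp.memLp g)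
  refine ⟨MinimalParabolic.exists_isModifiedFourierTransform e hs lam hfm hF,
    MinimalParabolic.exists_isModifiedFourierTransform e hs _ hgm
      (by rwa [MinimalParabolic.twist_contragredient e s hlam]), ?_⟩
  intro f' g' hf' hg'
  obtain ⟨hΦ, hΦm⟩ := hf'.isSliceFourier
  obtain ⟨hΓ, hΓm⟩ := hg'.isSliceFourier
  rw [MinimalParabolic.twist_contragredient e s hlam] at hΓ
  -- Joint integrability on `ℝ^ℓ × A \ V'` yields both the absolute convergence of `m(λ, υ)` for
  -- almost every `υ` and the integrability of `m(λ, ·)`.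
  have hi := (hΓ.memLp hΓm hG).integrable_inner_two (hΦ.memLp hΦm hF)
  have hδ := (MinimalParabolic.dilation l).measurableEmbedding
  rw [MinimalParabolic.dualMeasure_eq_map]
  refine ⟨hδ.ae_map_iff.2 hi.prod_right_ae, hδ.integrable_map_iff.2 hi.integral_prod_left, ?_⟩
  intro a
  have hae := MinimalParabolic.coeffIntegrand_ae_eq hw dx lam σ f g a
  have hmp := hw.measurePreserving e dx hq hs
  have hm : StronglyMeasurable fun x : P.V =>
      (inner ℂ (g x) (P.chi lam a • f (a⁻¹ • x)) : ℂ) :=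
    hgm.inner ((hfm.comp_measurable (MinimalParabolic.continuous_smul_V a⁻¹).measurable).const_smul
      (P.chi lam a))
  have hcomp := MinimalParabolic.inner_translate e (s := s) hlam f g a
  constructor
  · refine (integrable_congr hae).2 ((hmp.integrable_comp hm.aestronglyMeasurable).1 ?_)
    exact (hG.integrable_inner_two (hF.translate (e.symm (P.log a)))).congr
      (ae_of_all _ fun p => (hcomp p).symm)
  · rw [MinimalParabolic.coeff, integral_congr_ae hae,
      ← hmp.integral_comp_of_aestronglyMeasurable hm.aestronglyMeasurable]
    simp only [hcomp]
    -- In the coordinates of the section the coefficient is the pairing with a translate by `e.symm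
    -- (log a)`; Plancherel evaluates it, and the dilation restores the variable `υ = 2π ξ`.
    rw [← hΦ.integral_eq hΓ hΦm hΓm hF hG (e.symm (P.log a)), hδ.integral_map]
    refine integral_congr_ae (ae_of_all _ fun ξ => ?_)
    simp only
    congr 1
    rw [Real.fourierChar_apply, MinimalParabolic.dilation_apply, real_inner_smul_left]
    congr 1
    push_cast
    ring
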